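/- Let $d$ be an odd prime, $\chi(t)=e^{2\pi i t/d}$, and for $n\ge 0$ let $\Omega_n=(\mathbb Z_d^2)^n$ be the phase space with points $x=(q,p)$ and symplectic form $\omega(x,y)=\sum_i(q(x)_ip(y)_i-p(x)_iq(y)_i)$. **Epistricted theory.** $\mathbf{Rel}$ is the dagger compact category of sets and relations (tensor $=$ cartesian product, dagger $=$ converse, compact structure $=$ diagonal). $\mathbf{Spek}_d$ consists of the relations between phase spaces generated under composition, cartesian product and converse by the toy unit $\{p=0\}\subseteq\Omega_1$, the toy multiplication $(q,p)\cdot(q,p')=(q,p+p')$ on $\Omega_1$ (undefined for different positions; for $d=3$ this is the theory of trits on the nine points of $\Omega_1$), the affine symplectic permutations of $\Omega_1$, and the structural isomorphisms. $\mathbf{Frob}(\mathbf{Spek}_d)$ has as objects the special dagger Frobenius algebras $A=(\Omega_n,m,e)$ in $\mathbf{Rel}$ with $m,e\in\mathbf{Spek}_d$, and as morphisms the relations in $\mathbf{Spek}_d$ which are morphisms of Frobenius algebras: $r\subseteq X\times Y$ equals the set of componentwise products of its elements and is compatible with the involutions (i.e. $r$ is a subgroupoid). These form a category. **Stabilizer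 quantum mechanics.** For $f:\Omega_n\to\mathbb C$ let $\mathcal Ff$ be the operator on $\mathbb C^{d^n}$ with kernel $$\mathcal Ff(x,y)=d^{-n}\sum_{b\in\mathbb Z_d^n}f\bigl(\tfrac{x+y}2,b\bigr)\,\chi\bigl(b\cdot(x-y)\bigr),$$ and let $W(u)=\mathcal F(\chi(\omega(u,\cdot)))$. Stabilizer operations are the linear maps $\mathbb C^{d^n}\to\mathbb C^{d^k}$ generated by $|0\rangle$, the Clifford unitaries (those normalizing the $W(u)$ up to phase) and scalars under composition, tensor product, adjoint and permutation of tensor factors. $\mathbf{Frob}(\mathbf{Stab}_d)$ has as objects the special dagger Frobenius algebras in finite dimensional Hilbert spaces together with an algebra isomorphism $\pi$ onto the operator algebra $M_{d^n}(\mathbb C)$ such that $\langle a,b\rangle=d^n\operatorname{tr}(\pi(a)^\dagger\pi(b))$, and as morphisms the superoperators $\rho\mapsto K\rho K^\dagger$ with $K$ a stabilizer operation, modulo multiplication by positive scalars. **Quantization.** Let $\mathcal A_n$ be the space of polarized functions on the pair groupoid $\Omega_n\times\Omega_n$, i.e. of functions $a$ with $a(x+v,y+v)=\chi(\tfrac12\omega(v,x-y))\,a(x,y)$,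 with the convolution $(ab)(x,z)=\sum_ya(x,y)b(y,z)$, the unit $\delta_{x=y}$ and the inner product of $\ell^2(\Omega_n\times\Omega_n)$. The symbol of $a$ is $f_a(z)=\sum_ua(u,0)\chi(\omega(u,z))$, and $\pi_n(a)=\mathcal F(f_a)$. For a relation $r$ from $\Omega_n$ to $\Omega_k$ let $\mathcal Q(r):\mathcal A_n\to\mathcal A_k$ be push-forward of symbols, $f\mapsto\bigl(y\mapsto\sum_{x\sim_ry}f(x)\bigr)$. **Theorem (Main result for the finite case).** 1. For every $n$, the componentwise toy multiplication and unit make $\Omega_n$ an object of $\mathbf{Frob}(\mathbf{Spek}_d)$. 2. For every object $A=(\Omega_n,m,e)$ of $\mathbf{Frob}(\mathbf{Spek}_d)$, $m$ is the composition of a groupoid with identity arrows $e$, and it is a symplectic groupoid: the graph $\{(xy,x,y)\}$ is an affine Lagrangian subspace of $\Omega_n\oplus\bar\Omega_n\oplus\bar\Omega_n$. 3. The relation $h$, $x\sim(a,b)$ iff $a\cdot x=b$, is an injective homomorphism from $A$ (multiplication and unit) to the endomorphism monoid of $\Omega_n$, i.e. to the pair groupoid $(x,y)(y,z)=(x,z)$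 with unit the diagonal; here injective means $h^\dagger\circ h=1$. 4. The pair groupoid with the form $\omega\ominus\omega$ is a symplectic groupoid, and the common kernel of the functionals $q_1-q_2$, $p_1-p_2$ is a groupoid polarization of it (a Lagrangian subspace closed under composition and inversion). 5. $a\mapsto f_a$ is a bijection from $\mathcal A_n$ to the functions on $\Omega_n$, with inverse $f\mapsto\bigl((x,y)\mapsto\chi(\tfrac12\omega(y,x))\,|\Omega_n|^{-1}\sum_zf(z)\chi(\omega(z,x-y))\bigr)$; moreover $\pi_n(a)=\sum_ua(u,0)W(u)$ and $W(u)W(v)=\chi(\tfrac12\omega(v,u))W(u+v)$, so that $\mathcal A_n$ is the twisted group algebra of the finite Heisenberg group. 6. For affine symplectic transformations $\tau,\tau'$ of $\Omega_n$, $\mathcal Q(\tau'\tau)=\mathcal Q(\tau')\mathcal Q(\tau)$ exactly; $\mathcal Q(\tau)$ preserves product, unit and inner product of $\mathcal A_n$, and under $\pi_n$ it is conjugation by a Clifford unitary. 7. For every object $A=(\Omega_n,m,e)$ of $\mathbf{Frob}(\mathbf{Spek}_d)$ there is a special dagger Frobenius algebra $(\mathbb C^{d^n},\mu,\varepsilon)$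 in Hilbert spaces, with $\mu$ and $\varepsilon$ stabilizer operations, such that push-forward along $m$ and along $e$ corresponds under $\mathcal F$ to positive multiples of $\rho\mapsto\mu\rho\mu^\dagger$ and $\rho\mapsto\varepsilon\rho\varepsilon^\dagger$. 8. $\mathcal A_n$ is a special dagger Frobenius algebra in Hilbert spaces, $(\mathcal A_n,\pi_n)$ is an object of $\mathbf{Frob}(\mathbf{Stab}_d)$, $\mathcal Q(r)$ is the superoperator of a stabilizer operation for every $r\in\mathbf{Spek}_d$, and $$A=(\Omega_n,m,e)\longmapsto(\mathcal A_n,\pi_n),\qquad r\longmapsto[\mathcal Q(r)]$$ is a functor $\mathbf{Frob}(\mathbf{Spek}_d)\to\mathbf{Frob}(\mathbf{Stab}_d)$. -/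

import Mathlib

open scoped TensorProduct Matrix
open CategoryTheory

namespace EpiQuant

/-! ### Relations: the dagger compact category of sets and relations

Composition is `SetRel.comp` (in diagrammatic order), the dagger is `SetRel.inv`, the tensor
product is the cartesian product. -/

/-- The cartesian (tensor) product of two relations. -/
def prodRel {A B C D : Type} (r : SetRel A B) (s : SetRel C D) : SetRel (A × C) (B × D) :=
  {p | (p.1.1, p.2.1) ∈ r ∧ (p.1.2, p.2.2) ∈ s}

/-- The graph of a bijection. -/
def graphRel {A B : Type} (f : A ≃ B) : SetRel A B := {p | f p.1 = p.2}

/-- The compact structure `1 → X × X` of `Rel`, i.e. the diagonal. -/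
def cup (X : Type) : SetRel Unit (X × X) := {p | p.2.1 = p.2.2}

/-- The transpose `⌈r⌉ = (1 × r) ∘ η : 1 → X × Y` of `r : X → Y`. -/
def nameRel {X Y : Type} (r : SetRel X Y) : SetRel Unit (X × Y) :=
  (cup X).comp (prodRel SetRel.id r)

/-- `(X, m)` is a special dagger Frobenius algebra in `Rel` with unit `e : 1 → X`. -/
structure IsRelFrobenius {X : Type} (m : SetRel (X × X) X) (e : SetRel Unit X) : Prop where
  frob_left : ((prodRel m.inv SetRel.id).comp (graphRel (Equiv.prodAssoc X X X))).comp
      (prodRel SetRel.id m) = m.comp m.inv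
  frob_right : ((prodRel SetRel.id m.inv).comp (graphRel (Equiv.prodAssoc X X X).symm)).comp
      (prodRel m SetRel.id) = m.comp m.inv
  special : m.inv.comp m = SetRel.id
  assoc : ((graphRel (Equiv.prodAssoc X X X)).comp (prodRel SetRel.id m)).comp m =
      (prodRel m SetRel.id).comp m
  unit_left : ((graphRel (Equiv.punitProd X).symm).comp (prodRel e SetRel.id)).comp m = SetRel.id
  unit_right : ((graphRel (Equiv.prodPUnit X).symm).comp (prodRel SetRel.id e)).comp m = SetRel.id

/-- Morphisms of Frobenius algebras in `Rel`: `⌈r⌉` is closed under the multiplication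
(and every element of it is a product), and `r` commutes with the involutions. -/
structure IsRelFrobHom {X Y : Type} (mX : SetRel (X × X) X) (eX : SetRel Unit X)
    (mY : SetRel (Y × Y) Y) (eY : SetRel Unit Y) (r : SetRel X Y) : Prop where
  mul : (((graphRel (Equiv.punitProd Unit).symm).comp (prodRel (nameRel r) (nameRel r))).comp
      (graphRel (Equiv.prodProdProdComm X Y X Y))).comp (prodRel mX mY) = nameRel r
  inv : (((((graphRel (Equiv.punitProd X).symm).comp (prodRel eX SetRel.id)).comp
      (prodRel mX.inv SetRel.id)).comp (graphRel (Equiv.prodAssoc X X X))).comp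
      (prodRel r (cup X).inv)).comp (graphRel (Equiv.prodPUnit Y)) =
    (((((graphRel (Equiv.prodPUnit X).symm).comp (prodRel r (cup Y))).comp
      (graphRel (Equiv.prodAssoc Y Y Y).symm)).comp (prodRel mY SetRel.id)).comp
      (prodRel eY.inv SetRel.id)).comp (graphRel (Equiv.punitProd Y))

/-- The subset of `X` named by a relation `1 → X`. -/
def elems {X : Type} (e : SetRel Unit X) : Set X := {u | ((), u) ∈ e}

/-- `m` and `U` are the composition and the set of identity arrows of a groupoid with set of
arrows `X`: the source, target and inverse relations built from `m` and `U` are functions. -/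
structure IsGroupoid {X : Type} (m : SetRel (X × X) X) (U : Set X) : Prop where
  single_valued : ∀ f g h h', ((f, g), h) ∈ m → ((f, g), h') ∈ m → h = h'
  source : ∀ f, ∃! x, x ∈ U ∧ (f, x) ∈ m.dom
  target : ∀ f, ∃! y, y ∈ U ∧ (y, f) ∈ m.dom
  composable : ∀ f g, (f, g) ∈ m.dom ↔ ∃ x ∈ U, (f, x) ∈ m.dom ∧ (x, g) ∈ m.dom
  unit_right : ∀ f, ∀ x ∈ U, ∀ h, ((f, x), h) ∈ m → h = f
  unit_left : ∀ f, ∀ y ∈ U, ∀ h, ((y, f), h) ∈ m → h = f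
  assoc : ∀ f g h k, (∃ a, ((f, g), a) ∈ m ∧ ((a, h), k) ∈ m) ↔
    ∃ b, ((g, h), b) ∈ m ∧ ((f, b), k) ∈ m
  inverse : ∀ f, ∃! g, (∃ u ∈ U, ((f, g), u) ∈ m) ∧ ∃ u ∈ U, ((g, f), u) ∈ m

/-- The composition `(x, y) · (y, z) = (x, z)` of the pair groupoid; its identity arrows form
the diagonal. This is also the multiplication `1 × η† × 1` of the endomorphism monoid. -/
def pairMul (X : Type) : SetRel ((X × X) × (X × X)) (X × X) :=
  {p | p.1.1.2 = p.1.2.1 ∧ p.2 = (p.1.1.1, p.1.2.2)}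

/-- The embedding `h : X → X × X` of a Frobenius algebra in its endomorphism monoid, which is
the multiplication with one leg bent: `x ∼ (a, b)` iff `a · x = b`. -/
def endEmbedding {X : Type} (m : SetRel (X × X) X) : SetRel X (X × X) :=
  {p | ((p.2.1, p.1), p.2.2) ∈ m}

/-! ### Discrete phase space -/

section Phase
variable (d : ℕ) [Fact d.Prime]

/-- Phase space of a system with one degree of freedom for each element of `ι`:
`(x i).1` is the `i`-th position and `(x i).2` is the `i`-th momentum. -/
abbrev Ph (ι : Type) : Type := ι → ZMod d × ZMod d

/-- Configuration space. -/
abbrev Conf (ι : Type) : Type := ι → ZMod d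

/-- The symplectic form `ω(x, y) = ∑ᵢ (q(x)ᵢ p(y)ᵢ - p(x)ᵢ q(y)ᵢ)`. -/
def symp (ι : Type) [Fintype ι] : LinearMap.BilinForm (ZMod d) (Ph d ι) :=
  LinearMap.mk₂ (ZMod d) (fun x y => ∑ i, ((x i).1 * (y i).2 - (x i).2 * (y i).1))
    (by intro x x' y; rw [← Finset.sum_add_distrib]
        exact Finset.sum_congr rfl fun i _ => by simp; ring)
    (by intro c x y; rw [smul_eq_mul, Finset.mul_sum]
        exact Finset.sum_congr rfl fun i _ => by simp; ring)
    (by intro x y y'; rw [← Finset.sum_add_distrib]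
        exact Finset.sum_congr rfl fun i _ => by simp; ring)
    (by intro c x y; rw [smul_eq_mul, Finset.mul_sum]
        exact Finset.sum_congr rfl fun i _ => by simp; ring)

/-- Affine symplectic transformations `x ↦ S x + v`. -/
def IsAffineSymplectic {ι : Type} [Fintype ι] (τ : Ph d ι ≃ Ph d ι) : Prop :=
  ∃ (S : Ph d ι →ₗ[ZMod d] Ph d ι) (v : Ph d ι),
    (∀ x y, symp d ι (S x) (S y) = symp d ι x y) ∧ ∀ x, τ x = S x + v

/-- Difference `B₁ ⊖ B₂` of bilinear forms on a direct sum. -/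
def formSub {V W : Type} [AddCommGroup V] [Module (ZMod d) V] [AddCommGroup W]
    [Module (ZMod d) W] (B₁ : LinearMap.BilinForm (ZMod d) V)
    (B₂ : LinearMap.BilinForm (ZMod d) W) : LinearMap.BilinForm (ZMod d) (V × W) :=
  B₁.compl₁₂ (LinearMap.fst _ V W) (LinearMap.fst _ V W) -
    B₂.compl₁₂ (LinearMap.snd _ V W) (LinearMap.snd _ V W)

/-- Sum `B₁ ⊕ B₂` of bilinear forms on a direct sum. -/
def formAdd {V W : Type} [AddCommGroup V] [Module (ZMod d) V] [AddCommGroup W]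
    [Module (ZMod d) W] (B₁ : LinearMap.BilinForm (ZMod d) V)
    (B₂ : LinearMap.BilinForm (ZMod d) W) : LinearMap.BilinForm (ZMod d) (V × W) :=
  B₁.compl₁₂ (LinearMap.fst _ V W) (LinearMap.fst _ V W) +
    B₂.compl₁₂ (LinearMap.snd _ V W) (LinearMap.snd _ V W)

/-- A symplectic groupoid on a finite vector space `V` of arrows: `B` is a symplectic form, and
the graph `{(fg, f, g)}` of the multiplication is an (affine) Lagrangian subspace of
`V ⊕ V̄ ⊕ V̄`. -/
structure IsSymplecticGroupoid {V : Type} [AddCommGroup V] [Module (ZMod d) V]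
    (B : LinearMap.BilinForm (ZMod d) V) (m : SetRel (V × V) V) (U : Set V) : Prop where
  alt : B.IsAlt
  nondegenerate : B.Nondegenerate
  groupoid : IsGroupoid m U
  lagrangian : ∃ (a : V × (V × V)) (L : Submodule (ZMod d) (V × (V × V))),
    (formSub d B (formAdd d B B)).orthogonal L = L ∧
      {p : V × (V × V) | (p.2, p.1) ∈ m} = {p | p - a ∈ L}

/-- A (translation invariant) polarization of a symplectic groupoid: a Lagrangian subspace which
is closed under the composition and the inversion of the groupoid. -/
structure IsGroupoidPolarization {V : Type} [AddCommGroup V] [Module (ZMod d) V]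
    (B : LinearMap.BilinForm (ZMod d) V) (m : SetRel (V × V) V) (U : Set V)
    (P : Submodule (ZMod d) V) : Prop where
  lagrangian : B.orthogonal P = P
  mul_mem : ∀ f ∈ P, ∀ g ∈ P, ∀ h, ((f, g), h) ∈ m → h ∈ P
  inv_mem : ∀ f ∈ P, ∀ g, (∃ u ∈ U, ((f, g), u) ∈ m) → g ∈ P

/-- The leaf direction of the polarization of the pair groupoid of phase space: the common kernel
of all the functionals `q₁ - q₂` and `p₁ - p₂`. -/
def pairPolarization (ι : Type) : Submodule (ZMod d) (Ph d ι × Ph d ι) :=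
  LinearMap.ker (LinearMap.fst (ZMod d) (Ph d ι) (Ph d ι) - LinearMap.snd (ZMod d) _ _)

/-! ### The category of the epistricted theory -/

/-- The toy multiplication: `(q, p) · (q', p')` is defined iff `q = q'`, and then it is
`(q, p + p')`. -/
def toyMul (ι : Type) : SetRel (Ph d ι × Ph d ι) (Ph d ι) :=
  {t | ∀ i, (t.1.1 i).1 = (t.1.2 i).1 ∧ t.2 i = ((t.1.1 i).1, (t.1.1 i).2 + (t.1.2 i).2)}

/-- The unit of the toy multiplication: the points at which all momenta vanish. -/
def toyUnit (ι : Type) : SetRel Unit (Ph d ι) := {t | ∀ i, (t.2 i).2 = 0}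

/-- A multiplication relation on phase space as a relation from the doubled system. -/
def joinRel {ι : Type} (m : SetRel (Ph d ι × Ph d ι) (Ph d ι)) : SetRel (Ph d (ι ⊕ ι)) (Ph d ι) :=
  {t | ((t.1 ∘ Sum.inl, t.1 ∘ Sum.inr), t.2) ∈ m}

/-- A relation from the one-element set as a relation from the trivial system. -/
def stateRel {ι : Type} (e : SetRel Unit (Ph d ι)) : SetRel (Ph d Empty) (Ph d ι) :=
  {t | ((), t.2) ∈ e}

/-- Parallel composition of processes. -/
def tensorRel {ι κ ι' κ' : Type} (r : SetRel (Ph d ι) (Ph d κ)) (s : SetRel (Ph d ι') (Ph d κ')) :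
    SetRel (Ph d (ι ⊕ ι')) (Ph d (κ ⊕ κ')) :=
  {t | (t.1 ∘ Sum.inl, t.2 ∘ Sum.inl) ∈ r ∧ (t.1 ∘ Sum.inr, t.2 ∘ Sum.inr) ∈ s}

/-- Renaming (permuting) the elementary systems; this covers the identities and the associativity,
unit and symmetry isomorphisms. -/
def relabelRel {ι κ : Type} (f : ι ≃ κ) : SetRel (Ph d ι) (Ph d κ) := {t | ∀ i, t.2 (f i) = t.1 i}

/-- The morphisms of `Spek`: the relations obtained by composition, cartesian product and converse
from the toy unit and multiplication of one elementary system, the affine symplectic permutations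
of its phase space and the structural isomorphisms. -/
inductive Spek : {ι κ : Type} → SetRel (Ph d ι) (Ph d κ) → Prop
  | unit : Spek (stateRel d (toyUnit d Unit))
  | mul : Spek (joinRel d (toyMul d Unit))
  | affine (τ : Ph d Unit ≃ Ph d Unit) (h : IsAffineSymplectic d τ) : Spek (graphRel τ)
  | relabel {ι κ : Type} [Finite ι] (f : ι ≃ κ) : Spek (relabelRel d f)
  | comp {ι κ l : Type} {r : SetRel (Ph d ι) (Ph d κ)} {s : SetRel (Ph d κ) (Ph d l)} :
      Spek r → Spek s → Spek (r.comp s)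
  | tensor {ι κ ι' κ' : Type} {r : SetRel (Ph d ι) (Ph d κ)} {s : SetRel (Ph d ι') (Ph d κ')} :
      Spek r → Spek s → Spek (tensorRel d r s)
  | converse {ι κ : Type} {r : SetRel (Ph d ι) (Ph d κ)} : Spek r → Spek r.inv

/-- A special dagger Frobenius algebra of the epistricted theory with `n` degrees of freedom. -/
structure EpiFrob where
  n : ℕ
  mul : SetRel (Ph d (Fin n) × Ph d (Fin n)) (Ph d (Fin n))
  unit : SetRel Unit (Ph d (Fin n))
  isFrob : IsRelFrobenius mul unit
  mul_spek : Spek d (joinRel d mul)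
  unit_spek : Spek d (stateRel d unit)

/-- A morphism of Frobenius algebras of the epistricted theory. -/
@[ext]
structure EpiFrobHom (A B : EpiFrob d) where
  rel : SetRel (Ph d (Fin A.n)) (Ph d (Fin B.n))
  isHom : IsRelFrobHom A.mul A.unit B.mul B.unit rel
  spek : Spek d rel

end Phase

/-! ### Frobenius algebras of the epistricted theory form a category

(Composites of Frobenius morphisms between arbitrary Frobenius algebras in `Rel` need not be
Frobenius morphisms; inside `Spek` they are.) -/



/-! ### Frobenius algebras of the epistricted theory form a category

Composites of Frobenius morphisms between arbitrary Frobenius algebras in `Rel` need not be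
Frobenius morphisms; inside `Spek` they are, because all relations there are affine. -/

section RelFacts
variable {X Y Z : Type}

theorem IsRelFrobenius.frob_iff {m : SetRel (X × X) X} {e : SetRel Unit X}
    (h : IsRelFrobenius m e) (a b p q : X) :
    (∃ c, ((p, c), a) ∈ m ∧ ((c, b), q) ∈ m) ↔ ∃ z, ((a, b), z) ∈ m ∧ ((p, q), z) ∈ m := by
  have := Set.ext_iff.1 h.frob_left ((a, b), (p, q))
  simpa [prodRel, graphRel, SetRel.comp, SetRel.inv, SetRel.id] using this

theorem IsRelFrobenius.single {m : SetRel (X × X) X} {e : SetRel Unit X}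
    (h : IsRelFrobenius m e) {a b z z' : X} (h1 : ((a, b), z) ∈ m) (h2 : ((a, b), z') ∈ m) :
    z = z' := by
  have := (Set.ext_iff.1 h.special (z, z')).1 ⟨(a, b), h1, h2⟩
  simpa [SetRel.id] using this

theorem IsRelFrobenius.assoc_iff {m : SetRel (X × X) X} {e : SetRel Unit X}
    (h : IsRelFrobenius m e) (a b c w : X) :
    (∃ t, ((b, c), t) ∈ m ∧ ((a, t), w) ∈ m) ↔ ∃ t, ((a, b), t) ∈ m ∧ ((t, c), w) ∈ m := by
  have := Set.ext_iff.1 h.assoc (((a, b), c), w)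
  simpa [prodRel, graphRel, SetRel.comp, SetRel.inv, SetRel.id] using this

theorem IsRelFrobenius.left_iff {m : SetRel (X × X) X} {e : SetRel Unit X}
    (h : IsRelFrobenius m e) (a b : X) : (∃ u, ((), u) ∈ e ∧ ((u, a), b) ∈ m) ↔ a = b := by
  have := Set.ext_iff.1 h.unit_left (a, b)
  simpa [prodRel, graphRel, SetRel.comp, SetRel.inv, SetRel.id] using this

theorem IsRelFrobenius.right_iff {m : SetRel (X × X) X} {e : SetRel Unit X}
    (h : IsRelFrobenius m e) (a b : X) : (∃ u, ((), u) ∈ e ∧ ((a, u), b) ∈ m) ↔ a = b := by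
  have := Set.ext_iff.1 h.unit_right (a, b)
  simpa [prodRel, graphRel, SetRel.comp, SetRel.inv, SetRel.id] using this

/-- Existence of inverses. -/
theorem IsRelFrobenius.exists_inv {m : SetRel (X × X) X} {e : SetRel Unit X}
    (h : IsRelFrobenius m e) (x : X) : ∃ c v u, ((), v) ∈ e ∧ ((), u) ∈ e ∧
      ((x, c), v) ∈ m ∧ ((c, x), u) ∈ m ∧ ((v, x), x) ∈ m ∧ ((x, u), x) ∈ m := by
  obtain ⟨v, hv, hvx⟩ := (h.left_iff x x).2 rfl
  obtain ⟨u, hu, hux⟩ := (h.right_iff x x).2 rfl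
  obtain ⟨c, h1, h2⟩ := (h.frob_iff v x x u).2 ⟨x, hvx, hux⟩
  exact ⟨c, v, u, hv, hu, h1, h2, hvx, hux⟩

/-- Targets are unique. -/
theorem IsRelFrobenius.target_unique {m : SetRel (X × X) X} {e : SetRel Unit X}
    (h : IsRelFrobenius m e) {x u v : X} (hu : ((), u) ∈ e) (hv : ((), v) ∈ e)
    (hux : ((u, x), x) ∈ m) (hvx : ((v, x), x) ∈ m) : u = v := by
  obtain ⟨t, ht, -⟩ := (h.assoc_iff u v x x).1 ⟨x, hvx, hux⟩
  exact ((h.right_iff u t).1 ⟨v, hv, ht⟩).trans ((h.left_iff v t).1 ⟨u, hu, ht⟩).symm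

/-- The source of `x` is the target of `y` if `x y` is defined. -/
theorem IsRelFrobenius.source_eq_target {m : SetRel (X × X) X} {e : SetRel Unit X}
    (h : IsRelFrobenius m e) {x y z u v : X} (hu : ((), u) ∈ e) (hv : ((), v) ∈ e)
    (hxy : ((x, y), z) ∈ m) (hxu : ((x, u), x) ∈ m) (hvy : ((v, y), y) ∈ m) : u = v := by
  obtain ⟨t, ht, -⟩ := (h.assoc_iff x u y z).2 ⟨x, hxu, hxy⟩
  have : y = t := (h.left_iff y t).1 ⟨u, hu, ht⟩
  subst this
  exact h.target_unique hu hv ht hvy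

/-- Sources are unique. -/
theorem IsRelFrobenius.source_unique {m : SetRel (X × X) X} {e : SetRel Unit X}
    (h : IsRelFrobenius m e) {x u v : X} (hu : ((), u) ∈ e) (hv : ((), v) ∈ e)
    (hxu : ((x, u), x) ∈ m) (hxv : ((x, v), x) ∈ m) : u = v := by
  obtain ⟨t, ht, -⟩ := (h.assoc_iff x u v x).2 ⟨x, hxu, hxv⟩
  exact ((h.right_iff u t).1 ⟨v, hv, ht⟩).trans ((h.left_iff v t).1 ⟨u, hu, ht⟩).symm

/-- Inverses are unique. -/
theorem IsRelFrobenius.inv_unique {m : SetRel (X × X) X} {e : SetRel Unit X}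
    (h : IsRelFrobenius m e) {x y c u w : X} (hu : ((), u) ∈ e) (hw : ((), w) ∈ e)
    (hxy : ((x, y), w) ∈ m) (hcx : ((c, x), u) ∈ m) (hxu : ((x, u), x) ∈ m) : c = y := by
  obtain ⟨t, ht, hty⟩ := (h.assoc_iff x u y w).2 ⟨x, hxu, hxy⟩
  have : y = t := (h.left_iff y t).1 ⟨u, hu, ht⟩
  subst this
  obtain ⟨t, ht1, ht2⟩ := (h.assoc_iff c x y y).2 ⟨u, hcx, ht⟩
  have htw : t = w := h.single ht1 hxy
  subst htw
  exact (h.right_iff c y).1 ⟨t, hw, ht2⟩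

/-- One-sided inverses are two-sided. -/
theorem IsRelFrobenius.inv_comm {m : SetRel (X × X) X} {e : SetRel Unit X}
    (h : IsRelFrobenius m e) {x y : X} (hxy : ∃ u, ((), u) ∈ e ∧ ((x, y), u) ∈ m) :
    ∃ u, ((), u) ∈ e ∧ ((y, x), u) ∈ m := by
  obtain ⟨w, hw, hxyw⟩ := hxy
  obtain ⟨c, v, u, hv, hu, hxc, hcx, hvx, hxu⟩ := h.exists_inv x
  have := h.inv_unique hu hw hxyw hcx hxu
  subst this
  exact ⟨u, hu, hcx⟩

/-- The conditions on a morphism of Frobenius algebras in terms of elements. -/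
theorem isRelFrobHom_iff {mX : SetRel (X × X) X} {eX : SetRel Unit X}
    {mY : SetRel (Y × Y) Y} {eY : SetRel Unit Y} {r : SetRel X Y} :
    IsRelFrobHom mX eX mY eY r ↔
      (∀ x y, (∃ a a' b b', ((a, b) ∈ r ∧ (a', b') ∈ r) ∧
        ((a, a'), x) ∈ mX ∧ ((b, b'), y) ∈ mY) ↔ (x, y) ∈ r) ∧
      (∀ x y, (∃ a, (∃ u, ((), u) ∈ eX ∧ ((a, x), u) ∈ mX) ∧ (a, y) ∈ r) ↔
        ∃ b, (x, b) ∈ r ∧ ∃ u, ((), u) ∈ eY ∧ ((b, y), u) ∈ mY) := by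
  have key1 : ∀ x y, ((∃ a a' b b', ((a, b) ∈ r ∧ (a', b') ∈ r) ∧
        ((a, a'), x) ∈ mX ∧ ((b, b'), y) ∈ mY) ↔ (x, y) ∈ r) ↔
      (((), (x, y)) ∈ (((graphRel (Equiv.punitProd Unit).symm).comp
        (prodRel (nameRel r) (nameRel r))).comp
        (graphRel (Equiv.prodProdProdComm X Y X Y))).comp (prodRel mX mY) ↔
      ((), (x, y)) ∈ nameRel r) := by
    intro x y
    simp [prodRel, graphRel, SetRel.comp, SetRel.id, nameRel, cup]
  have key2 : ∀ x y, ((∃ a, (∃ u, ((), u) ∈ eX ∧ ((a, x), u) ∈ mX) ∧ (a, y) ∈ r) ↔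
        ∃ b, (x, b) ∈ r ∧ ∃ u, ((), u) ∈ eY ∧ ((b, y), u) ∈ mY) ↔
      ((x, y) ∈ (((((graphRel (Equiv.punitProd X).symm).comp (prodRel eX SetRel.id)).comp
      (prodRel mX.inv SetRel.id)).comp (graphRel (Equiv.prodAssoc X X X))).comp
      (prodRel r (cup X).inv)).comp (graphRel (Equiv.prodPUnit Y)) ↔
      (x, y) ∈ (((((graphRel (Equiv.prodPUnit X).symm).comp (prodRel r (cup Y))).comp
      (graphRel (Equiv.prodAssoc Y Y Y).symm)).comp (prodRel mY SetRel.id)).comp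
      (prodRel eY.inv SetRel.id)).comp (graphRel (Equiv.punitProd Y))) := by
    intro x y
    simp only [prodRel, graphRel, SetRel.comp, SetRel.inv, SetRel.id, cup]
    simp
    refine iff_congr Iff.rfl ⟨?_, ?_⟩
    · rintro ⟨b, h1, u, h2, h3⟩
      exact ⟨(), u, ⟨b, h1, h3⟩, h2⟩
    · rintro ⟨_, u, ⟨b, h1, h3⟩, h2⟩
      exact ⟨b, h1, u, h2, h3⟩
  constructor
  · intro h
    exact ⟨fun x y => (key1 x y).2 (by rw [h.mul]), fun x y => (key2 x y).2 (by rw [h.inv])⟩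
  · rintro ⟨h1, h2⟩
    exact ⟨Set.ext fun ⟨_, x, y⟩ => (key1 x y).1 (h1 x y),
      Set.ext fun ⟨x, y⟩ => (key2 x y).1 (h2 x y)⟩

/-- A relation between abelian groups is affine: closed under `a - b + c`. -/
def IsAffineRel [AddCommGroup X] [AddCommGroup Y] (r : SetRel X Y) : Prop :=
  ∀ a ∈ r, ∀ b ∈ r, ∀ c ∈ r, a - b + c ∈ r

theorem isRelFrobHom_id {m : SetRel (X × X) X} {e : SetRel Unit X} (h : IsRelFrobenius m e) :
    IsRelFrobHom m e m e SetRel.id := by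
  refine isRelFrobHom_iff.2 ⟨fun x y => ?_, fun x y => ?_⟩
  · constructor
    · rintro ⟨a, a', b, b', ⟨h1, h2⟩, h3, h4⟩
      simp only [SetRel.mem_id] at h1 h2
      subst h1 h2
      exact h.single h3 h4
    · intro hxy
      simp only [SetRel.mem_id] at hxy
      subst hxy
      obtain ⟨u, hu, hxu⟩ := (h.right_iff x x).2 rfl
      exact ⟨x, u, x, u, ⟨rfl, rfl⟩, hxu, hxu⟩
  · simp only [SetRel.mem_id]
    constructor
    · rintro ⟨a, ha, rfl⟩
      exact ⟨x, rfl, h.inv_comm ha⟩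
    · rintro ⟨b, rfl, hb⟩
      exact ⟨y, h.inv_comm hb, rfl⟩

/-- Frobenius morphisms are closed under taking sources and targets. -/
theorem IsRelFrobHom.unit_mem {mX : SetRel (X × X) X} {eX : SetRel Unit X}
    {mY : SetRel (Y × Y) Y} {eY : SetRel Unit Y} {r : SetRel X Y}
    (h : IsRelFrobHom mX eX mY eY r) (hX : IsRelFrobenius mX eX) (hY : IsRelFrobenius mY eY)
    {x u u' : X} {y v v' : Y} (hxy : (x, y) ∈ r) (hu : ((), u) ∈ eX) (hv : ((), v) ∈ eY)
    (hu' : ((), u') ∈ eX) (hv' : ((), v') ∈ eY) (hxu : ((x, u), x) ∈ mX)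
    (hyv : ((y, v), y) ∈ mY) (hux : ((u', x), x) ∈ mX) (hvy : ((v', y), y) ∈ mY) :
    (u, v) ∈ r ∧ (u', v') ∈ r := by
  obtain ⟨hm, hi⟩ := isRelFrobHom_iff.1 h
  obtain ⟨x', u1, u2, hu1, hu2, h1, h2, h3, h4⟩ := hX.exists_inv x
  obtain ⟨y', v1, v2, hv1, hv2, k1, k2, k3, k4⟩ := hY.exists_inv y
  obtain ⟨b, hb, hbw⟩ := (hi x' y).1 ⟨x, ⟨u1, hu1, h1⟩, hxy⟩
  obtain ⟨w, hw, hyb⟩ := hY.inv_comm hbw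
  obtain rfl : y' = b := hY.inv_unique hv2 hw hyb k2 k4
  obtain rfl := hX.target_unique hu' hu1 hux h3
  obtain rfl := hX.source_unique hu hu2 hxu h4
  obtain rfl := hY.target_unique hv' hv1 hvy k3
  obtain rfl := hY.source_unique hv hv2 hyv k4
  exact ⟨(hm u v).1 ⟨x', x, y', y, ⟨hb, hxy⟩, h2, k2⟩,
    (hm u' v').1 ⟨x, x', y, y', ⟨hxy, hb⟩, h1, k1⟩⟩

/-- Affine Frobenius morphisms compose. -/
theorem IsRelFrobHom.comp [AddCommGroup X] [AddCommGroup Y] [AddCommGroup Z]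
    {mX : SetRel (X × X) X} {eX : SetRel Unit X} {mY : SetRel (Y × Y) Y} {eY : SetRel Unit Y}
    {mZ : SetRel (Z × Z) Z} {eZ : SetRel Unit Z} {r : SetRel X Y} {s : SetRel Y Z}
    (hX : IsRelFrobenius mX eX) (hY : IsRelFrobenius mY eY) (hZ : IsRelFrobenius mZ eZ)
    (hmY : IsAffineRel mY) (har : IsAffineRel r)
    (hr : IsRelFrobHom mX eX mY eY r) (has : IsAffineRel s) (hs : IsRelFrobHom mY eY mZ eZ s) :
    IsRelFrobHom mX eX mZ eZ (r.comp s) := by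
  obtain ⟨rm, ri⟩ := isRelFrobHom_iff.1 hr
  obtain ⟨sm, si⟩ := isRelFrobHom_iff.1 hs
  refine isRelFrobHom_iff.2 ⟨fun x z => ⟨?_, ?_⟩, fun x z => ⟨?_, ?_⟩⟩
  · rintro ⟨x1, x2, z1, z2, ⟨⟨y1, h1, k1⟩, ⟨y2, h2, k2⟩⟩, hx, hz⟩
    obtain ⟨-, u1, u, hu1, hu, -, -, hux1, hxu1⟩ := hX.exists_inv x1
    obtain ⟨-, u', u2, hu', hu2, -, -, hux2, hxu2⟩ := hX.exists_inv x2
    obtain ⟨y1', a1, a, ha1, ha, -, hy1', hay1, hya1⟩ := hY.exists_inv y1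
    obtain ⟨-, b, b2, hb, hb2, -, -, hby2, hyb2⟩ := hY.exists_inv y2
    obtain ⟨-, w1, w, hw1, hw, -, -, hwz1, hzw1⟩ := hZ.exists_inv z1
    obtain ⟨-, w', w2, hw', hw2, -, -, hwz2, hzw2⟩ := hZ.exists_inv z2
    obtain rfl := hX.source_eq_target hu hu' hx hxu1 hux2
    obtain rfl := hZ.source_eq_target hw hw' hz hzw1 hwz2
    have r1 := (hr.unit_mem hX hY h1 hu ha hu1 ha1 hxu1 hya1 hux1 hay1).1
    have r2 := (hr.unit_mem hX hY h2 hu2 hb2 hu' hb hxu2 hyb2 hux2 hby2).2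
    have s1 := (hs.unit_mem hY hZ k1 ha hw ha1 hw1 hya1 hzw1 hay1 hwz1).1
    have s2 := (hs.unit_mem hY hZ k2 hb2 hw2 hb hw' hyb2 hzw2 hby2 hwz2).2
    -- translate `y2` so that its target becomes the source of `y1`
    have r3 : (x2, y2 - b + a) ∈ r := by
      simpa using har _ h2 _ r2 _ r1
    have s3 : (y2 - b + a, z2) ∈ s := by
      simpa using has _ k2 _ s2 _ s1
    have hunit : ∀ c, ((), c) ∈ eY → ((c, c), c) ∈ mY := by
      intro c hc
      obtain ⟨t, ht, hct⟩ := (hY.right_iff c c).2 rfl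
      obtain rfl := (hY.left_iff t c).1 ⟨c, hc, hct⟩
      exact hct
    have m3 : ((a, y2 - b + a), y2 - b + a) ∈ mY := by
      simpa using hmY _ hby2 _ (hunit b hb) _ (hunit a ha)
    obtain ⟨y, hy, -⟩ := (hY.assoc_iff y1' y1 (y2 - b + a) _).2 ⟨a, hy1', m3⟩
    exact ⟨y, (rm x y).1 ⟨x1, x2, y1, _, ⟨h1, r3⟩, hx, hy⟩,
      (sm y z).1 ⟨y1, _, z1, z2, ⟨k1, s3⟩, hy, hz⟩⟩
  · rintro ⟨y, h1, k1⟩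
    obtain ⟨-, u1, u, hu1, hu, -, -, hux, hxu⟩ := hX.exists_inv x
    obtain ⟨-, a1, a, ha1, ha, -, -, hay, hya⟩ := hY.exists_inv y
    obtain ⟨-, w1, w, hw1, hw, -, -, hwz, hzw⟩ := hZ.exists_inv z
    exact ⟨x, u, z, w, ⟨⟨y, h1, k1⟩,
      ⟨a, (hr.unit_mem hX hY h1 hu ha hu1 ha1 hxu hya hux hay).1,
        (hs.unit_mem hY hZ k1 ha hw ha1 hw1 hya hzw hay hwz).1⟩⟩, hxu, hzw⟩
  · rintro ⟨a, ha, y, h1, h2⟩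
    obtain ⟨b, hb, hby⟩ := (ri x y).1 ⟨a, ha, h1⟩
    obtain ⟨c, hc, hcz⟩ := (si b z).1 ⟨y, hY.inv_comm hby, h2⟩
    exact ⟨c, ⟨b, hb, hc⟩, hcz⟩
  · rintro ⟨c, ⟨b, hb, hc⟩, hcz⟩
    obtain ⟨y, hby, h2⟩ := (si b z).2 ⟨c, hc, hcz⟩
    obtain ⟨a, ha, h1⟩ := (ri x y).2 ⟨b, hb, hY.inv_comm hby⟩
    exact ⟨a, ha, y, h1, h2⟩

end RelFacts

section SpekCategory
variable (d : ℕ) [Fact d.Prime]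

theorem Spek.isAffineRel {ι κ : Type} {r : SetRel (Ph d ι) (Ph d κ)} (h : Spek d r) :
    IsAffineRel r := by
  induction h with
  | unit =>
    intro a ha b hb c hc i
    have h1 := ha i; have h2 := hb i; have h3 := hc i
    simp at h1 h2 h3 ⊢
    simp [h1, h2, h3]
  | mul =>
    intro a ha b hb c hc i
    obtain ⟨h1, k1⟩ := ha i; obtain ⟨h2, k2⟩ := hb i; obtain ⟨h3, k3⟩ := hc i
    simp at h1 h2 h3 k1 k2 k3 ⊢
    simp [h1, h2, h3, k1, k2, k3]
    ring
  | affine τ hτ =>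
    obtain ⟨S, v, -, hS⟩ := hτ
    intro a ha b hb c hc
    simp only [graphRel, Set.mem_ofPred_eq, hS] at ha hb hc ⊢
    simp [← ha, ← hb, ← hc]
    abel
  | relabel f =>
    intro a ha b hb c hc i
    simp [ha i, hb i, hc i]
  | comp _ _ hr hs =>
    rintro ⟨a, a'⟩ ⟨x, h1, k1⟩ ⟨b, b'⟩ ⟨y, h2, k2⟩ ⟨c, c'⟩ ⟨z, h3, k3⟩
    exact ⟨x - y + z, hr _ h1 _ h2 _ h3, hs _ k1 _ k2 _ k3⟩
  | tensor _ _ hr hs =>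
    intro a ha b hb c hc
    exact ⟨hr _ ha.1 _ hb.1 _ hc.1, hs _ ha.2 _ hb.2 _ hc.2⟩
  | converse _ hr =>
    intro a ha b hb c hc
    exact hr _ ha _ hb _ hc

theorem EpiFrob.isAffineRel_mul (A : EpiFrob d) : IsAffineRel A.mul := by
  intro a ha b hb c hc
  have := Spek.isAffineRel d A.mul_spek (Sum.elim a.1.1 a.1.2, a.2) ha
    (Sum.elim b.1.1 b.1.2, b.2) hb (Sum.elim c.1.1 c.1.2, c.2) hc
  exact this

theorem Spek.id (ι : Type) [Finite ι] : Spek d (SetRel.id : SetRel (Ph d ι) (Ph d ι)) := by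
  have : (SetRel.id : SetRel (Ph d ι) (Ph d ι)) = relabelRel d (Equiv.refl ι) := by
    ext ⟨x, y⟩
    simp only [SetRel.mem_id, relabelRel, Set.mem_ofPred_eq, Equiv.refl_apply]
    exact ⟨fun h i => by rw [h], fun h => (funext h).symm⟩
  rw [this]
  exact Spek.relabel _

/-- The category of special dagger Frobenius algebras in `Rel` of the epistricted theory. -/
instance : Category (EpiFrob d) where
  Hom A B := EpiFrobHom d A B
  id A := ⟨SetRel.id, isRelFrobHom_id A.isFrob, Spek.id d _⟩
  comp {A B C} r s := ⟨r.rel.comp s.rel,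
    IsRelFrobHom.comp A.isFrob B.isFrob C.isFrob B.isAffineRel_mul (Spek.isAffineRel d r.spek)
      r.isHom (Spek.isAffineRel d s.spek) s.isHom, Spek.comp r.spek s.spek⟩
  id_comp _ := EpiFrobHom.ext (SetRel.id_comp _)
  comp_id _ := EpiFrobHom.ext (SetRel.comp_id _)
  assoc _ _ _ := EpiFrobHom.ext (SetRel.comp_assoc _ _ _)

end SpekCategory

/-! ### Dagger Frobenius algebras in `Hilb` -/

/-- `mul` and `unit` make the finite dimensional Hilbert space `H` a special dagger Frobenius
algebra. -/
structure IsHilbFrobenius {H : Type} [NormedAddCommGroup H] [InnerProductSpace ℂ H]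
    [FiniteDimensional ℂ H] (mul : H ⊗[ℂ] H →ₗ[ℂ] H) (unit : H) : Prop where
  frob_left : mul.lTensor H ∘ₗ (TensorProduct.assoc ℂ H H H).toLinearMap ∘ₗ
      (LinearMap.adjoint mul).rTensor H = LinearMap.adjoint mul ∘ₗ mul
  frob_right : mul.rTensor H ∘ₗ (TensorProduct.assoc ℂ H H H).symm.toLinearMap ∘ₗ
      (LinearMap.adjoint mul).lTensor H = LinearMap.adjoint mul ∘ₗ mul
  special : mul ∘ₗ LinearMap.adjoint mul = LinearMap.id
  assoc : mul ∘ₗ mul.lTensor H ∘ₗ (TensorProduct.assoc ℂ H H H).toLinearMap =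
      mul ∘ₗ mul.rTensor H
  unit_left : ∀ a, mul (unit ⊗ₜ[ℂ] a) = a
  unit_right : ∀ a, mul (a ⊗ₜ[ℂ] unit) = a

noncomputable section Quantum
variable (d : ℕ) [Fact d.Prime]

/-- The additive character `χ(t) = exp(2πi t / d)`. -/
def chi (t : ZMod d) : ℂ := ZMod.stdAddChar t

/-- The discrete Fourier transform (Weyl correspondence): a function `f` on phase space is sent
to the operator on `ℂ^(dⁿ)` with kernel
`(x, y) ↦ d⁻ⁿ ∑_b f((x + y) / 2, b) χ(b · (x - y))`. -/
def weylOp {ι : Type} [Fintype ι] [DecidableEq ι] (f : Ph d ι → ℂ) :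
    Matrix (Conf d ι) (Conf d ι) ℂ :=
  fun x y => (Fintype.card (Conf d ι) : ℂ)⁻¹ *
    ∑ b : Conf d ι, f (fun i => ((x i + y i) * 2⁻¹, b i)) * chi d (∑ i, b i * (x i - y i))

/-- The displacement (Weyl, Pauli) operator with label `u`. -/
def displacement {ι : Type} [Fintype ι] [DecidableEq ι] (u : Ph d ι) :
    Matrix (Conf d ι) (Conf d ι) ℂ :=
  weylOp d fun z => chi d (symp d ι u z)

/-- Clifford unitaries: those which normalize the displacement operators up to phases. -/
def IsClifford {ι : Type} [Fintype ι] [DecidableEq ι] (U : Matrix (Conf d ι) (Conf d ι) ℂ) :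
    Prop :=
  U ∈ Matrix.unitaryGroup (Conf d ι) ℂ ∧
    ∀ u, ∃ (v : Ph d ι) (c : ℂ), U * displacement d u * Uᴴ = c • displacement d v

/-- Stabilizer quantum mechanics: the linear maps between the spaces `ℂ^(dⁿ)` (as matrices)
generated by the computational basis state `|0⟩`, the Clifford unitaries and the scalars, under
composition, tensor product, adjoint and permutations of the tensor factors. -/
inductive Stab : {ι κ : Type} → Matrix (Conf d κ) (Conf d ι) ℂ → Prop
  | ket0 : Stab (ι := Empty) (κ := Unit) (fun x _ => if x () = 0 then 1 else 0)
  | clifford {ι : Type} [Fintype ι] [DecidableEq ι] (U : Matrix (Conf d ι) (Conf d ι) ℂ)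
      (h : IsClifford d U) : Stab U
  | relabel {ι κ : Type} [Fintype ι] [DecidableEq ι] (f : ι ≃ κ) :
      Stab (ι := ι) (κ := κ) (fun y x => if y ∘ f = x then 1 else 0)
  | smul {ι κ : Type} (c : ℂ) {K : Matrix (Conf d κ) (Conf d ι) ℂ} : Stab K → Stab (c • K)
  | comp {ι κ l : Type} [Fintype κ] [DecidableEq κ] {K : Matrix (Conf d κ) (Conf d ι) ℂ}
      {L : Matrix (Conf d l) (Conf d κ) ℂ} : Stab K → Stab L → Stab (L * K)
  | tensor {ι κ ι' κ' : Type} {K : Matrix (Conf d κ) (Conf d ι) ℂ}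
      {L : Matrix (Conf d κ') (Conf d ι') ℂ} : Stab K → Stab L →
      Stab (ι := ι ⊕ ι') (κ := κ ⊕ κ')
        (fun y x => K (y ∘ Sum.inl) (x ∘ Sum.inl) * L (y ∘ Sum.inr) (x ∘ Sum.inr))
  | adjoint {ι κ : Type} {K : Matrix (Conf d κ) (Conf d ι) ℂ} : Stab K → Stab Kᴴ

/-- `rep` identifies the dagger Frobenius algebra `(H, mul, unit)` with the algebra of all operators
on `ℂ^(dⁿ)`, its Hilbert space structure being the one given by `dⁿ` times the trace. -/
structure IsOperatorRep (n : ℕ) {H : Type} [NormedAddCommGroup H] [InnerProductSpace ℂ H]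
    (mul : H ⊗[ℂ] H →ₗ[ℂ] H) (unit : H)
    (rep : H →ₗ[ℂ] Matrix (Conf d (Fin n)) (Conf d (Fin n)) ℂ) : Prop where
  bijective : Function.Bijective rep
  map_mul : ∀ a b, rep (mul (a ⊗ₜ[ℂ] b)) = rep a * rep b
  map_unit : rep unit = 1
  inner_eq : ∀ a b, inner ℂ a b = (d : ℂ) ^ n * ((rep a)ᴴ * rep b).trace

/-- Special dagger Frobenius algebras in `Hilb` for stabilizer quantum mechanics: those which are
identified with the operator algebra of a system of `n` qudits. -/
structure StabFrob where
  n : ℕ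
  H : Type
  [instNormed : NormedAddCommGroup H]
  [instInner : InnerProductSpace ℂ H]
  [instFinite : FiniteDimensional ℂ H]
  mul : H ⊗[ℂ] H →ₗ[ℂ] H
  unit : H
  isFrob : IsHilbFrobenius mul unit
  rep : H →ₗ[ℂ] Matrix (Conf d (Fin n)) (Conf d (Fin n)) ℂ
  isRep : IsOperatorRep d n mul unit rep

attribute [instance] StabFrob.instNormed StabFrob.instInner StabFrob.instFinite

/-- `T` is the superoperator `ρ ↦ K ρ K†` of a stabilizer operation `K`. -/
def IsStabSuperop {n k : ℕ} {H H' : Type} [AddCommGroup H] [Module ℂ H] [AddCommGroup H']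
    [Module ℂ H'] (rep : H →ₗ[ℂ] Matrix (Conf d (Fin n)) (Conf d (Fin n)) ℂ)
    (rep' : H' →ₗ[ℂ] Matrix (Conf d (Fin k)) (Conf d (Fin k)) ℂ) (T : H →ₗ[ℂ] H') : Prop :=
  ∃ K : Matrix (Conf d (Fin k)) (Conf d (Fin n)) ℂ, Stab d K ∧ ∀ a, rep' (T a) = K * rep a * Kᴴ

/-- Morphisms: superoperators of stabilizer operations. -/
@[ext]
structure StabFrobHom (A B : StabFrob d) where
  map : A.H →ₗ[ℂ] B.H
  isSuperop : IsStabSuperop d A.rep B.rep map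

theorem Stab.one (ι : Type) [Fintype ι] [DecidableEq ι] :
    Stab d (1 : Matrix (Conf d ι) (Conf d ι) ℂ) := by
  have : (1 : Matrix (Conf d ι) (Conf d ι) ℂ) =
      fun y x => if y ∘ (Equiv.refl ι) = x then 1 else 0 := by
    ext y x
    simp [Matrix.one_apply]
  rw [this]
  exact Stab.relabel _

instance : Category (StabFrob d) where
  Hom A B := StabFrobHom d A B
  id A := ⟨LinearMap.id, 1, Stab.one d _, fun a => by simp⟩
  comp S T := ⟨T.map ∘ₗ S.map, by
    obtain ⟨K, hK, hS⟩ := S.isSuperop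
    obtain ⟨L, hL, hT⟩ := T.isSuperop
    exact ⟨L * K, Stab.comp hK hL, fun a => by
      simp [hS, hT, Matrix.conjTranspose_mul, Matrix.mul_assoc]⟩⟩

/-- Two superoperators are identified if they differ by a positive scalar (normalization). -/
def posScale : HomRel (StabFrob d) :=
  fun _ _ S T => ∃ c : ℝ, 0 < c ∧ StabFrobHom.map T = (c : ℂ) • StabFrobHom.map S

/-! ### The quantization of phase space -/

section Quantization
variable (ι : Type) [Fintype ι] [DecidableEq ι]

theorem chi_add (s t : ZMod d) : chi d (s + t) = chi d s * chi d t :=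
  AddChar.map_add_eq_mul _ _ _

/-- The polarized functions on the pair groupoid of phase space: the sections of the (trivial)
prequantum line bundle which are covariantly constant along the leaves of the polarization, the
parallel transport from `(x, y)` to `(x + v, y + v)` being the phase `χ(ω(v, x - y) / 2)`. -/
def polarized : Submodule ℂ (EuclideanSpace ℂ (Ph d ι × Ph d ι)) where
  carrier := {a | ∀ x y v, a (x + v, y + v) = chi d (2⁻¹ * symp d ι v (x - y)) * a (x, y)}
  zero_mem' := by intro x y v; simp
  add_mem' := by
    intro a b ha hb x y v
    simp [ha x y v, hb x y v, mul_add]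
  smul_mem' := by
    intro c a ha x y v
    simp [ha x y v]
    ring

/-- Convolution on the pair groupoid preserves polarized functions. -/
theorem convolution_mem (a b : polarized d ι) :
    (WithLp.toLp 2 fun p : Ph d ι × Ph d ι => ∑ y, a.1 (p.1, y) * b.1 (y, p.2)) ∈
      polarized d ι := by
  intro x z v
  simp only [Finset.mul_sum]
  rw [← Equiv.sum_comp (Equiv.addRight v)]
  refine Finset.sum_congr rfl fun y _ => ?_
  simp only [Equiv.coe_addRight]
  rw [a.2 x y v, b.2 y z v]
  have : x - z = (x - y) + (y - z) := by abel
  rw [this, map_add, mul_add, chi_add]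
  ring

/-- The twisted polarized convolution algebra of the pair groupoid: its multiplication. -/
def polMul : polarized d ι ⊗[ℂ] polarized d ι →ₗ[ℂ] polarized d ι :=
  TensorProduct.lift (LinearMap.mk₂ ℂ
    (fun a b => (⟨WithLp.toLp 2 fun p => ∑ y, a.1 (p.1, y) * b.1 (y, p.2),
      convolution_mem d ι a b⟩ : polarized d ι))
    (by intro a a' b; ext p; simp [add_mul, Finset.sum_add_distrib])
    (by intro c a b; ext p; simp [Finset.mul_sum, mul_assoc])
    (by intro a b b'; ext p; simp [mul_add, Finset.sum_add_distrib])
    (by intro c a b; ext p; simp [Finset.mul_sum]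
        exact Finset.sum_congr rfl fun _ _ => by ring))

/-- The unit of the polarized convolution algebra: the characteristic function of the diagonal,
i.e. of the identity arrows. -/
def polUnit : polarized d ι :=
  ⟨WithLp.toLp 2 fun p => if p.1 = p.2 then 1 else 0, by
    intro x y v
    by_cases h : x = y
    · simp [h, chi]
    · simp [h]⟩

variable {ι}

/-- The phase space function (Weyl symbol) of a polarized function: the symplectic Fourier
transform of its restriction to the arrows with source `0`. -/
def symbol : polarized d ι →ₗ[ℂ] (Ph d ι → ℂ) where
  toFun a := fun z => ∑ u, a.1 (u, 0) * chi d (symp d ι u z)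
  map_add' a b := by ext z; simp [add_mul, Finset.sum_add_distrib]
  map_smul' c a := by ext z; simp [Finset.mul_sum, mul_assoc]

/-- The quantization of a function on phase space as a polarized function on the pair groupoid;
this is the inverse of `symbol`. -/
def quantize : (Ph d ι → ℂ) →ₗ[ℂ] polarized d ι where
  toFun f := ⟨WithLp.toLp 2 fun p => chi d (2⁻¹ * symp d ι p.2 p.1) *
      ((Fintype.card (Ph d ι) : ℂ)⁻¹ * ∑ z, f z * chi d (symp d ι z (p.1 - p.2))), by
    intro x y v
    have hx : symp d ι (y + v) (x + v) = symp d ι v (x - y) + symp d ι y x := by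
      simp only [symp, LinearMap.mk₂_apply, ← Finset.sum_add_distrib]
      exact Finset.sum_congr rfl fun i _ => by simp; ring
    simp only [hx, mul_add, chi_add, add_sub_add_right_eq_sub]
    ring⟩
  map_add' f g := by ext p; simp [add_mul, Finset.sum_add_distrib, mul_add]
  map_smul' c f := by
    ext p
    simp only [Pi.smul_apply, smul_eq_mul, mul_assoc, ← Finset.mul_sum, RingHom.id_apply,
      Submodule.coe_smul, PiLp.smul_apply]
    ring

open Classical in
/-- Push-forward of functions along a relation. -/
def push {ι κ : Type} [Fintype ι] [DecidableEq ι] (r : SetRel (Ph d ι) (Ph d κ)) :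
    (Ph d ι → ℂ) →ₗ[ℂ] (Ph d κ → ℂ) where
  toFun f := fun y => ∑ x, if (x, y) ∈ r then f x else 0
  map_add' f g := by
    ext y
    simp only [Pi.add_apply, ← Finset.sum_add_distrib]
    exact Finset.sum_congr rfl fun x _ => by split_ifs <;> simp
  map_smul' c f := by
    ext y
    simp [Finset.mul_sum]

/-- The quantization of a relation between phase spaces. -/
def quantMap {ι κ : Type} [Fintype ι] [DecidableEq ι] [Fintype κ] [DecidableEq κ]
    (r : SetRel (Ph d ι) (Ph d κ)) : polarized d ι →ₗ[ℂ] polarized d κ :=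
  quantize d ∘ₗ push d r ∘ₗ symbol d

/-- The representation of the polarized convolution algebra by operators on `ℂ^(dⁿ)`, by means of
the discrete Fourier transform. -/
def polRep : polarized d ι →ₗ[ℂ] Matrix (Conf d ι) (Conf d ι) ℂ where
  toFun a := weylOp d (symbol d a)
  map_add' a b := by
    ext x y
    simp [weylOp, add_mul, Finset.sum_add_distrib, mul_add]
  map_smul' c a := by
    ext x y
    simp only [weylOp, map_smul, Pi.smul_apply, smul_eq_mul, Matrix.smul_apply, mul_assoc,
      ← Finset.mul_sum, RingHom.id_apply]
    ring

end Quantization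

/-- The object of stabilizer quantum mechanics which quantizes a Frobenius algebra with `n` degrees
of freedom: the twisted polarized convolution algebra of the pair groupoid of its phase space. -/
def quantObj (n : ℕ) (hF : IsHilbFrobenius (polMul d (Fin n)) (polUnit d (Fin n)))
    (hR : IsOperatorRep d n (polMul d (Fin n)) (polUnit d (Fin n)) (polRep d)) : StabFrob d where
  n := n
  H := polarized d (Fin n)
  mul := polMul d (Fin n)
  unit := polUnit d (Fin n)
  isFrob := hF
  rep := polRep d
  isRep := hR

/-- The superoperator which quantizes a relation, as a morphism of Frobenius algebras of stabilizer
quantum mechanics. -/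
def quantHom {n k : ℕ} (hF : ∀ n, IsHilbFrobenius (polMul d (Fin n)) (polUnit d (Fin n)))
    (hR : ∀ n, IsOperatorRep d n (polMul d (Fin n)) (polUnit d (Fin n)) (polRep d))
    (r : SetRel (Ph d (Fin n)) (Ph d (Fin k)))
    (hS : IsStabSuperop d (polRep d) (polRep d) (quantMap d r)) :
    quantObj d n (hF n) (hR n) ⟶ quantObj d k (hF k) (hR k) :=
  StabFrobHom.mk (quantMap d r) hS

/-- A binary operation on `ℂ^(dⁿ)` as a matrix. -/
def mulMatrix {n : ℕ} (mul : EuclideanSpace ℂ (Conf d (Fin n)) ⊗[ℂ]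
    EuclideanSpace ℂ (Conf d (Fin n)) →ₗ[ℂ] EuclideanSpace ℂ (Conf d (Fin n))) :
    Matrix (Conf d (Fin n)) (Conf d (Fin n ⊕ Fin n)) ℂ :=
  fun z x => mul (EuclideanSpace.single (x ∘ Sum.inl) 1 ⊗ₜ[ℂ]
    EuclideanSpace.single (x ∘ Sum.inr) 1) z

/-- A vector of `ℂ^(dⁿ)` as a one-column matrix. -/
def vecMatrix {n : ℕ} (e : EuclideanSpace ℂ (Conf d (Fin n))) :
    Matrix (Conf d (Fin n)) (Conf d Empty) ℂ :=
  fun z _ => e z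

end Quantum

end EpiQuant

namespace EpiQuant

/-! ### Groupoids from Frobenius algebras in `Rel` -/

section Groupoid
variable {X : Type} {m : SetRel (X × X) X} {e : SetRel Unit X}

/-! On the classical side everything follows from two closure properties of `Spek`: each of its
relations is affine, and each is empty or an affine Lagrangian subspace for `ω ⊖ ω`. A special
dagger Frobenius algebra in `Rel` is a groupoid, the Frobenius law supplying both composability and
inverses. When its multiplication lies in `Spek`, the graph is nonempty and hence affine Lagrangian,
which is the symplectic groupoid condition. The embedding in the pair groupoid is Cayley's theorem
for groupoids: an arrow acts by translation, and translations can be cancelled.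

On the quantum side the Weyl correspondence is a linear bijection from functions on phase space to
operators, an isometry up to scale, which takes the characters `χ(ω(u, ·))` to the displacement
operators (`displacement_mul`, `trace_weylOp_mul`, `weylLin_bijective`). The central notion is
`Represents`: push-forward along a relation `r` becomes a positive multiple of `ρ ↦ K ρ K†`. It is
compatible with composition, tensor product and converse, and `K` is unique up to a nonzero scalar.
Affine symplectic maps are represented because they induce unital `*`-endomorphisms of a matrix
algebra, which are implemented by unitaries (`exists_unitary_of_starHom`). The toy unit and the toy
multiplication are composites of such maps with the position state `|0⟩`. By induction every
relation of `Spek` is represented by a stabilizer operation (`Spek.exists_stab`).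

Uniqueness turns the Frobenius equations between relations into equations between operators up to
unknown scalars. The unit laws force the associativity and Frobenius scalars to be `1`, and
rescaling the multiplication and unit normalizes the rest (`exists_isFrobeniusKernel_smul`).

The polarized functions form the twisted group algebra of phase space: a polarized function is
determined by its values on the arrows with source `0`, and the phase from parallel transport is
exactly the cocycle of the displacement operators. Quantization is functorial only up to a positive
scalar, because iterated push-forward counts intermediate points; affineness makes this count
constant wherever it is nonzero (`push_comp`). -/

theorem IsRelFrobenius.isGroupoid (h : IsRelFrobenius m e) : IsGroupoid m (elems e) := by
  have right : ∀ {f x k}, ((), x) ∈ e → ((f, x), k) ∈ m → k = f :=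
    fun hx hk => ((h.right_iff _ _).1 ⟨_, hx, hk⟩).symm
  have left : ∀ {f x k}, ((), x) ∈ e → ((x, f), k) ∈ m → k = f :=
    fun hx hk => ((h.left_iff _ _).1 ⟨_, hx, hk⟩).symm
  refine ⟨fun f g k k' => h.single, fun f => ?_, fun f => ?_, fun f g => ⟨?_, ?_⟩,
    fun f x hx k => right hx, fun f x hx k => left hx, fun f g k w => (h.assoc_iff f g k w).symm,
    fun f => ?_⟩
  · obtain ⟨u, hu, hfu⟩ := (h.right_iff f f).2 rfl
    refine ⟨u, ⟨hu, f, hfu⟩, ?_⟩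
    rintro v ⟨hv, w, hfv⟩
    obtain rfl := right hv hfv
    exact h.source_unique hv hu hfv hfu
  · obtain ⟨u, hu, hfu⟩ := (h.left_iff f f).2 rfl
    refine ⟨u, ⟨hu, f, hfu⟩, ?_⟩
    rintro v ⟨hv, w, hfv⟩
    obtain rfl := left hv hfv
    exact h.target_unique hv hu hfv hfu
  · rintro ⟨k, hk⟩
    obtain ⟨u, hu, hfu⟩ := (h.right_iff f f).2 rfl
    obtain ⟨v, hv, hgv⟩ := (h.left_iff g g).2 rfl
    obtain rfl := h.source_eq_target hu hv hk hfu hgv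
    exact ⟨u, hu, ⟨f, hfu⟩, g, hgv⟩
  · rintro ⟨x, hx, ⟨f', hf⟩, g', hg⟩
    obtain rfl := right hx hf
    obtain rfl := left hx hg
    -- The Frobenius law with both pairs equal to `(f, g)`: the common identity arrow `x` splits
    -- them, so they have a product.
    obtain ⟨t, ht, ht'⟩ := (h.frob_iff f' g' f' g').1 ⟨x, hf, hg⟩
    exact ⟨t, ht⟩
  · obtain ⟨c, v, u, hv, hu, hfc, hcf, hvf, hfu⟩ := h.exists_inv f
    refine ⟨c, ⟨⟨v, hv, hfc⟩, u, hu, hcf⟩, ?_⟩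
    rintro y ⟨⟨w, hw, hfy⟩, -⟩
    exact (h.inv_unique hu hw hfy hcf hfu).symm

/-- Associativity `a (x y) = (a x) y`: right translations compose, the intermediate endpoint being
`a x`. -/
theorem IsRelFrobenius.mul_comp_endEmbedding (h : IsRelFrobenius m e) :
    m.comp (endEmbedding m) =
      (prodRel (endEmbedding m) (endEmbedding m)).comp (pairMul X) := by
  ext ⟨⟨x, y⟩, a, b⟩
  have := h.assoc_iff a x y b
  simp only [SetRel.mem_comp, endEmbedding, prodRel, pairMul, Set.mem_ofPred_eq, Prod.exists]
  rw [this]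
  constructor
  · rintro ⟨t, h1, h2⟩
    exact ⟨a, t, t, b, ⟨h1, h2⟩, rfl, rfl⟩
  · rintro ⟨a', t, t', b', ⟨h1, h2⟩, h3, h4⟩
    simp only [Prod.mk.injEq] at h3 h4
    obtain ⟨rfl, rfl⟩ := h4
    subst h3
    exact ⟨_, h1, h2⟩

theorem IsRelFrobenius.unit_comp_endEmbedding (h : IsRelFrobenius m e) :
    e.comp (endEmbedding m) = cup X := by
  ext ⟨_, a, b⟩
  simpa [SetRel.mem_comp, endEmbedding, cup] using h.right_iff a b

/-- Left cancellation: if `a x = a y`, multiply by the inverse of `a`. Conversely every `x` is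
related to itself through its target identity. -/
theorem IsRelFrobenius.endEmbedding_comp_inv (h : IsRelFrobenius m e) :
    (endEmbedding m).comp (endEmbedding m).inv = SetRel.id := by
  ext ⟨x, y⟩
  simp only [SetRel.mem_comp, endEmbedding, SetRel.mem_inv, Set.mem_ofPred_eq, Prod.exists,
    SetRel.mem_id]
  constructor
  · rintro ⟨a, b, h1, h2⟩
    obtain ⟨c, v, u, hv, hu, -, hca, -, hau⟩ := h.exists_inv a
    have key : ∀ {z}, ((a, z), b) ∈ m → ((c, b), z) ∈ m := by
      intro z hz
      obtain ⟨w, hw, hwz⟩ := (h.left_iff z z).2 rfl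
      obtain rfl := h.source_eq_target hu hw hz hau hwz
      obtain ⟨t, ht, ht'⟩ := (h.assoc_iff c a z z).2 ⟨u, hca, hwz⟩
      rwa [h.single hz ht]
    exact h.single (key h1) (key h2)
  · rintro rfl
    obtain ⟨u, hu, hux⟩ := (h.left_iff x x).2 rfl
    exact ⟨u, x, hux, hux⟩

end Groupoid

/-! ### The pair groupoid -/

section Pair
variable (X : Type)

theorem pairMul_isGroupoid : IsGroupoid (pairMul X) {p | p.1 = p.2} := by
  simp only [pairMul]
  refine ⟨?_, ?_, ?_, ?_, ?_, ?_, ?_, ?_⟩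
  · rintro f g k k' ⟨-, h⟩ ⟨-, h'⟩
    exact h.trans h'.symm
  · rintro ⟨x, y⟩
    refine ⟨(y, y), ⟨rfl, (x, y), rfl, rfl⟩, ?_⟩
    rintro ⟨z, w⟩ ⟨h, k, h', -⟩
    simp_all
  · rintro ⟨x, y⟩
    refine ⟨(x, x), ⟨rfl, (x, y), rfl, rfl⟩, ?_⟩
    rintro ⟨z, w⟩ ⟨h, k, h', -⟩
    simp_all
  · rintro ⟨x, y⟩ ⟨z, w⟩
    constructor
    · rintro ⟨k, h, -⟩
      exact ⟨(y, y), rfl, ⟨(x, y), rfl, rfl⟩, ⟨(y, w), h, rfl⟩⟩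
    · rintro ⟨⟨a, b⟩, h, ⟨k, h1, -⟩, l, h2, -⟩
      exact ⟨(x, w), Eq.trans h1 (Eq.trans h h2), rfl⟩
  · rintro ⟨x, y⟩ ⟨z, w⟩ h k ⟨h1, h2⟩
    simp_all
  · rintro ⟨x, y⟩ ⟨z, w⟩ h k ⟨h1, h2⟩
    simp_all
  · rintro ⟨x, y⟩ ⟨z, w⟩ ⟨s, t⟩ k
    simp only [Set.mem_ofPred_eq, Prod.exists, Prod.mk.injEq]
    constructor
    · rintro ⟨a, b, ⟨h1, rfl, rfl⟩, h2, rfl⟩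
      exact ⟨z, t, ⟨h2, rfl, rfl⟩, h1, rfl⟩
    · rintro ⟨a, b, ⟨h1, rfl, rfl⟩, h2, rfl⟩
      exact ⟨x, w, ⟨h2, rfl, rfl⟩, h1, rfl⟩
  · rintro ⟨x, y⟩
    refine ⟨(y, x), ⟨⟨(x, x), rfl, rfl, rfl⟩, (y, y), rfl, rfl, rfl⟩, ?_⟩
    rintro ⟨z, w⟩ ⟨⟨u, hu, h1, h2⟩, v, hv, h3, h4⟩
    simp_all

end Pair

/-! ### Affine Lagrangian relations and their closure properties -/

section SymplecticForm
variable (d : ℕ) [Fact d.Prime] {ι κ l : Type} [Fintype ι] [Fintype κ] [Fintype l]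

theorem symp_apply (x y : Ph d ι) :
    symp d ι x y = ∑ i, ((x i).1 * (y i).2 - (x i).2 * (y i).1) := rfl

theorem symp_swap (x y : Ph d ι) : symp d ι x y = -symp d ι y x := by
  simp only [symp_apply, ← Finset.sum_neg_distrib]
  exact Finset.sum_congr rfl fun _ _ => by ring

theorem symp_isAlt : (symp d ι).IsAlt := by
  intro x
  rw [symp_apply]
  exact Finset.sum_eq_zero fun _ _ => by ring

theorem eq_zero_of_symp {y : Ph d ι} (h : ∀ x, symp d ι x y = 0) : y = 0 := by
  classical
  ext i
  · have := h (Pi.single i (0, 1))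
    rw [symp_apply, Finset.sum_eq_single i (by intro j _ hj; simp [hj]) (by simp)] at this
    simpa using this
  · have := h (Pi.single i (1, 0))
    rw [symp_apply, Finset.sum_eq_single i (by intro j _ hj; simp [hj]) (by simp)] at this
    simpa using this

theorem eq_of_symp {y z : Ph d ι} (h : ∀ x, symp d ι x y = symp d ι x z) : y = z :=
  sub_eq_zero.1 (eq_zero_of_symp d fun x => by rw [map_sub, h, sub_self])

theorem symp_nondegenerate : (symp d ι).Nondegenerate :=
  ⟨fun x h => eq_zero_of_symp d fun y => by rw [symp_swap, h, neg_zero],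
    fun _ h => eq_zero_of_symp d h⟩

theorem exists_symp_eq (ψ : Ph d ι →ₗ[ZMod d] ZMod d) : ∃ y, ∀ x, symp d ι x y = ψ x := by
  -- The dual isomorphism places the vector in the first slot of the form; moving it to the second
  -- costs the sign.
  refine ⟨-((symp d ι).toDual (symp_nondegenerate d)).symm ψ, fun x => ?_⟩
  rw [map_neg, ← symp_swap, LinearMap.BilinForm.apply_toDual_symm_apply]

theorem formSub_apply {V W : Type} [AddCommGroup V] [Module (ZMod d) V] [AddCommGroup W]
    [Module (ZMod d) W] (B₁ : LinearMap.BilinForm (ZMod d) V)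
    (B₂ : LinearMap.BilinForm (ZMod d) W) (x y : V × W) :
    formSub d B₁ B₂ x y = B₁ x.1 y.1 - B₂ x.2 y.2 := rfl

theorem formAdd_apply {V W : Type} [AddCommGroup V] [Module (ZMod d) V] [AddCommGroup W]
    [Module (ZMod d) W] (B₁ : LinearMap.BilinForm (ZMod d) V)
    (B₂ : LinearMap.BilinForm (ZMod d) W) (x y : V × W) :
    formAdd d B₁ B₂ x y = B₁ x.1 y.1 + B₂ x.2 y.2 := rfl

/-- A set is an affine Lagrangian subspace or empty. -/
def IsAffineLagrangian {V : Type} [AddCommGroup V] [Module (ZMod d) V]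
    (B : LinearMap.BilinForm (ZMod d) V) (s : Set V) : Prop :=
  ∀ a ∈ s, ∀ p, p ∈ s ↔ ∀ q ∈ s, B (q - a) (p - a) = 0

/-- Translated to a base point, the set equals its own orthogonal. An orthogonal is automatically a
subspace, so no linearity has to be assumed of `s`. -/
theorem IsAffineLagrangian.exists_submodule {V : Type} [AddCommGroup V] [Module (ZMod d) V]
    {B : LinearMap.BilinForm (ZMod d) V} {s : Set V} (h : IsAffineLagrangian d B s) {a : V}
    (ha : a ∈ s) : ∃ L : Submodule (ZMod d) V, B.orthogonal L = L ∧ s = {p | p - a ∈ L} := by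
  have hs : ∀ p, p ∈ s ↔ ∀ q ∈ s, B (q - a) (p - a) = 0 := h a ha
  have h0 : ∀ v, v + a ∈ s ↔ ∀ q ∈ s, B (q - a) v = 0 := fun v => by
    rw [hs, add_sub_cancel_right]
  let L : Submodule (ZMod d) V :=
    { carrier := {v | v + a ∈ s}
      zero_mem' := by simpa using ha
      add_mem' := by
        intro v w hv hw
        rw [Set.mem_ofPred_eq, h0] at hv hw ⊢
        intro q hq
        rw [map_add, hv q hq, hw q hq, add_zero]
      smul_mem' := by
        intro c v hv
        rw [Set.mem_ofPred_eq, h0] at hv ⊢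
        intro q hq
        rw [map_smul, hv q hq, smul_zero] }
  have hL : ∀ v, v ∈ L ↔ v + a ∈ s := fun v => Iff.rfl
  refine ⟨L, ?_, ?_⟩
  · ext v
    rw [hL, h0, LinearMap.BilinForm.mem_orthogonal_iff]
    constructor
    · intro hv q hq
      exact hv (q - a) (by rwa [hL, sub_add_cancel])
    · intro hv n hn
      simpa using hv (n + a) hn
  · ext p
    simp [hL]

/-- A composite of Lagrangian linear relations is coisotropic. -/
theorem exists_of_orthogonal_comp {V W : Type} [AddCommGroup V] [Module (ZMod d) V]
    [AddCommGroup W] [Module (ZMod d) W] {B : LinearMap.BilinForm (ZMod d) V}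
    {C : LinearMap.BilinForm (ZMod d) W} {L : Submodule (ZMod d) (V × Ph d κ)}
    {M : Submodule (ZMod d) (Ph d κ × W)} (hL : (formSub d B (symp d κ)).orthogonal L = L)
    (hM : (formSub d (symp d κ) C).orthogonal M = M) {u : V} {w : W}
    (h : ∀ x y z, (x, y) ∈ L → (y, z) ∈ M → B x u - C z w = 0) :
    ∃ y, (u, y) ∈ L ∧ (y, w) ∈ M := by
  let T : (L × M) →ₗ[ZMod d] Ph d κ :=
    LinearMap.snd _ _ _ ∘ₗ L.subtype ∘ₗ LinearMap.fst _ _ _ -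
      LinearMap.fst _ _ _ ∘ₗ M.subtype ∘ₗ LinearMap.snd _ _ _
  let φ : (L × M) →ₗ[ZMod d] ZMod d :=
    B.flip u ∘ₗ LinearMap.fst _ _ _ ∘ₗ L.subtype ∘ₗ LinearMap.fst _ _ _ -
      C.flip w ∘ₗ LinearMap.snd _ _ _ ∘ₗ M.subtype ∘ₗ LinearMap.snd _ _ _
  -- `T` measures the mismatch of the two middle components and `φ` is the pairing that a middle
  -- point `y` has to produce. The hypothesis says that `φ` vanishes on `ker T`, so `φ` factors
  -- through `T`; the factor extends to the whole middle space and is `symp` with some `y`.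
  have hφ : φ ∈ T.dualMap.range := by
    rw [LinearMap.range_dualMap_eq_dualAnnihilator_ker, Submodule.mem_dualAnnihilator]
    rintro ⟨⟨⟨x, y⟩, hl⟩, ⟨⟨y', z⟩, hm⟩⟩ hT
    have : y = y' := sub_eq_zero.1 hT
    subst this
    exact h x y z hl hm
  obtain ⟨ψ, hψ⟩ := hφ
  obtain ⟨y, hy⟩ := exists_symp_eq d ψ
  have key : ∀ (p : L) (q : M), symp d κ (p.1.2 - q.1.1) y = B p.1.1 u - C q.1.2 w := by
    intro p q
    rw [hy]
    exact LinearMap.congr_fun hψ (p, q)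
  refine ⟨y, ?_, ?_⟩
  · rw [← hL, LinearMap.BilinForm.mem_orthogonal_iff]
    intro p hp
    have := key ⟨p, hp⟩ 0
    simp only [Submodule.coe_zero, Prod.fst_zero, sub_zero, Prod.snd_zero, map_zero,
      LinearMap.zero_apply] at this
    change formSub d _ _ p _ = 0
    rw [formSub_apply, this, sub_self]
  · rw [← hM, LinearMap.BilinForm.mem_orthogonal_iff]
    intro p hp
    have := key 0 ⟨p, hp⟩
    simp only [Submodule.coe_zero, Prod.fst_zero, zero_sub, Prod.snd_zero, map_zero, map_neg,
      LinearMap.zero_apply, LinearMap.neg_apply, neg_inj] at this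
    change formSub d _ _ p _ = 0
    rw [formSub_apply, this, sub_self]

/-- In the sum of the two isotropy equations the middle terms cancel. The converse, that
orthogonality produces a middle point, is `exists_of_orthogonal_comp` after translation to base
points. -/
theorem IsAffineLagrangian.comp {r : SetRel (Ph d ι) (Ph d κ)} {s : SetRel (Ph d κ) (Ph d l)}
    (hr : IsAffineLagrangian d (formSub d (symp d ι) (symp d κ)) r)
    (hs : IsAffineLagrangian d (formSub d (symp d κ) (symp d l)) s) :
    IsAffineLagrangian d (formSub d (symp d ι) (symp d l)) (r.comp s) := by
  rintro ⟨a, c⟩ ⟨b, hab, hbc⟩ ⟨x, z⟩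
  constructor
  · rintro ⟨y, hxy, hyz⟩ ⟨x', z'⟩ ⟨y', hxy', hyz'⟩
    have h1 := (hr _ hab _).1 hxy _ hxy'
    have h2 := (hs _ hbc _).1 hyz _ hyz'
    simp only [formSub_apply, Prod.fst_sub, Prod.snd_sub] at h1 h2 ⊢
    rw [sub_eq_zero] at h1 h2 ⊢
    exact h1.trans h2
  · intro h
    obtain ⟨L, hL, hrL⟩ := hr.exists_submodule d hab
    obtain ⟨M, hM, hsM⟩ := hs.exists_submodule d hbc
    obtain ⟨y, hy1, hy2⟩ := exists_of_orthogonal_comp d hL hM (u := x - a) (w := z - c) (by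
      intro x' y' z' h1 h2
      have := h (x' + a, z' + c) ⟨y' + b, by simpa [hrL] using h1, by simpa [hsM] using h2⟩
      simpa [formSub_apply] using this)
    exact ⟨y + b, by simpa [hrL] using hy1, by simpa [hsM] using hy2⟩

theorem IsAffineLagrangian.inv {r : SetRel (Ph d ι) (Ph d κ)}
    (hr : IsAffineLagrangian d (formSub d (symp d ι) (symp d κ)) r) :
    IsAffineLagrangian d (formSub d (symp d κ) (symp d ι)) r.inv := by
  rintro ⟨b, a⟩ hab ⟨y, x⟩
  have := hr (a, b) hab (x, y)
  simp only [formSub_apply, Prod.forall, Prod.fst_sub, Prod.snd_sub] at this ⊢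
  rw [SetRel.mem_inv, this, forall_comm]
  simp only [SetRel.mem_inv, sub_eq_zero]
  exact forall₃_congr fun _ _ _ => eq_comm

theorem symp_sum (x y : Ph d (ι ⊕ κ)) : symp d (ι ⊕ κ) x y =
    symp d ι (x ∘ Sum.inl) (y ∘ Sum.inl) + symp d κ (x ∘ Sum.inr) (y ∘ Sum.inr) := by
  rw [symp_apply, Fintype.sum_sum_type]
  rfl

theorem IsAffineLagrangian.tensor {ι' κ' : Type} [Fintype ι'] [Fintype κ']
    {r : SetRel (Ph d ι) (Ph d κ)} {s : SetRel (Ph d ι') (Ph d κ')}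
    (hr : IsAffineLagrangian d (formSub d (symp d ι) (symp d κ)) r)
    (hs : IsAffineLagrangian d (formSub d (symp d ι') (symp d κ')) s) :
    IsAffineLagrangian d (formSub d (symp d (ι ⊕ ι')) (symp d (κ ⊕ κ'))) (tensorRel d r s) := by
  rintro ⟨a, b⟩ ⟨har, has⟩ ⟨x, y⟩
  have split : ∀ q : Ph d (ι ⊕ ι') × Ph d (κ ⊕ κ'),
      formSub d (symp d (ι ⊕ ι')) (symp d (κ ⊕ κ')) (q - (a, b)) ((x, y) - (a, b)) =
      formSub d (symp d ι) (symp d κ)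
        ((q.1 ∘ Sum.inl, q.2 ∘ Sum.inl) - (a ∘ Sum.inl, b ∘ Sum.inl))
        ((x ∘ Sum.inl, y ∘ Sum.inl) - (a ∘ Sum.inl, b ∘ Sum.inl)) +
      formSub d (symp d ι') (symp d κ')
        ((q.1 ∘ Sum.inr, q.2 ∘ Sum.inr) - (a ∘ Sum.inr, b ∘ Sum.inr))
        ((x ∘ Sum.inr, y ∘ Sum.inr) - (a ∘ Sum.inr, b ∘ Sum.inr)) := by
    intro q
    simp only [formSub_apply, symp_sum, Prod.fst_sub, Prod.snd_sub]
    exact add_sub_add_comm _ _ _ _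
  constructor
  · rintro ⟨h1, h2⟩ q ⟨h3, h4⟩
    rw [split, (hr _ har _).1 h1 _ h3, (hs _ has _).1 h2 _ h4, add_zero]
  · intro h
    refine ⟨(hr _ har _).2 fun q hq => ?_, (hs _ has _).2 fun q hq => ?_⟩
    -- Freezing the second factor at its base point removes its term from the pairing, which
    -- isolates the first factor.
    · have := h (Sum.elim q.1 (a ∘ Sum.inr), Sum.elim q.2 (b ∘ Sum.inr)) ⟨hq, has⟩
      rw [split] at this
      simpa [formSub_apply] using this
    · have := h (Sum.elim (a ∘ Sum.inl) q.1, Sum.elim (b ∘ Sum.inl) q.2) ⟨har, hq⟩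
      rw [split] at this
      simpa [formSub_apply] using this

/-- Isotropy is the invariance of the form. For maximality, surjectivity of `f` allows testing
against every vector of the target, and nondegeneracy then gives `y = f x`. -/
theorem isAffineLagrangian_graph (f : Ph d ι ≃ Ph d κ)
    (hf : ∀ x y z, symp d κ (f x - f z) (f y - f z) = symp d ι (x - z) (y - z)) :
    IsAffineLagrangian d (formSub d (symp d ι) (symp d κ)) (graphRel f) := by
  rintro ⟨a, b⟩ (rfl : f a = b) ⟨x, y⟩
  simp only [graphRel, Set.mem_ofPred_eq, formSub_apply, Prod.forall, Prod.fst_sub, Prod.snd_sub]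
  constructor
  · rintro rfl x' _ rfl
    rw [hf, sub_self]
  · intro h
    refine sub_left_injective (b := f a) (eq_of_symp d fun z => ?_)
    have := h (f.symm (z + f a)) (z + f a) (by simp)
    rw [← hf, sub_eq_zero] at this
    simpa using this

/-- In inductions over `Spek` this supplies the finiteness instances of the intermediate system of a
composite and of the factors of a tensor product. -/
theorem Spek.finite {ι κ : Type} {r : SetRel (Ph d ι) (Ph d κ)} (h : Spek d r) :
    Finite ι ∧ Finite κ := by
  induction h with
  | unit => exact ⟨inferInstance, inferInstance⟩
  | mul => exact ⟨inferInstance, inferInstance⟩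
  | affine τ h => exact ⟨inferInstance, inferInstance⟩
  | relabel f => exact ⟨inferInstance, Finite.of_equiv _ f⟩
  | comp _ _ hr hs => exact ⟨hr.1, hs.2⟩
  | tensor _ _ hr hs =>
    have := hr.1; have := hr.2; have := hs.1; have := hs.2
    exact ⟨inferInstance, inferInstance⟩
  | converse _ hr => exact hr.symm

theorem toyUnit_isAffineLagrangian :
    IsAffineLagrangian d (formSub d (symp d Empty) (symp d Unit))
      (stateRel d (toyUnit d Unit)) := by
  rintro ⟨a, b⟩ hb ⟨x, y⟩
  have hb' : (b ()).2 = 0 := hb ()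
  simp only [stateRel, toyUnit, Set.mem_ofPred_eq, formSub_apply, Prod.forall, symp_apply]
  constructor
  · intro h q s hs
    simp [h, hs, hb']
  · rintro h ⟨⟩
    have := h 0 (fun _ => ((b ()).1 + 1, 0)) (fun _ => rfl)
    simpa [hb'] using this

theorem toyMul_isAffineLagrangian :
    IsAffineLagrangian d (formSub d (symp d (Unit ⊕ Unit)) (symp d Unit))
      (joinRel d (toyMul d Unit)) := by
  rintro ⟨a, b⟩ hab ⟨x, y⟩
  obtain ⟨h1, h2⟩ := hab ()
  simp only [Function.comp_apply, Prod.ext_iff] at h1 h2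
  obtain ⟨h2, h3⟩ := h2
  simp only [joinRel, toyMul, Set.mem_ofPred_eq, formSub_apply, Prod.forall, symp_sum]
  simp only [symp_apply, Function.comp_apply, Finset.univ_unique, Finset.sum_singleton,
    Unique.forall_iff, Prod.ext_iff, PUnit.default_eq_unit, Pi.sub_apply, Prod.fst_sub, Prod.snd_sub]
  constructor
  · rintro ⟨k1, k2, k3⟩ q s ⟨l1, l2, l3⟩
    rw [k2, k3, l2, l3, h2, h3, ← k1, ← l1, ← h1]
    ring
  · intro h
    -- Three directions span the graph, half of the six dimensions: a momentum unit in either input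
    -- together with one in the output, and a common translation of all three positions. Each yields
    -- one defining equation.
    have e1 := h (a + Sum.elim (fun _ => (0, 1)) (fun _ => (0, 0))) (b + fun _ => (0, 1))
      (by simp [h1, h2, h3]; ring)
    have e2 := h (a + Sum.elim (fun _ => (0, 0)) (fun _ => (0, 1))) (b + fun _ => (0, 1))
      (by simp [h1, h2, h3]; ring)
    have e3 := h (a + fun _ => (1, 0)) (b + fun _ => (1, 0)) (by simp [h1, h2, h3])
    simp at e1 e2 e3
    refine ⟨?_, ?_, ?_⟩
    · linear_combination e2 - e1 + h1
    · linear_combination e1 + h2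
    · linear_combination -e3 + h3

theorem symp_comp_equiv (f : ι ≃ κ) (x y : Ph d κ) :
    symp d ι (x ∘ f) (y ∘ f) = symp d κ x y := by
  simp only [symp_apply, Function.comp_apply]
  exact Equiv.sum_comp f fun j => (x j).1 * (y j).2 - (x j).2 * (y j).1

omit [Fact d.Prime] [Fintype ι] [Fintype κ] in
theorem relabelRel_eq_graphRel (f : ι ≃ κ) :
    relabelRel d f = graphRel (Equiv.arrowCongr f (Equiv.refl (ZMod d × ZMod d))) := by
  ext ⟨x, y⟩
  simp only [relabelRel, graphRel, Set.mem_ofPred_eq]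
  constructor
  · intro h
    ext j <;> simp [← h]
  · rintro rfl i
    simp

theorem Spek.isAffineLagrangian {ι κ : Type} [Fintype ι] [Fintype κ]
    {r : SetRel (Ph d ι) (Ph d κ)} (h : Spek d r) :
    IsAffineLagrangian d (formSub d (symp d ι) (symp d κ)) r := by
  rename_i i1 i2
  -- The instances are generalized because the inductive hypotheses are applied with instances
  -- chosen inside the induction.
  revert i1 i2
  induction h with
  | unit =>
    intro i1 i2
    convert toyUnit_isAffineLagrangian d
  | mul =>
    intro i1 i2
    convert toyMul_isAffineLagrangian d
  | affine τ h =>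
    intro i1 i2
    obtain ⟨S, v, hS, hτ⟩ := h
    obtain rfl := Subsingleton.elim i1 i2
    obtain rfl := Subsingleton.elim i1 PUnit.fintype
    refine isAffineLagrangian_graph d τ fun x y z => ?_
    rw [hτ, hτ, hτ, add_sub_add_right_eq_sub, add_sub_add_right_eq_sub, ← map_sub, ← map_sub]
    exact hS _ _
  | relabel f =>
    intro i1 i2
    rw [relabelRel_eq_graphRel]
    refine isAffineLagrangian_graph d _ fun x y z => ?_
    have key : ∀ x : Ph d _, (f.arrowCongr (Equiv.refl (ZMod d × ZMod d)) x -
        f.arrowCongr (Equiv.refl _) z) ∘ f = x - z := by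
      intro x
      ext i <;> simp
    rw [← symp_comp_equiv d f, key, key]
  | @comp ι κ l r s hr hs ihr ihs =>
    intro i1 i2
    have := @Fintype.ofFinite κ (hr.finite d).2
    exact ihr.comp d ihs
  | @tensor ι κ ι' κ' r s hr hs ihr ihs =>
    intro i1 i2
    have := @Fintype.ofFinite ι (hr.finite d).1
    have := @Fintype.ofFinite κ (hr.finite d).2
    have := @Fintype.ofFinite ι' (hs.finite d).1
    have := @Fintype.ofFinite κ' (hs.finite d).2
    convert ihr.tensor d ihs
  | converse h ih =>
    intro i1 i2
    exact ih.inv d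

end SymplecticForm


/-! ### Symplectic groupoids, the pair groupoid polarization and the toy algebras -/

section SymplecticGroupoids
variable (d : ℕ) [Fact d.Prime]

theorem formSub_isAlt {V W : Type} [AddCommGroup V] [Module (ZMod d) V] [AddCommGroup W]
    [Module (ZMod d) W] {B₁ : LinearMap.BilinForm (ZMod d) V}
    {B₂ : LinearMap.BilinForm (ZMod d) W} (h₁ : B₁.IsAlt) (h₂ : B₂.IsAlt) :
    (formSub d B₁ B₂).IsAlt := by
  intro x
  rw [formSub_apply, h₁, h₂, sub_zero]

theorem formSub_nondegenerate {V W : Type} [AddCommGroup V] [Module (ZMod d) V] [AddCommGroup W]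
    [Module (ZMod d) W] {B₁ : LinearMap.BilinForm (ZMod d) V}
    {B₂ : LinearMap.BilinForm (ZMod d) W} (h₁ : B₁.Nondegenerate) (h₂ : B₂.Nondegenerate) :
    (formSub d B₁ B₂).Nondegenerate := by
  refine ⟨fun x h => Prod.ext (h₁.1 _ fun y => ?_) (h₂.1 _ fun y => ?_),
    fun x h => Prod.ext (h₁.2 _ fun y => ?_) (h₂.2 _ fun y => ?_)⟩
  · simpa [formSub_apply] using h (y, 0)
  · simpa [formSub_apply] using h (0, y)
  · simpa [formSub_apply] using h (y, 0)
  · simpa [formSub_apply] using h (0, y)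

theorem EpiFrob.isSymplecticGroupoid (A : EpiFrob d) :
    IsSymplecticGroupoid d (symp d (Fin A.n)) A.mul (elems A.unit) where
  alt := symp_isAlt d
  nondegenerate := symp_nondegenerate d
  groupoid := A.isFrob.isGroupoid
  lagrangian := by
    -- With the product listed first the form changes sign compared with `joinRel`, which does not
    -- affect orthogonality.
    have h : IsAffineLagrangian d (formSub d (symp d (Fin A.n))
        (formAdd d (symp d (Fin A.n)) (symp d (Fin A.n)))) {p | (p.2, p.1) ∈ A.mul} := by
      rintro ⟨z, x, y⟩ ha ⟨z', x', y'⟩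
      have := A.mul_spek.isAffineLagrangian d (Sum.elim x y, z) ha (Sum.elim x' y', z')
      refine this.trans ⟨?_, ?_⟩
      · rintro h ⟨z'', x'', y''⟩ hq
        have := h (Sum.elim x'' y'', z'') hq
        simp only [formSub_apply, formAdd_apply, symp_sum, Prod.fst_sub, Prod.snd_sub] at this ⊢
        rw [← neg_sub, neg_eq_zero]
        exact this
      · rintro h ⟨q, z''⟩ hq
        have := h (z'', q ∘ Sum.inl, q ∘ Sum.inr) hq
        simp only [formSub_apply, formAdd_apply, symp_sum, Prod.fst_sub, Prod.snd_sub] at this ⊢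
        rw [← neg_sub, neg_eq_zero]
        exact this
    -- The graph is nonempty: the phase space point `0` has a left identity `u`, and `u · 0 = 0`
    -- serves as base point.
    obtain ⟨u, hu, hu'⟩ := (A.isFrob.left_iff 0 0).2 rfl
    obtain ⟨L, hL, hs⟩ := h.exists_submodule d (a := (0, u, 0)) hu'
    exact ⟨_, L, hL, hs⟩

theorem pairMul_isSymplecticGroupoid (ι : Type) [Fintype ι] :
    IsSymplecticGroupoid d (formSub d (symp d ι) (symp d ι)) (pairMul (Ph d ι))
      {p | p.1 = p.2} where
  alt := formSub_isAlt d (symp_isAlt d) (symp_isAlt d)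
  nondegenerate := formSub_nondegenerate d (symp_nondegenerate d) (symp_nondegenerate d)
  groupoid := pairMul_isGroupoid _
  lagrangian := by
    have h : IsAffineLagrangian d (formSub d (formSub d (symp d ι) (symp d ι))
        (formAdd d (formSub d (symp d ι) (symp d ι)) (formSub d (symp d ι) (symp d ι))))
        {p | (p.2, p.1) ∈ pairMul (Ph d ι)} := by
      rintro ⟨⟨x, z⟩, ⟨x', y⟩, ⟨y', z'⟩⟩ ⟨h1, h2⟩ ⟨⟨a, c⟩, ⟨a', b⟩, ⟨b', c'⟩⟩
      simp only [Prod.mk.injEq] at h1 h2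
      obtain ⟨rfl, rfl⟩ := h2
      subst h1
      simp only [pairMul, Set.mem_ofPred_eq, Prod.mk.injEq, formSub_apply, formAdd_apply,
        Prod.fst_sub, Prod.snd_sub, Prod.forall]
      constructor
      · rintro ⟨rfl, rfl, rfl⟩ u v u' w w' v' ⟨rfl, rfl, rfl⟩
        ring
      · intro h
        refine ⟨sub_left_injective (b := y) (eq_of_symp d fun v => ?_),
          sub_left_injective (b := x) (eq_of_symp d fun v => ?_),
          sub_left_injective (b := z) (eq_of_symp d fun v => ?_)⟩
        -- A composable pair is given by three objects. Moving one of them at a time and using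
        -- nondegeneracy matches the corresponding endpoints.
        · have := h x z x (v + y) (v + y) z ⟨rfl, rfl, rfl⟩
          simp only [sub_self, map_zero, LinearMap.zero_apply, add_sub_cancel_right] at this
          linear_combination this
        · have := h (v + x) z (v + x) y y z ⟨rfl, rfl, rfl⟩
          simp only [sub_self, map_zero, LinearMap.zero_apply, add_sub_cancel_right] at this
          linear_combination this
        · have := h x (v + z) x y y (v + z) ⟨rfl, rfl, rfl⟩
          simp only [sub_self, map_zero, LinearMap.zero_apply, add_sub_cancel_right] at this
          linear_combination -this
    obtain ⟨L, hL, hs⟩ := h.exists_submodule d (a := 0) ⟨rfl, rfl⟩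
    exact ⟨_, L, hL, hs⟩

theorem mem_pairPolarization {ι : Type} {p : Ph d ι × Ph d ι} :
    p ∈ pairPolarization d ι ↔ p.1 = p.2 := by
  rw [pairPolarization, LinearMap.mem_ker, LinearMap.sub_apply, sub_eq_zero]
  rfl

/-- The leaf through the origin is the diagonal. It is its own orthogonal since the two summands
enter with opposite signs, and it is a subgroupoid since it consists of the identity arrows. -/
theorem pairPolarization_isGroupoidPolarization (ι : Type) [Fintype ι] :
    IsGroupoidPolarization d (formSub d (symp d ι) (symp d ι)) (pairMul (Ph d ι))
      {p | p.1 = p.2} (pairPolarization d ι) where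
  lagrangian := by
    ext ⟨x, y⟩
    rw [LinearMap.BilinForm.mem_orthogonal_iff, mem_pairPolarization]
    constructor
    · intro h
      refine eq_of_symp d fun v => sub_eq_zero.1 ?_
      exact h (v, v) ((mem_pairPolarization d).2 rfl)
    · rintro h ⟨u, v⟩ huv
      obtain rfl : u = v := (mem_pairPolarization d).1 huv
      obtain rfl : x = y := h
      exact sub_self _
  mul_mem := by
    rintro ⟨x, y⟩ hf ⟨z, w⟩ hg h ⟨h1, h2⟩
    rw [mem_pairPolarization] at *
    simp_all
  inv_mem := by
    rintro ⟨x, y⟩ hf ⟨z, w⟩ ⟨⟨a, b⟩, hu, h1, h2⟩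
    rw [mem_pairPolarization] at *
    simp only [Set.mem_ofPred_eq, Prod.mk.injEq] at hf hu h1 h2
    exact h1.symm.trans (hf.symm.trans (h2.1.symm.trans (hu.trans h2.2)))

/-! ### The toy algebras -/

/-- Over each position the momenta form an additive group, and the toy multiplication is the
disjoint union of these groups. The intermediate elements of all axioms are forced: sums or
differences of momenta at the common position. -/
theorem toyMul_isRelFrobenius (ι : Type) : IsRelFrobenius (toyMul d ι) (toyUnit d ι) := by
  have mem : ∀ a b c : Ph d ι, ((a, b), c) ∈ toyMul d ι ↔
      ∀ i, (a i).1 = (b i).1 ∧ c i = ((a i).1, (a i).2 + (b i).2) := fun _ _ _ => Iff.rfl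
  have add : ∀ a b : Ph d ι, (∀ i, (a i).1 = (b i).1) →
      ((a, b), fun i => ((a i).1, (a i).2 + (b i).2)) ∈ toyMul d ι := fun a b h i => ⟨h i, rfl⟩
  constructor
  · ext ⟨⟨a, b⟩, p, q⟩
    simp only [prodRel, graphRel, SetRel.mem_comp, SetRel.mem_inv, SetRel.id, Set.mem_ofPred_eq,
      Prod.exists, Equiv.prodAssoc_apply, Prod.mk.injEq, mem]
    constructor
    · rintro ⟨p', c, b', ⟨x, y, z, ⟨h1, rfl⟩, rfl, rfl, rfl⟩, rfl, h2⟩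
      refine ⟨fun i => ((a i).1, (a i).2 + (b i).2), fun i => ⟨?_, rfl⟩, fun i => ⟨?_, ?_⟩⟩ <;>
      obtain ⟨h1, h3⟩ := h1 i <;> obtain ⟨h2, h4⟩ := h2 i <;> simp_all [Prod.ext_iff]
      ring
    · rintro ⟨z, h1, h2⟩
      -- The solution `c` of `p · c = a`.
      refine ⟨p, fun i => ((a i).1, (a i).2 - (p i).2), b, ⟨p, _, b, ⟨?_, rfl⟩, rfl, rfl, rfl⟩,
        rfl, ?_⟩ <;> intro i <;> obtain ⟨h1, h3⟩ := h1 i <;> obtain ⟨h2, h4⟩ := h2 i <;>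
        rw [h4] at h3 <;> simp_all [Prod.ext_iff]
      linear_combination (h1 i).2.2
  · ext ⟨⟨a, b⟩, p, q⟩
    simp only [prodRel, graphRel, SetRel.mem_comp, SetRel.mem_inv, SetRel.id, Set.mem_ofPred_eq,
      Prod.exists, Equiv.prodAssoc_symm_apply, Prod.mk.injEq, mem]
    constructor
    · rintro ⟨x, c, q', ⟨_, y, z, ⟨rfl, h1⟩, ⟨rfl, rfl⟩, rfl⟩, h2, rfl⟩
      refine ⟨fun i => ((a i).1, (a i).2 + (b i).2), fun i => ⟨?_, rfl⟩, fun i => ⟨?_, ?_⟩⟩ <;>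
      obtain ⟨h1, h3⟩ := h1 i <;> obtain ⟨h2, h4⟩ := h2 i <;> simp_all [Prod.ext_iff]
      ring
    · rintro ⟨z, h1, h2⟩
      refine ⟨a, fun i => ((b i).1, (b i).2 - (q i).2), q, ⟨a, _, q, ⟨rfl, ?_⟩, ⟨rfl, rfl⟩, rfl⟩,
        ?_, rfl⟩ <;> intro i <;> obtain ⟨h1, h3⟩ := h1 i <;> obtain ⟨h2, h4⟩ := h2 i <;>
        rw [h4] at h3 <;> simp_all [Prod.ext_iff]
      linear_combination (h1 i).2.2
  · ext ⟨a, b⟩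
    simp only [SetRel.mem_comp, SetRel.mem_inv, SetRel.mem_id, Prod.exists, mem]
    constructor
    · rintro ⟨x, y, h1, h2⟩
      ext1 i
      rw [(h1 i).2, (h2 i).2]
    · rintro rfl
      exact ⟨a, fun i => ((a i).1, 0), fun i => by simp, fun i => by simp⟩
  · ext ⟨⟨⟨a, b⟩, c⟩, w⟩
    simp only [prodRel, graphRel, SetRel.mem_comp, SetRel.id, Set.mem_ofPred_eq,
      Prod.exists, Equiv.prodAssoc_apply, Prod.mk.injEq, mem]
    constructor
    · rintro ⟨x, y, ⟨_, _, _, ⟨rfl, rfl, rfl⟩, rfl, h1⟩, h2⟩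
      refine ⟨fun i => ((a i).1, (a i).2 + (b i).2), c, ⟨fun i => ⟨?_, rfl⟩, rfl⟩,
        fun i => ⟨?_, ?_⟩⟩ <;> obtain ⟨h1, h3⟩ := h1 i <;> obtain ⟨h2, h4⟩ := h2 i <;>
        simp_all [Prod.ext_iff]
      ring
    · rintro ⟨x, y, ⟨h1, rfl⟩, h2⟩
      refine ⟨a, fun i => ((b i).1, (b i).2 + (c i).2), ⟨a, b, c, ⟨rfl, rfl, rfl⟩, rfl,
        fun i => ⟨?_, rfl⟩⟩, fun i => ⟨?_, ?_⟩⟩ <;> obtain ⟨h1, h3⟩ := h1 i <;>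
        obtain ⟨h2, h4⟩ := h2 i <;> simp_all [Prod.ext_iff]
      ring
  · ext ⟨a, b⟩
    simp only [prodRel, graphRel, SetRel.mem_comp, SetRel.id, Set.mem_ofPred_eq, Prod.exists,
      Equiv.punitProd_symm_apply, Prod.mk.injEq, mem, toyUnit]
    constructor
    · rintro ⟨u, _, ⟨_, _, ⟨-, rfl⟩, hu, rfl⟩, h⟩
      ext i <;> obtain ⟨h1, h2⟩ := h i <;> simp_all [Prod.ext_iff]
    · rintro rfl
      exact ⟨fun i => ((a i).1, 0), a, ⟨(), a, ⟨trivial, rfl⟩, fun _ => rfl, rfl⟩,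
        fun i => by simp⟩
  · ext ⟨a, b⟩
    simp only [prodRel, graphRel, SetRel.mem_comp, SetRel.id, Set.mem_ofPred_eq, Prod.exists,
      Equiv.prodPUnit_symm_apply, Prod.mk.injEq, mem, toyUnit]
    constructor
    · rintro ⟨_, u, ⟨_, _, ⟨rfl, -⟩, rfl, hu⟩, h⟩
      ext i <;> obtain ⟨h1, h2⟩ := h i <;> simp_all [Prod.ext_iff]
    · rintro rfl
      exact ⟨a, fun i => ((a i).1, 0), ⟨a, (), ⟨rfl, trivial⟩, rfl, fun _ => rfl⟩,
        fun i => by simp⟩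

omit [Fact d.Prime] in
theorem relabelRel_comp {ι κ l : Type} (f : ι ≃ κ) (r : SetRel (Ph d κ) (Ph d l)) :
    (relabelRel d f).comp r = {t | (t.1 ∘ f.symm, t.2) ∈ r} := by
  ext ⟨x, y⟩
  simp only [SetRel.mem_comp, relabelRel, Set.mem_ofPred_eq]
  constructor
  · rintro ⟨z, h1, h2⟩
    convert h2
    ext1 i
    simp [← h1]
  · intro h
    exact ⟨_, fun i => by simp, h⟩

omit [Fact d.Prime] in
theorem comp_relabelRel {ι κ l : Type} (r : SetRel (Ph d ι) (Ph d κ)) (f : κ ≃ l) :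
    r.comp (relabelRel d f) = {t | (t.1, t.2 ∘ f) ∈ r} := by
  ext ⟨x, y⟩
  simp only [SetRel.mem_comp, relabelRel, Set.mem_ofPred_eq]
  constructor
  · rintro ⟨z, h1, h2⟩
    convert h1
    ext1 i
    simp [← h2]
  · intro h
    exact ⟨_, h, fun i => by simp⟩

theorem Spek.toyMul_congr {ι κ : Type} (e : ι ≃ κ) (h : Spek d (joinRel d (toyMul d ι))) :
    Spek d (joinRel d (toyMul d κ)) := by
  have := (h.finite d).2
  have := Finite.of_equiv _ e
  convert ((Spek.relabel (e.symm.sumCongr e.symm)).comp h).comp (Spek.relabel e)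
  rw [comp_relabelRel, relabelRel_comp]
  ext ⟨x, y⟩
  simp only [joinRel, toyMul, Set.mem_ofPred_eq]
  rw [← e.forall_congr_right]
  simp

theorem Spek.toyUnit_congr {ι κ : Type} (e : ι ≃ κ) (h : Spek d (stateRel d (toyUnit d ι))) :
    Spek d (stateRel d (toyUnit d κ)) := by
  have := (h.finite d).2
  convert h.comp (Spek.relabel e)
  rw [comp_relabelRel]
  ext ⟨x, y⟩
  simp only [stateRel, toyUnit, Set.mem_ofPred_eq]
  rw [← e.forall_congr_right]
  simp

/-- The inputs arrive grouped by argument, while the tensor product of two multiplications wants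
them grouped by system; `Equiv.sumSumSumComm` interchanges the middle factors. -/
theorem Spek.toyMul_sum {ι κ : Type} (h : Spek d (joinRel d (toyMul d ι)))
    (h' : Spek d (joinRel d (toyMul d κ))) : Spek d (joinRel d (toyMul d (ι ⊕ κ))) := by
  have := (h.finite d).2
  have := (h'.finite d).2
  convert (Spek.relabel (Equiv.sumSumSumComm ι κ ι κ)).comp (h.tensor h')
  rw [relabelRel_comp]
  ext ⟨x, y⟩
  simp only [joinRel, toyMul, tensorRel, Set.mem_ofPred_eq, Sum.forall]
  rfl

theorem Spek.toyUnit_sum {ι κ : Type} (h : Spek d (stateRel d (toyUnit d ι)))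
    (h' : Spek d (stateRel d (toyUnit d κ))) : Spek d (stateRel d (toyUnit d (ι ⊕ κ))) := by
  convert (Spek.relabel (Equiv.equivOfIsEmpty Empty (Empty ⊕ Empty))).comp (h.tensor h')
  rw [relabelRel_comp]
  ext ⟨x, y⟩
  simp only [stateRel, toyUnit, tensorRel, Set.mem_ofPred_eq, Sum.forall]
  rfl

/-- The generator concerns a single elementary system. Further systems are added one at a time by
tensor product and transport along bijections. -/
theorem Spek.toyMul (ι : Type) [Finite ι] : Spek d (joinRel d (toyMul d ι)) := by
  induction ι using Finite.induction_empty_option with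
  | of_equiv e h => exact h.toyMul_congr d e
  | h_empty =>
    convert Spek.relabel (d := d) (Equiv.equivOfIsEmpty (PEmpty ⊕ PEmpty) PEmpty)
    ext ⟨x, y⟩
    simp [joinRel, EpiQuant.toyMul, relabelRel]
  | h_option h => exact (h.toyMul_sum d Spek.mul).toyMul_congr d (Equiv.optionEquivSumPUnit _).symm

theorem Spek.toyUnit (ι : Type) [Finite ι] : Spek d (stateRel d (toyUnit d ι)) := by
  induction ι using Finite.induction_empty_option with
  | of_equiv e h => exact h.toyUnit_congr d e
  | h_empty =>
    convert Spek.relabel (d := d) (Equiv.equivOfIsEmpty Empty PEmpty)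
    ext ⟨x, y⟩
    simp [stateRel, EpiQuant.toyUnit, relabelRel]
  | h_option h =>
    exact (h.toyUnit_sum d Spek.unit).toyUnit_congr d (Equiv.optionEquivSumPUnit _).symm

end SymplecticGroupoids


/-! ### The Weyl correspondence and displacement operators -/

noncomputable section Weyl
variable (d : ℕ) [Fact d.Prime]

/-- Every use of `d ≠ 2` in the proof reduces to the existence of halves. -/
theorem two_ne_zero_of_ne_two (hd : d ≠ 2) : (2 : ZMod d) ≠ 0 := by
  have hp : d.Prime := Fact.out
  intro h
  have h2 : d ∣ 2 := (ZMod.natCast_eq_zero_iff 2 d).1 (by exact_mod_cast h)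
  exact hd ((Nat.prime_dvd_prime_iff_eq hp Nat.prime_two).1 h2)

theorem chi_zero : chi d 0 = 1 := AddChar.map_zero_eq_one _

theorem star_chi (t : ZMod d) : star (chi d t) = chi d (-t) := by
  rw [chi, chi, AddChar.map_neg_eq_conj]
  rfl

theorem chi_mul_chi_neg (t : ZMod d) : chi d t * chi d (-t) = 1 := by
  rw [← chi_add, add_neg_cancel, chi_zero]

/-- Orthogonality of characters. -/
theorem sum_chi_linear {V : Type} [AddCommGroup V] [Module (ZMod d) V] [Fintype V]
    (ψ : V →ₗ[ZMod d] ZMod d) [Decidable (ψ = 0)] :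
    ∑ v, chi d (ψ v) = if ψ = 0 then (Fintype.card V : ℂ) else 0 := by
  split_ifs with h
  · simp [h, chi_zero]
  · have : (ZMod.stdAddChar (N := d)).compAddMonoidHom ψ.toAddMonoidHom ≠ 0 := by
      intro h0
      apply h
      ext v
      apply ZMod.injective_stdAddChar (N := d)
      rw [LinearMap.zero_apply, AddChar.map_zero_eq_one]
      exact DFunLike.congr_fun h0 v
    exact AddChar.sum_eq_zero_of_ne_one this

variable {ι : Type} [Fintype ι]

theorem sum_chi_symp [DecidableEq ι] (u : Ph d ι) :
    ∑ z, chi d (symp d ι u z) = if u = 0 then (Fintype.card (Ph d ι) : ℂ) else 0 := by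
  classical
  rw [sum_chi_linear]
  congr 1
  refine propext ⟨fun h => (symp_nondegenerate d).1 u fun y => LinearMap.congr_fun h y, ?_⟩
  rintro rfl
  exact map_zero _

theorem sum_chi_conf [DecidableEq ι] (t : Conf d ι) :
    ∑ b : Conf d ι, chi d (∑ i, b i * t i) =
      if t = 0 then (Fintype.card (Conf d ι) : ℂ) else 0 := by
  classical
  have := sum_chi_linear d (Fintype.linearCombination (ZMod d) t)
  simp only [Fintype.linearCombination_apply, smul_eq_mul] at this
  rw [this]
  congr 1
  refine propext ⟨fun h => ?_, ?_⟩
  · ext i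
    have := LinearMap.congr_fun h (Pi.single i 1)
    simpa using this
  · rintro rfl
    ext
    simp

theorem card_ne_zero (α : Type) [Fintype α] [Nonempty α] : (Fintype.card α : ℂ) ≠ 0 :=
  Nat.cast_ne_zero.2 Fintype.card_ne_zero

theorem card_phase [DecidableEq ι] :
    (Fintype.card (Ph d ι) : ℂ) = Fintype.card (Conf d ι) * Fintype.card (Conf d ι) := by
  rw [Fintype.card_congr (Equiv.arrowProdEquivProdArrow ι (fun _ => ZMod d) fun _ => ZMod d),
    Fintype.card_prod]
  push_cast
  rfl

variable [DecidableEq ι]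

/-- Fourier inversion: the sum over `u` of `χ(ω(w - z, u))` is concentrated at `w = z`. -/
theorem symbol_quantize (f : Ph d ι → ℂ) : symbol d (quantize d f) = f := by
  ext z
  have key : ∀ u : Ph d ι, (quantize d f).1 (u, 0) * chi d (symp d ι u z) =
      (Fintype.card (Ph d ι) : ℂ)⁻¹ * ∑ w, f w * chi d (symp d ι (w - z) u) := by
    intro u
    simp only [quantize, LinearMap.coe_mk, AddHom.coe_mk, map_zero, LinearMap.zero_apply, mul_zero,
      chi_zero, one_mul, sub_zero, mul_assoc, Finset.sum_mul]
    refine congrArg _ (Finset.sum_congr rfl fun w _ => ?_)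
    rw [← chi_add, symp_swap d u z, ← sub_eq_add_neg, ← LinearMap.sub_apply, ← map_sub]
  simp only [symbol, LinearMap.coe_mk, AddHom.coe_mk, key]
  rw [← Finset.mul_sum, Finset.sum_comm]
  simp only [← Finset.mul_sum, sum_chi_symp, sub_eq_zero, mul_ite, mul_zero,
    Finset.sum_ite_eq', Finset.mem_univ, if_true]
  rw [mul_comm (f z), inv_mul_cancel_left₀ (card_ne_zero _)]

/-- Fourier inversion recovers only the value at `(x - y, 0)`; parallel transport by `y` then
restores the value at `(x, y)`. -/
theorem quantize_symbol (a : polarized d ι) : quantize d (symbol d a) = a := by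
  ext ⟨x, y⟩
  have key : ∑ z, symbol d a z * chi d (symp d ι z (x - y)) =
      (Fintype.card (Ph d ι) : ℂ) * a.1 (x - y, 0) := by
    simp only [symbol, LinearMap.coe_mk, AddHom.coe_mk, Finset.sum_mul]
    rw [Finset.sum_comm]
    have : ∀ u z, a.1 (u, 0) * chi d (symp d ι u z) * chi d (symp d ι z (x - y)) =
        a.1 (u, 0) * chi d (symp d ι (u - (x - y)) z) := by
      intro u z
      rw [mul_assoc, ← chi_add, symp_swap d z, ← sub_eq_add_neg, ← LinearMap.sub_apply, ← map_sub]
    simp only [this, ← Finset.mul_sum, sum_chi_symp, sub_eq_zero, mul_ite, mul_zero,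
      Finset.sum_ite_eq', Finset.mem_univ, if_true]
    rw [mul_comm]
  have h := a.2 (x - y) 0 y
  rw [sub_add_cancel, zero_add, sub_zero, map_sub, symp_isAlt d y, sub_zero] at h
  simp only [quantize, LinearMap.coe_mk, AddHom.coe_mk, key]
  rw [inv_mul_cancel_left₀ (card_ne_zero _), h]

/-- The symbol of the displacement operator with label `u`. -/
def character (u : Ph d ι) : Ph d ι → ℂ := fun z => chi d (symp d ι u z)

theorem symbol_eq_sum (a : polarized d ι) :
    symbol d a = ∑ u, a.1 (u, 0) • character d u := by
  ext z
  simp [symbol, character]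

theorem eq_sum_character (f : Ph d ι → ℂ) :
    f = ∑ u, (quantize d f).1 (u, 0) • character d u := by
  rw [← symbol_eq_sum, symbol_quantize]

/-- Characters span all functions by Fourier inversion, so linear identities need checking only on
the symbols of displacement operators. -/
theorem hom_ext_character {V : Type} [AddCommGroup V] [Module ℂ V] {φ ψ : (Ph d ι → ℂ) →ₗ[ℂ] V}
    (h : ∀ u, φ (character d u) = ψ (character d u)) : φ = ψ := by
  refine LinearMap.ext fun f => ?_
  rw [eq_sum_character d f]
  simp only [map_sum, map_smul, h]

/-- The Weyl correspondence as a linear map. -/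
def weylLin : (Ph d ι → ℂ) →ₗ[ℂ] Matrix (Conf d ι) (Conf d ι) ℂ where
  toFun f := weylOp d f
  map_add' f g := by
    ext x y
    simp [weylOp, add_mul, Finset.sum_add_distrib, mul_add]
  map_smul' c f := by
    ext x y
    simp only [weylOp, Pi.smul_apply, smul_eq_mul, Matrix.smul_apply, mul_assoc,
      ← Finset.mul_sum, RingHom.id_apply]
    ring

theorem weylLin_apply (f : Ph d ι → ℂ) : weylLin d f = weylOp d f := rfl

theorem weylOp_character (u : Ph d ι) : weylOp d (character d u) = displacement d u := rfl

theorem polRep_apply (a : polarized d ι) : polRep d a = weylOp d (symbol d a) := rfl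

theorem polRep_eq_sum (a : polarized d ι) :
    polRep d a = ∑ u, a.1 (u, 0) • displacement d u := by
  rw [polRep_apply, symbol_eq_sum, ← weylLin_apply, map_sum]
  simp only [map_smul, weylLin_apply, weylOp_character]

/-- The sum over momenta is a delta function: `W(u)` is a shift by the position part of `u`, with a
phase given by its momentum part at the midpoint of the step. -/
theorem displacement_apply (u : Ph d ι) (x y : Conf d ι) :
    displacement d u x y = if y = x + fun i => (u i).1 then
      chi d (-∑ i, (u i).2 * ((x i + y i) * 2⁻¹)) else 0 := by
  have key : ∀ b : Conf d ι, chi d (symp d ι u fun i => ((x i + y i) * 2⁻¹, b i)) *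
      chi d (∑ i, b i * (x i - y i)) = chi d (-∑ i, (u i).2 * ((x i + y i) * 2⁻¹)) *
        chi d (∑ i, b i * (x + (fun i => (u i).1) - y) i) := by
    intro b
    rw [← chi_add, ← chi_add, symp_apply, ← Finset.sum_neg_distrib, ← Finset.sum_add_distrib,
      ← Finset.sum_add_distrib]
    refine congrArg _ (Finset.sum_congr rfl fun i _ => ?_)
    simp only [Pi.add_apply, Pi.sub_apply]
    ring
  simp only [displacement, weylOp, key]
  rw [← Finset.mul_sum, sum_chi_conf]
  simp only [sub_eq_zero, eq_comm (a := y)]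
  split_ifs
  · rw [mul_comm, mul_assoc, mul_inv_cancel₀ (card_ne_zero _), mul_one]
  · simp

theorem displacement_zero : displacement d (0 : Ph d ι) = 1 := by
  ext x y
  rw [displacement_apply, Matrix.one_apply]
  simp [chi_zero, eq_comm, ← Pi.zero_def]

theorem displacement_conjTranspose (u : Ph d ι) : (displacement d u)ᴴ = displacement d (-u) := by
  ext x y
  rw [Matrix.conjTranspose_apply, displacement_apply, displacement_apply]
  have : (x = y + fun i => (u i).1) ↔ (y = x + fun i => ((-u) i).1) := by
    constructor <;> intro h <;> rw [h] <;> ext i <;> simp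
  simp only [this]
  split_ifs
  · rw [star_chi]
    simp [add_comm]
  · simp

/-- The phases sit at midpoints of steps. The midpoints of the two successive steps differ from the
midpoint of the total step by half a shift, which produces the half symplectic form. -/
theorem displacement_mul (hd : d ≠ 2) (u v : Ph d ι) : displacement d u * displacement d v =
    chi d (2⁻¹ * symp d ι v u) • displacement d (u + v) := by
  have h2 := two_ne_zero_of_ne_two d hd
  ext x z
  simp only [Matrix.mul_apply, displacement_apply, Matrix.smul_apply, smul_eq_mul, ite_mul,
    zero_mul, Finset.sum_ite_eq', Finset.mem_univ, if_true]
  have : (z = (x + fun i => (u i).1) + fun i => (v i).1) ↔ z = x + fun i => ((u + v) i).1 := by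
    rw [add_assoc]
    rfl
  simp only [this, mul_ite, mul_zero]
  split_ifs with hz
  · rw [← chi_add, ← chi_add, symp_apply, Finset.mul_sum, ← Finset.sum_neg_distrib,
      ← Finset.sum_neg_distrib, ← Finset.sum_neg_distrib, ← Finset.sum_add_distrib,
      ← Finset.sum_add_distrib]
    refine congrArg _ (Finset.sum_congr rfl fun i _ => ?_)
    simp only [hz, Pi.add_apply, Prod.fst_add, Prod.snd_add]
    field_simp
    ring
  · rfl

/-- A nonzero shift has no diagonal entries. For zero shift the diagonal is a character of
configuration space with label minus the momentum part. -/
theorem trace_displacement (hd : d ≠ 2) (u : Ph d ι) : (displacement d u).trace =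
    if u = 0 then (Fintype.card (Conf d ι) : ℂ) else 0 := by
  have h2 := two_ne_zero_of_ne_two d hd
  simp only [Matrix.trace, Matrix.diag_apply, displacement_apply, left_eq_add]
  by_cases h1 : (fun i => (u i).1) = (0 : Conf d ι)
  · have : ∀ x : Conf d ι, chi d (-∑ i, (u i).2 * ((x i + x i) * 2⁻¹)) =
        chi d (∑ i, x i * (fun i => -(u i).2) i) := by
      intro x
      rw [← Finset.sum_neg_distrib]
      refine congrArg _ (Finset.sum_congr rfl fun i _ => ?_)
      field_simp
      ring
    simp only [h1, if_true, this]
    rw [sum_chi_conf]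
    congr 1
    refine propext ⟨fun h => ?_, ?_⟩
    · ext i
      · exact congrFun h1 i
      · simpa using congrFun h i
    · rintro rfl
      ext i
      simp
  · have : u ≠ 0 := by
      rintro rfl
      exact h1 rfl
    simp [h1, this]

/-- The Weyl correspondence is an isometry up to normalization. -/
theorem trace_weylOp_mul (hd : d ≠ 2) (f g : Ph d ι → ℂ) : (weylOp d f * weylOp d g).trace =
    (Fintype.card (Conf d ι) : ℂ)⁻¹ * ∑ z, f z * g z := by
  let φ : (Ph d ι → ℂ) →ₗ[ℂ] (Ph d ι → ℂ) →ₗ[ℂ] ℂ :=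
    (LinearMap.mul ℂ (Matrix (Conf d ι) (Conf d ι) ℂ)).compl₁₂ (weylLin d) (weylLin d) |>.compr₂
      (Matrix.traceLinearMap _ ℂ ℂ)
  let ψ : (Ph d ι → ℂ) →ₗ[ℂ] (Ph d ι → ℂ) →ₗ[ℂ] ℂ :=
    (LinearMap.mul ℂ (Ph d ι → ℂ)).compr₂
      ((Fintype.card (Conf d ι) : ℂ)⁻¹ • ∑ z, LinearMap.proj z)
  have : φ = ψ := by
    -- Both sides are bilinear, and on a pair of characters both are supported on `u + v = 0`.
    refine hom_ext_character d fun u => hom_ext_character d fun v => ?_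
    change (displacement d u * displacement d v).trace = _
    have hψ : ψ (character d u) (character d v) =
        (Fintype.card (Conf d ι) : ℂ)⁻¹ * ∑ z, character d u z * character d v z := by
      simp [ψ]
    have hc : ∀ z, character d u z * character d v z = chi d (symp d ι (u + v) z) := by
      intro z
      rw [map_add, LinearMap.add_apply, chi_add]
      rfl
    simp only [hψ, hc]
    rw [sum_chi_symp, displacement_mul d hd, Matrix.trace_smul, trace_displacement d hd]
    split_ifs with h
    · obtain rfl := eq_neg_of_add_eq_zero_left h
      have hz := symp_isAlt d v
      rw [map_neg, hz, neg_zero, mul_zero, chi_zero, one_smul, card_phase,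
        inv_mul_cancel_left₀ (card_ne_zero _)]
    · simp
  have h2 := LinearMap.congr_fun (LinearMap.congr_fun this f) g
  simpa [φ, ψ, weylLin_apply] using h2

/-- Injectivity comes from the trace pairing with delta functions, and surjectivity from a dimension
count: phase space has as many points as a square matrix over configuration space has entries. -/
theorem weylLin_bijective (hd : d ≠ 2) : Function.Bijective (weylLin d (ι := ι)) := by
  have hinj : Function.Injective (weylLin d (ι := ι)) := by
    rw [injective_iff_map_eq_zero]
    intro f hf
    ext z
    have := trace_weylOp_mul d hd f (Pi.single z 1)
    rw [← weylLin_apply, hf, zero_mul, Matrix.trace_zero] at this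
    simpa only [Pi.single_apply, mul_ite, mul_one, mul_zero, Finset.sum_ite_eq', Finset.mem_univ,
      if_true, zero_eq_mul, inv_eq_zero, card_ne_zero, false_or, Pi.zero_apply] using this
  refine ⟨hinj, (LinearMap.injective_iff_surjective_of_finrank_eq_finrank ?_).1 hinj⟩
  have := card_phase d (ι := ι)
  rw [Module.finrank_fintype_fun_eq_card, Module.finrank_matrix, Module.finrank_self, mul_one]
  exact_mod_cast this

theorem exists_eq_weylOp (hd : d ≠ 2) (A : Matrix (Conf d ι) (Conf d ι) ℂ) :
    ∃ f, weylOp d f = A := (weylLin_bijective d hd).2 A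

theorem exists_eq_sum_displacement (hd : d ≠ 2) (A : Matrix (Conf d ι) (Conf d ι) ℂ) :
    ∃ c : Ph d ι → ℂ, A = ∑ u, c u • displacement d u := by
  obtain ⟨f, rfl⟩ := exists_eq_weylOp d hd A
  refine ⟨fun u => (quantize d f).1 (u, 0), ?_⟩
  rw [← polRep_eq_sum, polRep_apply, symbol_quantize]

/-- Unital `*`-endomorphisms of a matrix algebra are implemented by unitaries. -/
theorem exists_unitary_of_starHom {X : Type} [Fintype X] [DecidableEq X] [Nonempty X]
    (Φ : Matrix X X ℂ →ₗ[ℂ] Matrix X X ℂ) (h1 : Φ 1 = 1)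
    (hmul : ∀ A B, Φ (A * B) = Φ A * Φ B) (hstar : ∀ A, Φ Aᴴ = (Φ A)ᴴ) :
    ∃ U ∈ Matrix.unitaryGroup X ℂ, ∀ A, Φ A = U * A * Uᴴ := by
  classical
  let o : X := Classical.arbitrary X
  let E : X → X → Matrix X X ℂ := fun i j => Matrix.single i j 1
  have hE : ∀ i j k, E i j * E j k = E i k := by
    intro i j k
    simp [E]
  have hE0 : ∀ i j k l, j ≠ k → E i j * E k l = 0 := by
    intro i j k l h
    simp [E, h]
  have hEs : ∀ i j, (E i j)ᴴ = E j i := by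
    intro i j
    simp [E]
  -- The two-sided ideal generated by one diagonal matrix unit contains `1`, and `Φ 1 = 1` is
  -- nonzero.
  have hP : Φ (E o o) ≠ 0 := by
    intro h0
    have : (1 : Matrix X X ℂ) = ∑ j, E j o * E o o * E o j := by
      simp only [hE]
      ext i j
      simp only [E, Matrix.one_apply, Matrix.sum_apply, Matrix.single_apply, ite_and,
        Finset.sum_ite_eq', Finset.mem_univ, if_true]
    have h2 := congrArg Φ this
    simp only [map_sum, hmul, h0, mul_zero, zero_mul, Finset.sum_const_zero, h1] at h2
    exact one_ne_zero h2
  -- A unit vector fixed by the idempotent `Φ (E o o)`, obtained by normalizing a nonzero vector of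
  -- its range.
  obtain ⟨v, hv, hvv⟩ : ∃ v : X → ℂ, Φ (E o o) *ᵥ v = v ∧ star v ⬝ᵥ v = 1 := by
    obtain ⟨w, hw⟩ : ∃ w, Φ (E o o) *ᵥ w ≠ 0 := by
      by_contra! h
      exact hP (Matrix.ext_of_mulVec_single fun i => by rw [h, Matrix.zero_mulVec])
    set v := Φ (E o o) *ᵥ w with hv
    have hs : star v ⬝ᵥ v = ((∑ i, ‖v i‖ ^ 2 : ℝ) : ℂ) := by
      simp [dotProduct, Complex.conj_mul']
    have hpos : 0 < ∑ i, ‖v i‖ ^ 2 := by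
      obtain ⟨i, hi⟩ := Function.ne_iff.1 hw
      exact Finset.sum_pos' (fun _ _ => by positivity) ⟨i, Finset.mem_univ i, by
        have : 0 < ‖v i‖ := norm_pos_iff.2 hi
        positivity⟩
    set r := ∑ i, ‖v i‖ ^ 2
    refine ⟨((Real.sqrt r)⁻¹ : ℂ) • v, ?_, ?_⟩
    · rw [Matrix.mulVec_smul, hv, Matrix.mulVec_mulVec, ← hmul, hE]
    · rw [star_smul, smul_dotProduct, dotProduct_smul, hs]
      have : (Real.sqrt r : ℂ) * Real.sqrt r = r := by
        rw [← Complex.ofReal_mul, Real.mul_self_sqrt hpos.le]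
      have h0 : (Real.sqrt r : ℂ) ≠ 0 := Complex.ofReal_ne_zero.2 (Real.sqrt_pos.2 hpos).ne'
      simp only [star_inv₀, smul_eq_mul, Complex.star_def, Complex.conj_ofReal]
      rw [← this]
      field_simp
  -- The `j`-th basis vector is sent to `Φ (E j o) v`: the images of the matrix units carry `v` to a
  -- new orthonormal basis, and `U` intertwines the two actions.
  let U : Matrix X X ℂ := fun i j => (Φ (E j o) *ᵥ v) i
  have hU : ∀ A, Φ A * U = U * A := by
    intro A
    ext i j
    have h3 : A * E j o = ∑ k, A k j • E k o := by
      ext a b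
      simp only [E, Matrix.sum_apply, Matrix.smul_apply, Matrix.single_apply, Matrix.mul_apply,
        smul_eq_mul, mul_ite, mul_one, mul_zero, ite_and]
      by_cases hb : o = b <;> simp [hb]
    calc (Φ A * U) i j = (Φ A *ᵥ (Φ (E j o) *ᵥ v)) i := rfl
      _ = (∑ k, A k j • (Φ (E k o) *ᵥ v)) i := by
        rw [Matrix.mulVec_mulVec, ← hmul, h3, map_sum, Matrix.sum_mulVec]
        simp only [map_smul, Matrix.smul_mulVec]
      _ = (U * A) i j := by
        rw [Matrix.mul_apply, Finset.sum_apply]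
        exact Finset.sum_congr rfl fun k _ => mul_comm _ _
  have hUU : Uᴴ * U = 1 := by
    ext i j
    calc (Uᴴ * U) i j = star (Φ (E i o) *ᵥ v) ⬝ᵥ (Φ (E j o) *ᵥ v) := rfl
      _ = star v ⬝ᵥ (Φ (E o i * E j o) *ᵥ v) := by
        rw [Matrix.star_mulVec, ← hstar, hEs, ← Matrix.dotProduct_mulVec, Matrix.mulVec_mulVec,
          hmul]
      _ = (1 : Matrix X X ℂ) i j := by
        rw [Matrix.one_apply]
        split_ifs with h
        · rw [h, hE, hv, hvv]
        · rw [hE0 _ _ _ _ h, map_zero, Matrix.zero_mulVec, dotProduct_zero]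
  have hUm : U ∈ Matrix.unitaryGroup X ℂ := Matrix.mem_unitaryGroup_iff'.2 hUU
  refine ⟨U, hUm, fun A => ?_⟩
  rw [← hU, mul_assoc, show U * Uᴴ = 1 from Matrix.mem_unitaryGroup_iff.1 hUm, mul_one]

end Weyl


/-! ### Push-forward along affine relations and the operators that represent it -/

noncomputable section Representation
variable (d : ℕ) [Fact d.Prime]

section Push
variable {ι κ l : Type} [Fintype ι] [DecidableEq ι] [Fintype κ] [DecidableEq κ]

omit [Fintype κ] [DecidableEq κ] in
open Classical in
theorem push_apply (r : SetRel (Ph d ι) (Ph d κ)) (f : Ph d ι → ℂ) (y : Ph d κ) :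
    push d r f y = ∑ x, if (x, y) ∈ r then f x else 0 := by
  simp only [push, LinearMap.coe_mk, AddHom.coe_mk]

omit [Fintype κ] [DecidableEq κ] in
theorem push_graphRel (τ : Ph d ι ≃ Ph d κ) (f : Ph d ι → ℂ) :
    push d (graphRel τ) f = f ∘ τ.symm := by
  ext y
  rw [push_apply, Finset.sum_eq_single (τ.symm y)]
  · simp [graphRel]
  · intro x _ hx
    rw [if_neg]
    rintro (rfl : τ x = y)
    simp at hx
  · simp

/-- Iterated push-forward weights each related pair by the number `N x z` of intermediate points.
For affine relations the sets of intermediate points are translates of each other, so this weight is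
constant on the composite. -/
theorem push_comp (r : SetRel (Ph d ι) (Ph d κ)) (s : SetRel (Ph d κ) (Ph d l))
    (hr : IsAffineRel r) (hs : IsAffineRel s) : ∃ c : ℝ, 0 < c ∧ ∀ f,
      push d s (push d r f) = (c : ℂ) • push d (r.comp s) f := by
  classical
  let N : Ph d ι → Ph d l → ℕ := fun x z =>
    (Finset.univ.filter fun y => (x, y) ∈ r ∧ (y, z) ∈ s).card
  have hN : ∀ f z, push d s (push d r f) z = ∑ x, (N x z : ℂ) * f x := by
    intro f z
    simp only [push, LinearMap.coe_mk, AddHom.coe_mk]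
    have : ∀ y, (if (y, z) ∈ s then ∑ x, (if (x, y) ∈ r then f x else 0) else 0) =
        ∑ x, if (x, y) ∈ r ∧ (y, z) ∈ s then f x else 0 := by
      intro y
      by_cases h : (y, z) ∈ s <;> simp [h]
    simp only [this]
    rw [Finset.sum_comm]
    refine Finset.sum_congr rfl fun x _ => ?_
    rw [← Finset.sum_filter, Finset.sum_const, nsmul_eq_mul]
  have hconst : ∀ x z x' z', (x, z) ∈ r.comp s → (x', z') ∈ r.comp s → N x z ≤ N x' z' := by
    rintro x z x' z' ⟨y, h1, h2⟩ ⟨y', h1', h2'⟩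
    -- Translation from one set of intermediate points to another. Both relations are closed under
    -- `a - b + c`, so it stays inside; equality of the counts follows by symmetry.
    refine Finset.card_le_card_of_injOn (fun w => w - y + y') ?_ ?_
    · intro w hw
      simp only [Finset.coe_filter, Finset.mem_univ, true_and, Set.mem_ofPred_eq] at hw ⊢
      refine ⟨?_, ?_⟩
      · simpa using hr _ hw.1 _ h1 _ h1'
      · simpa using hs _ hw.2 _ h2 _ h2'
    · intro w _ w' _ h
      simpa using h
  have hzero : ∀ x z, (x, z) ∉ r.comp s → N x z = 0 := by
    intro x z h
    rw [Finset.card_eq_zero, Finset.filter_eq_empty_iff]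
    intro y _ hy
    exact h ⟨y, hy⟩
  by_cases hne : ∃ x z, (x, z) ∈ r.comp s
  · obtain ⟨x₀, z₀, h₀⟩ := hne
    refine ⟨N x₀ z₀, ?_, fun f => ?_⟩
    · obtain ⟨y, hy⟩ := h₀
      exact Nat.cast_pos.2 (Finset.card_pos.2 ⟨y, by simpa using hy⟩)
    · ext z
      rw [hN, Pi.smul_apply, push_apply, Finset.smul_sum]
      refine Finset.sum_congr rfl fun x _ => ?_
      split_ifs with h
      · rw [le_antisymm (hconst _ _ _ _ h h₀) (hconst _ _ _ _ h₀ h)]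
        simp
      · simp [hzero x z h]
  · push Not at hne
    -- For an empty composite both sides vanish and any positive scalar would do.
    refine ⟨1, one_pos, fun f => ?_⟩
    ext z
    rw [hN, Pi.smul_apply, push_apply, Finset.smul_sum]
    refine Finset.sum_congr rfl fun x _ => ?_
    simp [hzero x z (hne x z), hne x z]

/-- At `y = S x + v` one has `ω(S u, y) = ω(u, x) + ω(S u, v)`, so a character goes to a character
up to the phase of the translation. -/
theorem push_character {τ : Ph d ι ≃ Ph d ι} {S : Ph d ι →ₗ[ZMod d] Ph d ι} {v : Ph d ι}
    (hS : ∀ x y, symp d ι (S x) (S y) = symp d ι x y) (hτ : ∀ x, τ x = S x + v) (u : Ph d ι) :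
    push d (graphRel τ) (character d u) = chi d (-symp d ι (S u) v) • character d (S u) := by
  ext y
  obtain ⟨x, rfl⟩ := τ.surjective y
  rw [push_graphRel, Function.comp_apply, Equiv.symm_apply_apply, Pi.smul_apply, smul_eq_mul,
    character, character, ← chi_add, hτ, map_add, hS]
  congr 1
  ring

end Push

section Clifford
variable {ι : Type} [Fintype ι] [DecidableEq ι]

/-- No explicit metaplectic operator is needed. Push-forward acts on displacement operators by `W(u)
↦ χ(-ω(S u, v)) W(S u)`; since `S` preserves the cocycle and the phase is additive in `u`, this is a
unital `*`-homomorphism, hence conjugation by a unitary. The same formula shows that the unitary is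
Clifford. -/
theorem exists_clifford (hd : d ≠ 2) {τ : Ph d ι ≃ Ph d ι} (hτ : IsAffineSymplectic d τ) :
    ∃ U, IsClifford d U ∧
      ∀ f, weylOp d (push d (graphRel τ) f) = U * weylOp d f * Uᴴ := by
  obtain ⟨S, v, hS, hτ⟩ := hτ
  let e := LinearEquiv.ofBijective _ (weylLin_bijective d hd (ι := ι))
  let Φ : Matrix (Conf d ι) (Conf d ι) ℂ →ₗ[ℂ] Matrix (Conf d ι) (Conf d ι) ℂ :=
    weylLin d ∘ₗ push d (graphRel τ) ∘ₗ e.symm.toLinearMap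
  have hΦ : ∀ f, Φ (weylOp d f) = weylOp d (push d (graphRel τ) f) := by
    intro f
    have : e.symm (weylOp d f) = f := e.symm_apply_apply f
    simp only [Φ, LinearMap.comp_apply, LinearEquiv.coe_coe, this, weylLin_apply]
  have hW : ∀ u, Φ (displacement d u) = chi d (-symp d ι (S u) v) • displacement d (S u) := by
    intro u
    rw [← weylOp_character, hΦ, push_character d hS hτ, ← weylLin_apply, map_smul,
      weylLin_apply, weylOp_character]
  obtain ⟨U, hU, h⟩ := exists_unitary_of_starHom Φ
    (by rw [← displacement_zero d, hW, map_zero, map_zero, LinearMap.zero_apply, neg_zero,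
          chi_zero, one_smul])
    (by
      intro A B
      obtain ⟨a, rfl⟩ := exists_eq_sum_displacement d hd A
      obtain ⟨b, rfl⟩ := exists_eq_sum_displacement d hd B
      simp only [Finset.sum_mul, Finset.mul_sum, map_sum, map_smul, smul_mul_assoc,
        mul_smul_comm, hW, Finset.smul_sum]
      refine Finset.sum_congr rfl fun u _ => Finset.sum_congr rfl fun w _ => ?_
      rw [displacement_mul d hd, displacement_mul d hd, map_smul, hW, hS, map_add, map_add,
        LinearMap.add_apply, neg_add, chi_add]
      simp only [smul_smul]
      congr 1
      ring)
    (by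
      intro A
      obtain ⟨a, rfl⟩ := exists_eq_sum_displacement d hd A
      simp only [Matrix.conjTranspose_sum, Matrix.conjTranspose_smul, map_sum, map_smul, hW,
        displacement_conjTranspose, star_chi]
      simp)
  refine ⟨U, ⟨hU, fun u => ⟨S u, _, (h _).symm.trans (hW u)⟩⟩, fun f => ?_⟩
  rw [← hΦ, h]

end Clifford

/-- Push-forward along `r` corresponds to a positive multiple of `ρ ↦ K ρ K†` under the Weyl
correspondence. -/
def Represents {ι κ : Type} [Fintype ι] [DecidableEq ι] [Fintype κ] [DecidableEq κ]
    (r : SetRel (Ph d ι) (Ph d κ)) (K : Matrix (Conf d κ) (Conf d ι) ℂ) : Prop :=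
  ∃ c : ℝ, 0 < c ∧ ∀ f, weylOp d (push d r f) = (c : ℂ) • (K * weylOp d f * Kᴴ)

section Calculus
set_option linter.unusedSectionVars false
variable {ι κ l ι' κ' : Type} [Fintype ι] [DecidableEq ι] [Fintype κ] [DecidableEq κ]
  [Fintype l] [DecidableEq l] [Fintype ι'] [DecidableEq ι'] [Fintype κ'] [DecidableEq κ']

theorem Represents.comp {r : SetRel (Ph d ι) (Ph d κ)} {s : SetRel (Ph d κ) (Ph d l)}
    {K : Matrix (Conf d κ) (Conf d ι) ℂ} {L : Matrix (Conf d l) (Conf d κ) ℂ}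
    (hr : IsAffineRel r) (hs : IsAffineRel s) (hK : Represents d r K) (hL : Represents d s L) :
    Represents d (r.comp s) (L * K) := by
  obtain ⟨a, ha, hK⟩ := hK
  obtain ⟨b, hb, hL⟩ := hL
  obtain ⟨c, hc, h⟩ := push_comp d r s hr hs
  have hc' : (c : ℂ) ≠ 0 := Complex.ofReal_ne_zero.2 hc.ne'
  refine ⟨c⁻¹ * (b * a), by positivity, fun f => ?_⟩
  have h1 : push d (r.comp s) f = (c : ℂ)⁻¹ • push d s (push d r f) := by
    rw [h, inv_smul_smul₀ hc']
  rw [h1, ← weylLin_apply, map_smul, weylLin_apply, hL, hK, Matrix.conjTranspose_mul]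
  simp only [Matrix.mul_smul, Matrix.smul_mul, smul_smul, Matrix.mul_assoc]
  push_cast
  rfl

/-- Weyl operators exhaust all matrices, so matrix units may be inserted; the two superoperators
then agree entrywise, and a fixed nonzero entry of `L` determines the ratio. This converts equal
relations into proportional operators. -/
theorem Represents.unique (hd : d ≠ 2) {r : SetRel (Ph d ι) (Ph d κ)}
    {K L : Matrix (Conf d κ) (Conf d ι) ℂ}
    (hK : Represents d r K) (hL : Represents d r L) : ∃ c : ℂ, c ≠ 0 ∧ L = c • K := by
  obtain ⟨a, ha, hK⟩ := hK
  obtain ⟨b, hb, hL⟩ := hL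
  have ha' : (a : ℂ) ≠ 0 := Complex.ofReal_ne_zero.2 ha.ne'
  have hb' : (b : ℂ) ≠ 0 := Complex.ofReal_ne_zero.2 hb.ne'
  have h : ∀ i j k l, (a : ℂ) * (K i j * star (K k l)) = b * (L i j * star (L k l)) := by
    intro i j k l
    obtain ⟨f, hf⟩ := exists_eq_weylOp d hd (Matrix.single j l 1)
    have := congrFun (congrFun ((hK f).symm.trans (hL f)) i) k
    simpa [hf, Matrix.mul_apply, Matrix.single_apply, ite_and] using this
  by_cases hL0 : L = 0
  · have : K = 0 := by
      ext i j
      have := h i j i j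
      simpa [hL0, ha'] using this
    exact ⟨1, one_ne_zero, by rw [hL0, this, smul_zero]⟩
  · obtain ⟨k, l, hkl⟩ : ∃ k l, L k l ≠ 0 := by
      by_contra! h0
      exact hL0 (Matrix.ext h0)
    have hK0 : K k l ≠ 0 := by
      intro h0
      have := h k l k l
      rw [h0, zero_mul, mul_zero, zero_eq_mul] at this
      simp [hb', hkl] at this
    -- The solution of `a * K i j * star (K k l) = b * L i j * star (L k l)` for `L i j`, with the
    -- nonzero entry at `(k, l)` fixed.
    refine ⟨a * star (K k l) / (b * star (L k l)), by simp [ha', hb', hK0, hkl], ?_⟩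
    ext i j
    have hs : star (L k l) ≠ 0 := star_ne_zero.2 hkl
    rw [Matrix.smul_apply, smul_eq_mul, div_mul_eq_mul_div, eq_div_iff (mul_ne_zero hb' hs)]
    linear_combination -(h i j k l)

/-- Push-forward along the converse is the transpose of push-forward along `r`, and `σ ↦ K† σ K` is
the transpose of `ρ ↦ K ρ K†` for the trace form. The Weyl correspondence matches the two pairings
up to scale. -/
theorem Represents.inv (hd : d ≠ 2) {r : SetRel (Ph d ι) (Ph d κ)}
    {K : Matrix (Conf d κ) (Conf d ι) ℂ} (hK : Represents d r K) : Represents d r.inv Kᴴ := by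
  classical
  obtain ⟨c, hc, hK⟩ := hK
  have hι := card_ne_zero (Conf d ι)
  have hκ := card_ne_zero (Conf d κ)
  -- The quotient of cardinalities compares the trace normalizations of the two systems.
  refine ⟨c * Fintype.card (Conf d κ) / Fintype.card (Conf d ι),
    by have : 0 < Fintype.card (Conf d ι) := Fintype.card_pos
       have : 0 < Fintype.card (Conf d κ) := Fintype.card_pos
       positivity, fun g => ?_⟩
  rw [Matrix.ext_iff_trace_mul_left]
  intro A
  obtain ⟨f, rfl⟩ := exists_eq_weylOp d hd A
  have hdual : ∑ x, f x * push d r.inv g x = ∑ y, push d r f y * g y := by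
    simp only [push_apply, Finset.mul_sum, Finset.sum_mul, SetRel.mem_inv]
    rw [Finset.sum_comm]
    refine Finset.sum_congr rfl fun y _ => Finset.sum_congr rfl fun x _ => ?_
    split_ifs <;> simp
  have h1 := trace_weylOp_mul d hd (push d r f) g
  rw [hK, Matrix.smul_mul, Matrix.trace_smul, ← hdual] at h1
  have h2 : (weylOp d f * (Kᴴ * weylOp d g * Kᴴᴴ)).trace =
      (K * weylOp d f * Kᴴ * weylOp d g).trace := by
    rw [Matrix.conjTranspose_conjTranspose, ← Matrix.mul_assoc, Matrix.trace_mul_comm]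
    simp only [Matrix.mul_assoc]
  rw [trace_weylOp_mul d hd, Matrix.mul_smul, Matrix.trace_smul, h2]
  rw [smul_eq_mul] at h1 ⊢
  push_cast
  field_simp at h1 ⊢
  linear_combination -h1

/-- The tensor product of operators. -/
def kron {ι κ ι' κ' : Type} (K : Matrix (Conf d κ) (Conf d ι) ℂ)
    (L : Matrix (Conf d κ') (Conf d ι') ℂ) : Matrix (Conf d (κ ⊕ κ')) (Conf d (ι ⊕ ι')) ℂ :=
  fun y x => K (y ∘ Sum.inl) (x ∘ Sum.inl) * L (y ∘ Sum.inr) (x ∘ Sum.inr)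

/-- The product of functions on two phase spaces. -/
def boxProd {ι ι' : Type} (f : Ph d ι → ℂ) (g : Ph d ι' → ℂ) : Ph d (ι ⊕ ι') → ℂ :=
  fun z => f (z ∘ Sum.inl) * g (z ∘ Sum.inr)

theorem sum_sum_arrow {α β γ M : Type} [Fintype α] [Fintype β] [Fintype γ] [DecidableEq α]
    [DecidableEq β] [AddCommMonoid M] (F : (α ⊕ β → γ) → M) :
    ∑ z, F z = ∑ x : α → γ, ∑ y : β → γ, F (Sum.elim x y) := by
  rw [← Fintype.sum_prod_type', ← (Equiv.sumArrowEquivProdArrow α β γ).symm.sum_comp]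
  rfl

theorem sum_arrow_mul {α β γ : Type} [Fintype α] [Fintype β] [Fintype γ] [DecidableEq α]
    [DecidableEq β] (F : (α → γ) → ℂ) (G : (β → γ) → ℂ) :
    ∑ z : α ⊕ β → γ, F (z ∘ Sum.inl) * G (z ∘ Sum.inr) = (∑ x, F x) * ∑ y, G y := by
  rw [sum_sum_arrow, Finset.sum_mul_sum]
  simp

theorem kron_mul (K : Matrix (Conf d κ) (Conf d ι) ℂ) (K' : Matrix (Conf d l) (Conf d κ) ℂ)
    {l' : Type} (L : Matrix (Conf d κ') (Conf d ι') ℂ) (L' : Matrix (Conf d l') (Conf d κ') ℂ) :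
    kron d K' L' * kron d K L = kron d (K' * K) (L' * L) := by
  ext y x
  simp only [kron, Matrix.mul_apply]
  rw [← sum_arrow_mul]
  exact Finset.sum_congr rfl fun z _ => by ring

theorem kron_conjTranspose (K : Matrix (Conf d κ) (Conf d ι) ℂ)
    (L : Matrix (Conf d κ') (Conf d ι') ℂ) : (kron d K L)ᴴ = kron d Kᴴ Lᴴ := by
  ext y x
  simp [kron, Matrix.conjTranspose_apply]

theorem kron_smul (a b : ℂ) (K : Matrix (Conf d κ) (Conf d ι) ℂ)
    (L : Matrix (Conf d κ') (Conf d ι') ℂ) : kron d (a • K) (b • L) = (a * b) • kron d K L := by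
  ext y x
  simp only [kron, Matrix.smul_apply, smul_eq_mul]
  ring

theorem weylOp_boxProd (f : Ph d ι → ℂ) (g : Ph d ι' → ℂ) :
    weylOp d (boxProd d f g) = kron d (weylOp d f) (weylOp d g) := by
  ext x y
  have hcard : (Fintype.card (Conf d (ι ⊕ ι')) : ℂ) =
      Fintype.card (Conf d ι) * Fintype.card (Conf d ι') := by
    rw [Fintype.card_congr (Equiv.sumArrowEquivProdArrow ι ι' (ZMod d)), Fintype.card_prod]
    push_cast
    rfl
  simp only [weylOp, kron, hcard, mul_inv]
  rw [mul_mul_mul_comm, ← sum_arrow_mul]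
  refine congrArg _ (Finset.sum_congr rfl fun b _ => ?_)
  rw [Fintype.sum_sum_type, chi_add, mul_mul_mul_comm]
  rfl

theorem push_boxProd (r : SetRel (Ph d ι) (Ph d κ)) (s : SetRel (Ph d ι') (Ph d κ'))
    (f : Ph d ι → ℂ) (g : Ph d ι' → ℂ) :
    push d (tensorRel d r s) (boxProd d f g) = boxProd d (push d r f) (push d s g) := by
  classical
  ext z
  simp only [boxProd, push_apply]
  rw [← sum_arrow_mul]
  refine Finset.sum_congr rfl fun x _ => ?_
  by_cases h1 : (x ∘ Sum.inl, z ∘ Sum.inl) ∈ r <;>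
    by_cases h2 : (x ∘ Sum.inr, z ∘ Sum.inr) ∈ s <;> simp [tensorRel, h1, h2]

theorem character_sum (u : Ph d (ι ⊕ ι')) : character d u =
    boxProd d (character d (u ∘ Sum.inl)) (character d (u ∘ Sum.inr)) := by
  ext z
  simp only [character, boxProd, symp_sum, chi_add]

/-- A character of the joint system is a product of characters, on which push-forward, Weyl
operators and conjugation all factor; characters span. -/
theorem Represents.tensor {r : SetRel (Ph d ι) (Ph d κ)} {s : SetRel (Ph d ι') (Ph d κ')}
    {K : Matrix (Conf d κ) (Conf d ι) ℂ} {L : Matrix (Conf d κ') (Conf d ι') ℂ}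
    (hK : Represents d r K) (hL : Represents d s L) :
    Represents d (tensorRel d r s) (kron d K L) := by
  obtain ⟨a, ha, hK⟩ := hK
  obtain ⟨b, hb, hL⟩ := hL
  refine ⟨a * b, mul_pos ha hb, fun f => ?_⟩
  have : weylLin d ∘ₗ push d (tensorRel d r s) = ((a * b : ℝ) : ℂ) •
      ((mulRightLinearMap (Conf d (κ ⊕ κ')) ℂ (kron d K L)ᴴ) ∘ₗ
      (mulLeftLinearMap (Conf d (ι ⊕ ι')) ℂ (kron d K L)) ∘ₗ weylLin d) := by
    refine hom_ext_character d fun u => ?_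
    simp only [LinearMap.comp_apply, LinearMap.smul_apply, weylLin_apply,
      mulRightLinearMap_apply, mulLeftLinearMap_apply]
    rw [character_sum, push_boxProd, weylOp_boxProd, weylOp_boxProd, hK, hL, kron_conjTranspose,
      kron_mul, kron_mul, kron_smul]
    push_cast
    rfl
  exact LinearMap.congr_fun this f

/-- The operator which permutes tensor factors. -/
def relabelMatrix {ι κ : Type} [Fintype ι] [DecidableEq ι] (f : ι ≃ κ) :
    Matrix (Conf d κ) (Conf d ι) ℂ :=
  fun y x => if y ∘ f = x then 1 else 0

theorem Represents.relabel (f : ι ≃ κ) : Represents d (relabelRel d f) (relabelMatrix d f) := by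
  refine ⟨1, one_pos, fun g => ?_⟩
  ext x y
  have h1 : (relabelMatrix d f * weylOp d g * (relabelMatrix d f)ᴴ) x y =
      weylOp d g (x ∘ f) (y ∘ f) := by
    simp [relabelMatrix, Matrix.mul_apply, Matrix.conjTranspose_apply, apply_ite]
  rw [Complex.ofReal_one, one_smul, h1, relabelRel_eq_graphRel, push_graphRel]
  simp only [weylOp]
  rw [Fintype.card_congr (f.symm.arrowCongr (Equiv.refl (ZMod d))),
    ← (f.symm.arrowCongr (Equiv.refl (ZMod d))).sum_comp]
  refine congrArg _ (Finset.sum_congr rfl fun b _ => ?_)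
  rw [← f.sum_comp]
  rfl

theorem Represents.id : Represents d (SetRel.id : SetRel (Ph d ι) (Ph d ι)) 1 := by
  refine ⟨1, one_pos, fun f => ?_⟩
  have : (SetRel.id : SetRel (Ph d ι) (Ph d ι)) = graphRel (Equiv.refl _) := rfl
  rw [this, push_graphRel]
  simp

theorem Represents.graph (hd : d ≠ 2) {τ : Ph d ι ≃ Ph d ι} (hτ : IsAffineSymplectic d τ) :
    ∃ U, Stab d U ∧ Represents d (graphRel τ) U := by
  obtain ⟨U, hU, h⟩ := exists_clifford d hd hτ
  exact ⟨U, Stab.clifford U hU, 1, one_pos, fun f => by rw [h, Complex.ofReal_one, one_smul]⟩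

end Calculus

end Representation


/-! ### Stabilizer operations for the generators of `Spek` -/

noncomputable section Stabilizer
variable (d : ℕ) [Fact d.Prime]

/-- The state of one system in which the position vanishes. -/
def positionState : SetRel (Ph d Empty) (Ph d Unit) := {t | (t.2 ()).1 = 0}

/-- The computational basis state `|0⟩`. -/
def ketZero : Matrix (Conf d Unit) (Conf d Empty) ℂ := fun x _ => if x () = 0 then 1 else 0

/-- The Weyl kernel of the indicator of zero position is supported where both midpoint and
difference vanish. As `2` is invertible, this means both arguments vanish, which gives the kernel of
`|0⟩⟨0|`. -/
theorem positionState_represents (hd : d ≠ 2) :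
    Represents d (positionState d) (ketZero d) := by
  have h2 := two_ne_zero_of_ne_two d hd
  refine ⟨1, one_pos, fun f => ?_⟩
  have hp : ∀ y, push d (positionState d) f y = if (y ()).1 = 0 then f 0 else 0 := by
    intro y
    rw [push_apply, Finset.sum_eq_single 0
      (fun x _ hx => absurd (Subsingleton.elim x 0) hx) (fun h => absurd (Finset.mem_univ _) h)]
    have hm : ((0, y) : Ph d Empty × Ph d Unit) ∈ positionState d ↔ (y ()).1 = 0 := Iff.rfl
    by_cases h : (y ()).1 = 0
    · exact (if_pos (hm.2 h)).trans (if_pos h).symm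
    · exact (if_neg (mt hm.1 h)).trans (if_neg h).symm
  have hW : ∀ x y, weylOp d f x y = f 0 := by
    intro x y
    simp only [weylOp]
    rw [Fintype.sum_unique, Subsingleton.elim (fun _ => _ : Ph d Empty) 0]
    simp [chi_zero]
  ext x y
  have hR : (ketZero d * weylOp d f * (ketZero d)ᴴ) x y =
      if x () = 0 ∧ y () = 0 then f 0 else 0 := by
    simp only [Matrix.mul_apply, Matrix.conjTranspose_apply, Fintype.sum_unique, hW, ketZero]
    split_ifs <;> simp_all
  rw [Complex.ofReal_one, one_smul, hR]
  simp only [weylOp, hp]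
  have hs := sum_chi_conf d (x - y)
  simp only [Pi.sub_apply] at hs
  have hxy : x - y = 0 ↔ x () = y () := by
    rw [sub_eq_zero, funext_iff, Unique.forall_iff]
  have hiff : (x () = 0 ∧ y () = 0) ↔ ((x () + y ()) * 2⁻¹ = 0 ∧ x - y = 0) := by
    rw [hxy, mul_eq_zero, or_iff_left (inv_ne_zero h2)]
    constructor
    · rintro ⟨h, h'⟩
      simp [h, h']
    · rintro ⟨h, h'⟩
      rw [← h', ← two_mul, mul_eq_zero, or_iff_right h2] at h
      exact ⟨h, h' ▸ h⟩
  have hc := card_ne_zero (Conf d Unit)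
  rw [if_congr hiff rfl rfl, ite_and]
  by_cases h : (x () + y ()) * 2⁻¹ = 0
  · simp only [h, if_true]
    rw [← Finset.mul_sum, hs]
    split_ifs
    · field_simp
    · simp
  · simp [h]

theorem positionState_isAffineRel : IsAffineRel (positionState d) := by
  intro a ha b hb c hc
  simp only [positionState, Set.mem_ofPred_eq] at *
  simp [ha, hb, hc]

/-- The Fourier transform on phase space. -/
def fourierEquiv : Ph d Unit ≃ Ph d Unit where
  toFun x i := ((x i).2, -(x i).1)
  invFun x i := (-(x i).2, (x i).1)
  left_inv x := by ext i <;> simp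
  right_inv x := by ext i <;> simp

theorem fourierEquiv_isAffineSymplectic : IsAffineSymplectic d (fourierEquiv d) := by
  refine ⟨⟨⟨fourierEquiv d, fun x y => ?_⟩, fun c x => ?_⟩, 0, fun x y => ?_, fun x => ?_⟩
  · ext i <;> simp [fourierEquiv]
    ring
  · ext i <;> simp [fourierEquiv]
  · simp [fourierEquiv, symp_apply]
    ring
  · simp

/-- The classical controlled shift on phase space. -/
def shiftEquiv : Ph d (Unit ⊕ Unit) ≃ Ph d (Unit ⊕ Unit) where
  toFun x := Sum.elim (fun _ => ((x (.inl ())).1, (x (.inl ())).2 + (x (.inr ())).2))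
    (fun _ => ((x (.inr ())).1 - (x (.inl ())).1, (x (.inr ())).2))
  invFun x := Sum.elim (fun _ => ((x (.inl ())).1, (x (.inl ())).2 - (x (.inr ())).2))
    (fun _ => ((x (.inr ())).1 + (x (.inl ())).1, (x (.inr ())).2))
  left_inv x := by ext i <;> rcases i with i | i <;> simp
  right_inv x := by ext i <;> rcases i with i | i <;> simp

theorem shiftEquiv_isAffineSymplectic : IsAffineSymplectic d (shiftEquiv d) := by
  refine ⟨⟨⟨shiftEquiv d, fun x y => ?_⟩, fun c x => ?_⟩, 0, fun x y => ?_, fun x => ?_⟩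
  · ext i <;> rcases i with i | i <;> simp [shiftEquiv] <;> ring
  · ext i <;> rcases i with i | i <;> simp [shiftEquiv] <;> ring
  · simp [shiftEquiv, symp_apply]
    ring
  · simp

theorem IsAffineSymplectic.isAffineRel {ι : Type} [Fintype ι] {τ : Ph d ι ≃ Ph d ι}
    (h : IsAffineSymplectic d τ) : IsAffineRel (graphRel τ) := by
  obtain ⟨S, v, -, hS⟩ := h
  intro a ha b hb c hc
  simp only [graphRel, Set.mem_ofPred_eq, hS] at ha hb hc ⊢
  simp [← ha, ← hb, ← hc]
  abel

theorem isAffineRel_tensorRel {ι κ ι' κ' : Type} {r : SetRel (Ph d ι) (Ph d κ)}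
    {s : SetRel (Ph d ι') (Ph d κ')} (hr : IsAffineRel r) (hs : IsAffineRel s) :
    IsAffineRel (tensorRel d r s) := fun _ ha _ hb _ hc =>
  ⟨hr _ ha.1 _ hb.1 _ hc.1, hs _ ha.2 _ hb.2 _ hc.2⟩

theorem isAffineRel_comp {X Y Z : Type} [AddCommGroup X] [AddCommGroup Y] [AddCommGroup Z]
    {r : SetRel X Y} {s : SetRel Y Z} (hr : IsAffineRel r) (hs : IsAffineRel s) :
    IsAffineRel (r.comp s) := by
  rintro ⟨a, a'⟩ ⟨x, h1, k1⟩ ⟨b, b'⟩ ⟨y, h2, k2⟩ ⟨c, c'⟩ ⟨z, h3, k3⟩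
  exact ⟨x - y + z, hr _ h1 _ h2 _ h3, hs _ k1 _ k2 _ k3⟩

theorem isAffineRel_inv {X Y : Type} [AddCommGroup X] [AddCommGroup Y] {r : SetRel X Y}
    (hr : IsAffineRel r) : IsAffineRel r.inv :=
  fun _ ha _ hb _ hc => hr _ ha _ hb _ hc

/-- The toy unit is the state `|0⟩` rotated from position to momentum by the Fourier transform,
which exhibits it as a stabilizer state. -/
theorem toyUnit_eq_comp :
    stateRel d (toyUnit d Unit) = (positionState d).comp (graphRel (fourierEquiv d)) := by
  ext ⟨x, y⟩
  simp only [stateRel, toyUnit, positionState, graphRel, SetRel.mem_comp, Set.mem_ofPred_eq]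
  constructor
  · intro h
    exact ⟨(fourierEquiv d).symm y, by simp [fourierEquiv, h ()], by simp⟩
  · rintro ⟨z, hz, rfl⟩ i
    simp [fourierEquiv, hz]

/-- The controlled shift turns the first momentum into the sum of the momenta and the second
position into the difference of the positions. Projecting the second system on zero position imposes
equal positions and discards its momentum. -/
theorem toyMul_eq_comp : joinRel d (toyMul d Unit) =
    ((graphRel (shiftEquiv d)).comp (tensorRel d SetRel.id (positionState d).inv)).comp
      (relabelRel d (Equiv.sumEmpty Unit Empty)) := by
  rw [comp_relabelRel]
  ext ⟨x, y⟩
  simp only [joinRel, toyMul, positionState, graphRel, tensorRel, SetRel.mem_comp, SetRel.mem_inv,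
    Set.mem_ofPred_eq, SetRel.mem_id, exists_eq_left', Unique.forall_iff]
  constructor
  · rintro ⟨h1, h2⟩
    refine ⟨?_, ?_⟩
    · funext i
      exact h2.symm
    · change (x (.inr ())).1 - (x (.inl ())).1 = 0
      exact sub_eq_zero.2 h1.symm
  · rintro ⟨h1, h2⟩
    exact ⟨(sub_eq_zero.1 h2).symm, (congrFun h1 ()).symm⟩

theorem toyUnit_exists_stab (hd : d ≠ 2) :
    ∃ K, Stab d K ∧ Represents d (stateRel d (toyUnit d Unit)) K := by
  have hτ := fourierEquiv_isAffineSymplectic d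
  obtain ⟨U, hU, hτU⟩ := Represents.graph d hd hτ
  rw [toyUnit_eq_comp]
  exact ⟨U * ketZero d, Stab.comp Stab.ket0 hU, (positionState_represents d hd).comp d
    (positionState_isAffineRel d) (hτ.isAffineRel d) hτU⟩

theorem toyMul_exists_stab (hd : d ≠ 2) :
    ∃ K, Stab d K ∧ Represents d (joinRel d (toyMul d Unit)) K := by
  have hτ := shiftEquiv_isAffineSymplectic d
  obtain ⟨U, hU, hτU⟩ := Represents.graph d hd hτ
  have hid : IsAffineRel (SetRel.id : SetRel (Ph d Unit) (Ph d Unit)) :=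
    (Spek.id d Unit).isAffineRel
  have ht := isAffineRel_tensorRel d hid (isAffineRel_inv (positionState_isAffineRel d))
  rw [toyMul_eq_comp]
  exact ⟨relabelMatrix d (Equiv.sumEmpty Unit Empty) * (kron d 1 (ketZero d)ᴴ * U),
    Stab.comp (Stab.comp hU (Stab.tensor (Stab.one d Unit) (Stab.adjoint Stab.ket0)))
      (Stab.relabel _),
    (hτU.comp d (hτ.isAffineRel d) ht
      ((Represents.id d).tensor d ((positionState_represents d hd).inv d hd))).comp d
      (isAffineRel_comp (hτ.isAffineRel d) ht) (Spek.relabel _).isAffineRel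
      (Represents.relabel d _)⟩

/-- Each constructor of `Spek` has a counterpart in `Stab`, with affine maps going to Clifford
unitaries and the two toy generators to circuits built from `|0⟩`. Affineness enters at composites.
-/
theorem Spek.exists_stab (hd : d ≠ 2) {ι κ : Type} {r : SetRel (Ph d ι) (Ph d κ)}
    (h : Spek d r) : ∀ [Fintype ι] [DecidableEq ι] [Fintype κ] [DecidableEq κ],
      ∃ K, Stab d K ∧ Represents d r K := by
  induction h with
  | unit =>
    intro i1 i2 i3 i4
    convert toyUnit_exists_stab d hd
  | mul =>
    intro i1 i2 i3 i4
    convert toyMul_exists_stab d hd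
  | affine τ h =>
    intro i1 i2 i3 i4
    obtain rfl := Subsingleton.elim i1 i3
    obtain rfl := Subsingleton.elim i2 i4
    obtain rfl := Subsingleton.elim i1 PUnit.fintype
    exact Represents.graph d hd h
  | relabel f =>
    intro i1 i2 i3 i4
    exact ⟨relabelMatrix d f, Stab.relabel f, Represents.relabel d f⟩
  | @comp ι κ l r s hr hs ihr ihs =>
    intro i1 i2 i3 i4
    classical
    have := @Fintype.ofFinite κ (hr.finite d).2
    obtain ⟨K, hK, hrK⟩ := ihr
    obtain ⟨L, hL, hsL⟩ := ihs
    exact ⟨L * K, Stab.comp hK hL, hrK.comp d (hr.isAffineRel d) (hs.isAffineRel d) hsL⟩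
  | @tensor ι κ ι' κ' r s hr hs ihr ihs =>
    intro i1 i2 i3 i4
    classical
    have := @Fintype.ofFinite ι (hr.finite d).1
    have := @Fintype.ofFinite κ (hr.finite d).2
    have := @Fintype.ofFinite ι' (hs.finite d).1
    have := @Fintype.ofFinite κ' (hs.finite d).2
    obtain ⟨K, hK, hrK⟩ := ihr
    obtain ⟨L, hL, hsL⟩ := ihs
    refine ⟨kron d K L, Stab.tensor hK hL, ?_⟩
    convert hrK.tensor d hsL
  | converse h ih =>
    intro i1 i2 i3 i4
    obtain ⟨K, hK, hrK⟩ := ih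
    exact ⟨Kᴴ, Stab.adjoint hK, hrK.inv d hd⟩

end Stabilizer


/-! ### Frobenius algebras in Hilbert spaces from structure constants -/

noncomputable section HilbertFrobenius

/-- The structure constants of a special dagger Frobenius algebra in an orthonormal basis. -/
structure IsFrobeniusKernel {X : Type} [Fintype X] [DecidableEq X] (k : X → X → X → ℂ)
    (e : X → ℂ) : Prop where
  frob_left : ∀ a b p q, ∑ c, star (k a p c) * k q c b = ∑ z, k z a b * star (k z p q)
  frob_right : ∀ a b p q, ∑ c, star (k b c q) * k p a c = ∑ z, k z a b * star (k z p q)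
  special : ∀ z z', ∑ x, ∑ y, k z x y * star (k z' x y) = if z = z' then 1 else 0
  assoc : ∀ a b c w, ∑ t, k t a b * k w t c = ∑ t, k t b c * k w a t
  unit_left : ∀ a w, ∑ u, e u * k w u a = if w = a then 1 else 0
  unit_right : ∀ a w, ∑ u, e u * k w a u = if w = a then 1 else 0

section Basis
variable {X : Type} [Fintype X] [DecidableEq X] {H : Type} [NormedAddCommGroup H]
  [InnerProductSpace ℂ H] [FiniteDimensional ℂ H] {k : X → X → X → ℂ} {e : X → ℂ}

omit [DecidableEq X] in
theorem adjoint_mul_apply (b : OrthonormalBasis X ℂ H) {mul : H ⊗[ℂ] H →ₗ[ℂ] H}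
    (hmul : ∀ x y, mul (b x ⊗ₜ[ℂ] b y) = ∑ z, k z x y • b z) (z : X) :
    LinearMap.adjoint mul (b z) = ∑ x, ∑ y, star (k z x y) • (b x ⊗ₜ[ℂ] b y) := by
  classical
  rw [← (b.tensorProduct b).sum_repr' (LinearMap.adjoint mul (b z)), Fintype.sum_prod_type]
  refine Finset.sum_congr rfl fun x _ => Finset.sum_congr rfl fun y _ => ?_
  rw [LinearMap.adjoint_inner_right, OrthonormalBasis.tensorProduct_apply, hmul, sum_inner,
    Finset.sum_eq_single z]
  · rw [inner_smul_left, b.inner_eq_one, mul_one]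
    rfl
  · intro w _ hw
    rw [inner_smul_left, b.inner_eq_zero hw, mul_zero]
  · simp

/-- Orthonormality makes the adjoint of the multiplication have the conjugate structure constants;
each axiom is then a comparison of coefficients. -/
theorem IsFrobeniusKernel.isHilbFrobenius (hk : IsFrobeniusKernel k e)
    (b : OrthonormalBasis X ℂ H) {mul : H ⊗[ℂ] H →ₗ[ℂ] H} {unit : H}
    (hmul : ∀ x y, mul (b x ⊗ₜ[ℂ] b y) = ∑ z, k z x y • b z) (hunit : unit = ∑ x, e x • b x) :
    IsHilbFrobenius mul unit := by
  have hadj := adjoint_mul_apply b hmul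
  have ext2 : ∀ {f g : H ⊗[ℂ] H →ₗ[ℂ] H ⊗[ℂ] H}, (∀ x y, f (b x ⊗ₜ b y) = g (b x ⊗ₜ b y)) →
      f = g := by
    intro f g h
    refine (b.tensorProduct b).toBasis.ext fun p => ?_
    rw [OrthonormalBasis.coe_toBasis, OrthonormalBasis.tensorProduct_apply]
    exact h p.1 p.2
  have hR : ∀ x y, (LinearMap.adjoint mul ∘ₗ mul) (b x ⊗ₜ b y) =
      ∑ p, ∑ q, (∑ z, k z x y * star (k z p q)) • (b p ⊗ₜ[ℂ] b q) := by
    intro x y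
    rw [LinearMap.comp_apply, hmul, map_sum]
    simp only [map_smul, hadj, Finset.smul_sum, smul_smul, Finset.sum_smul]
    rw [Finset.sum_comm]
    exact Finset.sum_congr rfl fun p _ => Finset.sum_comm
  refine ⟨ext2 fun x y => ?_, ext2 fun x y => ?_, b.toBasis.ext fun z => ?_, ?_, fun a => ?_,
    fun a => ?_⟩
  · rw [hR]
    simp only [LinearMap.comp_apply, LinearMap.rTensor_tmul, hadj, TensorProduct.sum_tmul,
      map_sum, ← TensorProduct.smul_tmul', map_smul, LinearEquiv.coe_coe,
      TensorProduct.assoc_tmul, LinearMap.lTensor_tmul, hmul, TensorProduct.tmul_sum,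
      TensorProduct.tmul_smul,
      Finset.smul_sum, smul_smul, ← hk.frob_left, Finset.sum_smul]
    refine Finset.sum_congr rfl fun p _ => ?_
    rw [Finset.sum_comm]
  · rw [hR]
    simp only [LinearMap.comp_apply, LinearMap.lTensor_tmul, hadj, TensorProduct.tmul_sum,
      map_sum, TensorProduct.tmul_smul, map_smul, LinearEquiv.coe_coe,
      TensorProduct.assoc_symm_tmul, LinearMap.rTensor_tmul, hmul, TensorProduct.sum_tmul,
      ← TensorProduct.smul_tmul', Finset.smul_sum, smul_smul, ← hk.frob_right, Finset.sum_smul]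
    rw [Finset.sum_comm]
    conv_rhs => rw [Finset.sum_comm]
    refine Finset.sum_congr rfl fun q _ => ?_
    rw [Finset.sum_comm]
  · simp only [LinearMap.comp_apply, OrthonormalBasis.coe_toBasis, hadj, map_sum, map_smul, hmul,
      LinearMap.id_apply, Finset.smul_sum, smul_smul]
    have : ∑ x, ∑ y, ∑ w, (star (k z x y) * k w x y) • b w =
        ∑ w, (∑ x, ∑ y, k w x y * star (k z x y)) • b w := by
      simp only [Finset.sum_smul]
      conv_rhs => rw [Finset.sum_comm]
      refine Finset.sum_congr rfl fun x _ => ?_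
      rw [Finset.sum_comm]
      exact Finset.sum_congr rfl fun w _ => Finset.sum_congr rfl fun y _ => by rw [mul_comm]
    rw [this]
    simp only [hk.special, ite_smul, one_smul, zero_smul, Finset.sum_ite_eq', Finset.mem_univ,
      if_true]
  · refine ((b.tensorProduct b).tensorProduct b).toBasis.ext fun p => ?_
    obtain ⟨⟨x, y⟩, z⟩ := p
    simp only [LinearMap.comp_apply, OrthonormalBasis.coe_toBasis,
      OrthonormalBasis.tensorProduct_apply, LinearEquiv.coe_coe, TensorProduct.assoc_tmul,
      LinearMap.lTensor_tmul, LinearMap.rTensor_tmul, hmul, TensorProduct.tmul_sum,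
      TensorProduct.sum_tmul, TensorProduct.tmul_smul, ← TensorProduct.smul_tmul', map_sum,
      map_smul, Finset.smul_sum, smul_smul]
    rw [Finset.sum_comm]
    conv_rhs => rw [Finset.sum_comm]
    refine Finset.sum_congr rfl fun w _ => ?_
    rw [← Finset.sum_smul, ← Finset.sum_smul, hk.assoc]
  · have : mul ∘ₗ TensorProduct.mk ℂ H H unit = LinearMap.id := by
      refine b.toBasis.ext fun x => ?_
      simp only [LinearMap.comp_apply, OrthonormalBasis.coe_toBasis, TensorProduct.mk_apply]
      simp only [hunit, TensorProduct.sum_tmul, ← TensorProduct.smul_tmul', map_sum, map_smul, hmul,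
        Finset.smul_sum, smul_smul, LinearMap.id_apply]
      rw [Finset.sum_comm]
      simp only [← Finset.sum_smul, hk.unit_left]
      simp
    exact LinearMap.congr_fun this a
  · have : mul ∘ₗ (TensorProduct.mk ℂ H H).flip unit = LinearMap.id := by
      refine b.toBasis.ext fun x => ?_
      simp only [LinearMap.comp_apply, OrthonormalBasis.coe_toBasis, LinearMap.flip_apply,
        TensorProduct.mk_apply]
      simp only [hunit, TensorProduct.tmul_sum, TensorProduct.tmul_smul, map_sum, map_smul, hmul,
        Finset.smul_sum, smul_smul, LinearMap.id_apply]
      rw [Finset.sum_comm]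
      simp only [← Finset.sum_smul, hk.unit_right]
      simp
    exact LinearMap.congr_fun this a

omit [FiniteDimensional ℂ H] [DecidableEq X] in
theorem exists_mul_of_kernel (b : OrthonormalBasis X ℂ H) (k : X → X → X → ℂ) :
    ∃ mul : H ⊗[ℂ] H →ₗ[ℂ] H, ∀ x y, mul (b x ⊗ₜ[ℂ] b y) = ∑ z, k z x y • b z := by
  refine ⟨(b.toBasis.tensorProduct b.toBasis).constr ℂ fun p => ∑ z, k z p.1 p.2 • b z,
    fun x y => ?_⟩
  have := (b.toBasis.tensorProduct b.toBasis).constr_basis ℂ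
    (fun p => ∑ z, k z p.1 p.2 • b z) (x, y)
  rwa [Module.Basis.tensorProduct_apply, b.coe_toBasis] at this

end Basis

/-- The scalars in the Frobenius algebra equations are fixed by normalization. -/
theorem exists_isFrobeniusKernel_smul {X : Type} [Fintype X] [DecidableEq X] [Nonempty X]
    {k : X → X → X → ℂ} {e : X → ℂ} {α β σ l μ ν : ℂ} (hα : α ≠ 0) (hσ : σ ≠ 0)
    (frob_left : ∀ a b p q, ∑ c, star (k a p c) * k q c b = μ * ∑ z, k z a b * star (k z p q))
    (frob_right : ∀ a b p q, ∑ c, star (k b c q) * k p a c = ν * ∑ z, k z a b * star (k z p q))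
    (special : ∀ z z', ∑ x, ∑ y, k z x y * star (k z' x y) = if z = z' then σ else 0)
    (assoc : ∀ a b c w, ∑ t, k t a b * k w t c = l * ∑ t, k t b c * k w a t)
    (unit_left : ∀ a w, ∑ u, e u * k w u a = if w = a then α else 0)
    (unit_right : ∀ a w, ∑ u, e u * k w a u = if w = a then β else 0) :
    ∃ s t : ℂ, s ≠ 0 ∧ t ≠ 0 ∧
      IsFrobeniusKernel (fun z x y => s * k z x y) (fun x => t * e x) := by
  obtain ⟨o⟩ := ‹Nonempty X›
  have he : ∃ u, e u ≠ 0 := by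
    by_contra! h
    have := unit_left o o
    simp [h, hα.symm] at this
  -- The product of `e` with itself, computed by either unit law.
  have hβ : α = β := by
    obtain ⟨w, hw⟩ := he
    have h1 : ∑ a, e a * ∑ u, e u * k w u a = α * e w := by
      simp only [unit_left, mul_ite, mul_zero]
      simp [mul_comm]
    have h2 : ∑ a, e a * ∑ u, e u * k w a u = β * e w := by
      simp only [unit_right, mul_ite, mul_zero]
      simp [mul_comm]
    have h3 : ∑ a, e a * ∑ u, e u * k w u a = ∑ a, e a * ∑ u, e u * k w a u := by
      simp only [Finset.mul_sum]
      rw [Finset.sum_comm]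
      exact Finset.sum_congr rfl fun a _ => Finset.sum_congr rfl fun u _ => by ring
    rw [h1, h2] at h3
    exact mul_right_cancel₀ hw h3
  have hknz : ∀ z, ∃ x y, k z x y ≠ 0 := by
    intro z
    by_contra! h
    have := special z z
    simp [h, hσ.symm] at this
  -- Contracting the first argument of the associativity law with `e` turns both sides into `α`
  -- times the product. Some product coefficient is nonzero since `σ ≠ 0`.
  have hl : l = 1 := by
    obtain ⟨b, c, hbc⟩ := hknz o
    have h1 : ∑ a, e a * ∑ t, k t a b * k o t c = α * k o b c := by
      simp only [Finset.mul_sum]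
      rw [Finset.sum_comm]
      simp only [← mul_assoc, ← Finset.sum_mul, unit_left]
      simp
    have h2 : ∑ a, e a * (l * ∑ t, k t b c * k o a t) = l * (α * k o b c) := by
      have : ∀ a, e a * (l * ∑ t, k t b c * k o a t) =
          ∑ t, l * k t b c * (e a * k o a t) := by
        intro a
        rw [Finset.mul_sum, Finset.mul_sum]
        exact Finset.sum_congr rfl fun t _ => by ring
      simp only [this]
      rw [Finset.sum_comm]
      simp only [← Finset.mul_sum, unit_left]
      simp
      ring
    simp only [assoc] at h1
    rw [h2] at h1
    exact mul_right_cancel₀ (mul_ne_zero hα hbc) (h1.trans (one_mul _).symm)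
  -- The comultiplication of the unit is nonzero: multiplying it back together gives `σ e`.
  have hez : ∃ p q, ∑ z, e z * star (k z p q) ≠ 0 := by
    by_contra! h
    obtain ⟨w, hw⟩ := he
    have h1 : ∑ x, ∑ y, k w x y * ∑ z, e z * star (k z x y) = σ * e w := by
      have : ∀ x, ∑ y, k w x y * ∑ z, e z * star (k z x y) =
          ∑ z, e z * ∑ y, k w x y * star (k z x y) := by
        intro x
        simp only [Finset.mul_sum]
        rw [Finset.sum_comm]
        exact Finset.sum_congr rfl fun a _ => Finset.sum_congr rfl fun u _ => by ring
      simp only [this]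
      rw [Finset.sum_comm]
      simp only [← Finset.mul_sum, special]
      simp [mul_comm]
    simp only [h, mul_zero, Finset.sum_const_zero] at h1
    exact mul_ne_zero hσ hw h1.symm
  have hR : ∀ p q, ∑ a, ∑ b, e a * e b * ∑ z, k z a b * star (k z p q) =
      α * ∑ z, e z * star (k z p q) := by
    intro p q
    have : ∀ a, ∑ b, e a * e b * ∑ z, k z a b * star (k z p q) =
        ∑ z, e a * star (k z p q) * ∑ b, e b * k z a b := by
      intro a
      simp only [Finset.mul_sum]
      rw [Finset.sum_comm]
      exact Finset.sum_congr rfl fun z _ => Finset.sum_congr rfl fun b _ => by ring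
    simp only [this, unit_right, ← hβ, mul_ite, mul_zero]
    simp [Finset.mul_sum, mul_comm]
  -- Contracting both arguments with `e` turns either side of the Frobenius law into `α` times the
  -- comultiplication of the unit.
  have hμ : μ = 1 := by
    obtain ⟨p, q, hpq⟩ := hez
    have h1 : ∑ a, ∑ b, e a * e b * ∑ c, star (k a p c) * k q c b =
        α * ∑ z, e z * star (k z p q) := by
      have : ∀ a, ∑ b, e a * e b * ∑ c, star (k a p c) * k q c b =
          ∑ c, e a * star (k a p c) * ∑ b, e b * k q c b := by
        intro a
        simp only [Finset.mul_sum]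
        rw [Finset.sum_comm]
        exact Finset.sum_congr rfl fun z _ => Finset.sum_congr rfl fun b _ => by ring
      simp only [this, unit_right, ← hβ, mul_ite, mul_zero]
      simp [Finset.mul_sum, mul_comm]
    have h2 : ∑ a, ∑ b, e a * e b * (μ * ∑ z, k z a b * star (k z p q)) =
        μ * (α * ∑ z, e z * star (k z p q)) := by
      rw [← hR, Finset.mul_sum]
      refine Finset.sum_congr rfl fun a _ => ?_
      rw [Finset.mul_sum]
      exact Finset.sum_congr rfl fun b _ => by ring
    simp only [frob_left] at h1
    rw [h2] at h1
    exact mul_right_cancel₀ (mul_ne_zero hα hpq) (h1.trans (one_mul _).symm)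
  have hν : ν = 1 := by
    obtain ⟨p, q, hpq⟩ := hez
    have h1 : ∑ a, ∑ b, e a * e b * ∑ c, star (k b c q) * k p a c =
        α * ∑ z, e z * star (k z p q) := by
      have : ∀ b, ∑ a, e a * e b * ∑ c, star (k b c q) * k p a c =
          ∑ c, e b * star (k b c q) * ∑ a, e a * k p a c := by
        intro a
        simp only [Finset.mul_sum]
        rw [Finset.sum_comm]
        exact Finset.sum_congr rfl fun z _ => Finset.sum_congr rfl fun b _ => by ring
      rw [Finset.sum_comm]
      simp only [this, unit_left, mul_ite, mul_zero]
      simp [Finset.mul_sum, mul_comm]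
    have h2 : ∑ a, ∑ b, e a * e b * (ν * ∑ z, k z a b * star (k z p q)) =
        ν * (α * ∑ z, e z * star (k z p q)) := by
      rw [← hR, Finset.mul_sum]
      refine Finset.sum_congr rfl fun a _ => ?_
      rw [Finset.mul_sum]
      exact Finset.sum_congr rfl fun b _ => by ring
    simp only [frob_right] at h1
    rw [h2] at h1
    exact mul_right_cancel₀ (mul_ne_zero hα hpq) (h1.trans (one_mul _).symm)
  -- `σ` is a sum of squared moduli, hence positive, so a real square root is available to normalize
  -- specialness.
  obtain ⟨r, hr, hrσ⟩ : ∃ r : ℝ, 0 < r ∧ σ = r := by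
    have h0 : σ = ((∑ x, ∑ y, ‖k o x y‖ ^ 2 : ℝ) : ℂ) := by
      have := special o o
      simp only [if_true] at this
      rw [← this]
      push_cast
      exact Finset.sum_congr rfl fun x _ => Finset.sum_congr rfl fun y _ => Complex.mul_conj' _
    refine ⟨_, lt_of_le_of_ne (by positivity) fun h => hσ ?_, h0⟩
    rw [h0, ← h, Complex.ofReal_zero]
  obtain ⟨s, hs0, hstar, hsσ⟩ : ∃ s : ℂ, s ≠ 0 ∧ star s = s ∧ s * s * σ = 1 := by
    have h0 : (Real.sqrt r : ℂ) ≠ 0 := Complex.ofReal_ne_zero.2 (Real.sqrt_pos.2 hr).ne'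
    have h1 : (Real.sqrt r : ℂ) * Real.sqrt r = r := by
      rw [← Complex.ofReal_mul, Real.mul_self_sqrt hr.le]
    refine ⟨(Real.sqrt r : ℂ)⁻¹, inv_ne_zero h0, by simp [Complex.conj_ofReal], ?_⟩
    rw [hrσ, ← h1, ← mul_inv, inv_mul_cancel₀ (mul_ne_zero h0 h0)]
  -- Specialness is quadratic in the multiplication, so `s` is the inverse square root of `σ`; the
  -- unit must then cancel the factor `s * α` in the unit laws.
  refine ⟨s, (s * α)⁻¹, hs0, inv_ne_zero (mul_ne_zero hs0 hα), ?_⟩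
  have pull : ∀ {c : ℂ} (F G : X → ℂ), (∀ x, F x = c * G x) → ∑ x, F x = c * ∑ x, G x := by
    intro c F G h
    rw [Finset.mul_sum]
    exact Finset.sum_congr rfl fun x _ => h x
  refine ⟨fun a b p q => ?_, fun a b p q => ?_, fun z z' => ?_, fun a b c w => ?_,
    fun a w => ?_, fun a w => ?_⟩
  · have h := frob_left a b p q
    rw [hμ, one_mul] at h
    rw [pull _ (fun c => star (k a p c) * k q c b) (c := s * s)
      (fun c => by rw [star_mul', hstar]; ring), h]
    exact (pull _ _ fun c => by rw [star_mul', hstar]; ring).symm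
  · have h := frob_right a b p q
    rw [hν, one_mul] at h
    rw [pull _ (fun c => star (k b c q) * k p a c) (c := s * s)
      (fun c => by rw [star_mul', hstar]; ring), h]
    exact (pull _ _ fun c => by rw [star_mul', hstar]; ring).symm
  · rw [pull (c := s * s) _ (fun x => ∑ y, k z x y * star (k z' x y)) (fun x => pull _ _
      fun y => by rw [star_mul', hstar]; ring), special, mul_ite, mul_zero, hsσ]
  · have h := assoc a b c w
    rw [hl, one_mul] at h
    rw [pull _ (fun t => k t a b * k w t c) (c := s * s) (fun t => by ring), h]
    exact (pull _ _ fun t => by ring).symm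
  · rw [pull (c := (s * α)⁻¹ * s) _ (fun u => e u * k w u a) (fun t => by ring), unit_left,
      mul_ite, mul_zero]
    congr 1
    field_simp
  · rw [pull (c := (s * α)⁻¹ * s) _ (fun u => e u * k w a u) (fun t => by ring), unit_right,
      ← hβ, mul_ite, mul_zero]
    congr 1
    field_simp

end HilbertFrobenius


/-! ### Quantization of the toy Frobenius algebras -/

noncomputable section ToyQuantization
variable (d : ℕ) [Fact d.Prime]

theorem exists_sum_arrow {α β γ : Type} {P : (α ⊕ β → γ) → Prop} :
    (∃ z, P z) ↔ ∃ x y, P (Sum.elim x y) :=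
  ⟨fun ⟨z, hz⟩ => ⟨z ∘ Sum.inl, z ∘ Sum.inr, by rwa [Sum.elim_comp_inl_inr]⟩,
    fun ⟨x, y, h⟩ => ⟨_, h⟩⟩

section Relations
variable {ι : Type} {m : SetRel (Ph d ι × Ph d ι) (Ph d ι)} {e : SetRel Unit (Ph d ι)}

omit [Fact d.Prime] in
-- Here and in the following lemmas the axioms are rewritten with tensor products and relabelings of
-- systems, the form to which the calculus of `Represents` applies.
theorem joinRel_assoc (h : IsRelFrobenius m e) :
    (tensorRel d (joinRel d m) SetRel.id).comp (joinRel d m) =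
      (relabelRel d (Equiv.sumAssoc ι ι ι)).comp
        ((tensorRel d SetRel.id (joinRel d m)).comp (joinRel d m)) := by
  rw [relabelRel_comp]
  ext ⟨x, w⟩
  have := h.assoc_iff (x ∘ Sum.inl ∘ Sum.inl) (x ∘ Sum.inl ∘ Sum.inr) (x ∘ Sum.inr) w
  simp only [SetRel.mem_comp, tensorRel, joinRel, Set.mem_ofPred_eq, SetRel.mem_id,
    exists_sum_arrow, Sum.elim_comp_inl, Sum.elim_comp_inr]
  refine Iff.trans ?_ (this.symm.trans ?_)
  · constructor
    · rintro ⟨t, _, ⟨h1, rfl⟩, h2⟩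
      exact ⟨t, h1, h2⟩
    · rintro ⟨t, h1, h2⟩
      exact ⟨t, _, ⟨h1, rfl⟩, h2⟩
  · constructor
    · rintro ⟨t, h1, h2⟩
      exact ⟨_, t, ⟨rfl, h1⟩, h2⟩
    · rintro ⟨_, t, ⟨rfl, h1⟩, h2⟩
      exact ⟨t, h1, h2⟩

omit [Fact d.Prime] in
theorem joinRel_unit_left (h : IsRelFrobenius m e) :
    (relabelRel d (Equiv.emptySum Empty ι).symm).comp
      ((tensorRel d (stateRel d e) SetRel.id).comp (joinRel d m)) = SetRel.id := by
  rw [relabelRel_comp]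
  ext ⟨x, w⟩
  have := h.left_iff x w
  simp only [SetRel.mem_comp, tensorRel, joinRel, stateRel, Set.mem_ofPred_eq, SetRel.mem_id,
    exists_sum_arrow, Sum.elim_comp_inl, Sum.elim_comp_inr]
  refine Iff.trans ?_ this
  constructor
  · rintro ⟨u, _, ⟨h1, rfl⟩, h2⟩
    exact ⟨u, h1, h2⟩
  · rintro ⟨u, h1, h2⟩
    exact ⟨u, x, ⟨h1, rfl⟩, h2⟩

omit [Fact d.Prime] in
theorem joinRel_unit_right (h : IsRelFrobenius m e) :
    (relabelRel d (Equiv.sumEmpty ι Empty).symm).comp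
      ((tensorRel d SetRel.id (stateRel d e)).comp (joinRel d m)) = SetRel.id := by
  rw [relabelRel_comp]
  ext ⟨x, w⟩
  have := h.right_iff x w
  simp only [SetRel.mem_comp, tensorRel, joinRel, stateRel, Set.mem_ofPred_eq, SetRel.mem_id,
    exists_sum_arrow, Sum.elim_comp_inl, Sum.elim_comp_inr]
  refine Iff.trans ?_ this
  constructor
  · rintro ⟨_, u, ⟨rfl, h1⟩, h2⟩
    exact ⟨u, h1, h2⟩
  · rintro ⟨u, h1, h2⟩
    exact ⟨x, u, ⟨rfl, h1⟩, h2⟩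

omit [Fact d.Prime] in
theorem joinRel_special (h : IsRelFrobenius m e) :
    (joinRel d m).inv.comp (joinRel d m) = SetRel.id := by
  rw [← h.special]
  ext ⟨x, w⟩
  simp only [SetRel.mem_comp, SetRel.mem_inv, joinRel, Set.mem_ofPred_eq, exists_sum_arrow,
    Sum.elim_comp_inl, Sum.elim_comp_inr, Prod.exists]

omit [Fact d.Prime] in
theorem joinRel_frob_left (h : IsRelFrobenius m e) :
    ((tensorRel d (joinRel d m).inv SetRel.id).comp (relabelRel d (Equiv.sumAssoc ι ι ι))).comp
      (tensorRel d SetRel.id (joinRel d m)) = (joinRel d m).comp (joinRel d m).inv := by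
  rw [comp_relabelRel]
  ext ⟨x, w⟩
  have := h.frob_iff (x ∘ Sum.inl) (x ∘ Sum.inr) (w ∘ Sum.inl) (w ∘ Sum.inr)
  simp only [SetRel.mem_comp, SetRel.mem_inv, tensorRel, joinRel, Set.mem_ofPred_eq,
    SetRel.mem_id, exists_sum_arrow, Sum.elim_comp_inl, Sum.elim_comp_inr]
  refine Iff.trans ?_ this
  constructor
  · rintro ⟨_, c, b, ⟨h1, h2⟩, rfl, h3⟩
    have h2 : x ∘ Sum.inr = b := h2
    subst h2
    exact ⟨c, h1, h3⟩
  · rintro ⟨c, h1, h2⟩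
    exact ⟨_, c, _, ⟨h1, rfl⟩, rfl, h2⟩

omit [Fact d.Prime] in
theorem joinRel_frob_right (h : IsRelFrobenius m e) :
    ((tensorRel d SetRel.id (joinRel d m).inv).comp
      (relabelRel d (Equiv.sumAssoc ι ι ι).symm)).comp
      (tensorRel d (joinRel d m) SetRel.id) = (joinRel d m).comp (joinRel d m).inv := by
  have key : ∀ a b p q, (∃ c, ((c, q), b) ∈ m ∧ ((a, c), p) ∈ m) ↔
      ∃ z, ((a, b), z) ∈ m ∧ ((p, q), z) ∈ m := by
    intro a b p q
    have := Set.ext_iff.1 h.frob_right ((a, b), (p, q))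
    simpa [prodRel, graphRel, SetRel.comp, SetRel.inv, SetRel.id] using this
  rw [comp_relabelRel]
  ext ⟨x, w⟩
  have := key (x ∘ Sum.inl) (x ∘ Sum.inr) (w ∘ Sum.inl) (w ∘ Sum.inr)
  simp only [SetRel.mem_comp, SetRel.mem_inv, tensorRel, joinRel, Set.mem_ofPred_eq,
    SetRel.mem_id, exists_sum_arrow, Sum.elim_comp_inl, Sum.elim_comp_inr]
  refine Iff.trans ?_ this
  constructor
  · rintro ⟨a, c, q, ⟨h1, h2⟩, h3, rfl⟩
    have h1 : x ∘ Sum.inl = a := h1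
    subst h1
    exact ⟨c, h2, h3⟩
  · rintro ⟨c, h1, h2⟩
    exact ⟨x ∘ Sum.inl, c, _, ⟨rfl, h1⟩, h2, rfl⟩

end Relations

section Kernels
variable {ι κ l ι' κ' : Type} [Fintype ι] [DecidableEq ι] [Fintype κ] [DecidableEq κ]
  [Fintype κ'] [DecidableEq κ']

theorem mul_relabelMatrix_apply (M : Matrix (Conf d l) (Conf d κ) ℂ)
    (f : ι ≃ κ) (y : Conf d l) (x : Conf d ι) :
    (M * relabelMatrix d f) y x = M y (x ∘ f.symm) := by
  have : ∀ t : Conf d κ, t ∘ f = x ↔ t = x ∘ f.symm := fun t =>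
    ⟨fun h => by rw [← h]; ext; simp, fun h => by rw [h]; ext; simp⟩
  simp [Matrix.mul_apply, relabelMatrix, this]

omit [Fintype ι] [DecidableEq ι] in
theorem mul_kron_apply (M : Matrix (Conf d l) (Conf d (κ ⊕ κ')) ℂ)
    (A : Matrix (Conf d κ) (Conf d ι) ℂ) (B : Matrix (Conf d κ') (Conf d ι') ℂ) (y : Conf d l)
    (x : Conf d (ι ⊕ ι')) : (M * kron d A B) y x =
      ∑ s, ∑ t, M y (Sum.elim s t) * (A s (x ∘ Sum.inl) * B t (x ∘ Sum.inr)) := by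
  rw [Matrix.mul_apply, sum_sum_arrow]
  rfl

omit [Fact d.Prime] [Fintype ι] [DecidableEq ι] in
theorem sum_mul_one_apply {α : Type} [Fintype α] [DecidableEq α] (F : α → ℂ) (b : α) :
    ∑ t, F t * (1 : Matrix α α ℂ) t b = F b := by
  simp [Matrix.one_apply]

omit [Fact d.Prime] [Fintype ι] [DecidableEq ι] in
theorem sum_one_apply_mul {α : Type} [Fintype α] [DecidableEq α] (F : α → ℂ) (b : α) :
    ∑ t, (1 : Matrix α α ℂ) b t * F t = F b := by
  simp [Matrix.one_apply]

/-- The multiplication and unit of a Frobenius algebra in `Rel` are represented by operators which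
satisfy the equations of a special dagger Frobenius algebra, after normalization. -/
theorem exists_isFrobeniusKernel (hd : d ≠ 2) {m : SetRel (Ph d ι × Ph d ι) (Ph d ι)}
    {e : SetRel Unit (Ph d ι)} (h : IsRelFrobenius m e) (hm : IsAffineRel (joinRel d m))
    (he : IsAffineRel (stateRel d e)) {K : Matrix (Conf d ι) (Conf d (ι ⊕ ι)) ℂ}
    {E : Matrix (Conf d ι) (Conf d Empty) ℂ} (hK : Represents d (joinRel d m) K)
    (hE : Represents d (stateRel d e) E) : ∃ s t : ℂ, s ≠ 0 ∧ t ≠ 0 ∧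
      IsFrobeniusKernel (fun z x y => s * K z (Sum.elim x y)) (fun x => t * E x default) := by
  have hid : IsAffineRel (SetRel.id : SetRel (Ph d ι) (Ph d ι)) := (Spek.id d ι).isAffineRel
  have hrel : ∀ {α β : Type} [Finite α] (f : α ≃ β), IsAffineRel (relabelRel d f) :=
    fun f => (Spek.relabel f).isAffineRel
  have I : Represents d (SetRel.id : SetRel (Ph d ι) (Ph d ι)) 1 := Represents.id d
  have hm' := isAffineRel_inv hm
  have hK' := hK.inv d hd
  -- Both sides of each axiom are the same relation, so the two operators that represent it are
  -- proportional by uniqueness. Only the scalars remain unknown.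
  obtain ⟨l, -, hassoc⟩ := Represents.unique d hd
    ((Represents.relabel d (Equiv.sumAssoc ι ι ι)).comp d (hrel _)
      (isAffineRel_comp (isAffineRel_tensorRel d hid hm) hm)
      ((I.tensor d hK).comp d (isAffineRel_tensorRel d hid hm) hm hK))
    (joinRel_assoc d h ▸ (hK.tensor d I).comp d (isAffineRel_tensorRel d hm hid) hm hK)
  obtain ⟨α, hα, hleft⟩ := Represents.unique d hd I (joinRel_unit_left d h ▸
    (Represents.relabel d (Equiv.emptySum Empty ι).symm).comp d (hrel _)
      (isAffineRel_comp (isAffineRel_tensorRel d he hid) hm)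
      ((hE.tensor d I).comp d (isAffineRel_tensorRel d he hid) hm hK))
  obtain ⟨β, -, hright⟩ := Represents.unique d hd I (joinRel_unit_right d h ▸
    (Represents.relabel d (Equiv.sumEmpty ι Empty).symm).comp d (hrel _)
      (isAffineRel_comp (isAffineRel_tensorRel d hid he) hm)
      ((I.tensor d hE).comp d (isAffineRel_tensorRel d hid he) hm hK))
  obtain ⟨σ, hσ, hspecial⟩ := Represents.unique d hd I
    (joinRel_special d h ▸ hK'.comp d hm' hm hK)
  obtain ⟨μ, -, hfl⟩ := Represents.unique d hd (hK.comp d hm hm' hK')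
    (joinRel_frob_left d h ▸ ((hK'.tensor d I).comp d (isAffineRel_tensorRel d hm' hid) (hrel _)
      (Represents.relabel d _)).comp d
      (isAffineRel_comp (isAffineRel_tensorRel d hm' hid) (hrel _))
      (isAffineRel_tensorRel d hid hm) (I.tensor d hK))
  obtain ⟨ν, -, hfr⟩ := Represents.unique d hd (hK.comp d hm hm' hK')
    (joinRel_frob_right d h ▸ ((I.tensor d hK').comp d (isAffineRel_tensorRel d hid hm') (hrel _)
      (Represents.relabel d _)).comp d
      (isAffineRel_comp (isAffineRel_tensorRel d hid hm') (hrel _))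
      (isAffineRel_tensorRel d hm hid) (hK.tensor d I))
  refine exists_isFrobeniusKernel_smul hα hσ (β := β) (l := l) (μ := μ) (ν := ν)
    (fun a b p q => ?_) (fun a b p q => ?_) (fun z z' => ?_) (fun a b c w => ?_)
    (fun a w => ?_) (fun a w => ?_)
  -- The axioms are read off at matrix entries; each identity tensor factor is a Kronecker delta
  -- that removes a summation.
  · have := congrFun (congrFun hfl (Sum.elim p q)) (Sum.elim a b)
    rw [← Matrix.mul_assoc, mul_kron_apply, sum_sum_arrow, Matrix.smul_apply,
      Matrix.mul_apply] at this
    have hs : ∀ s₁ s₂ t : Conf d ι, kron d 1 K (Sum.elim p q)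
        (Sum.elim (Sum.elim s₁ s₂) t ∘ (Equiv.sumAssoc ι ι ι).symm) =
          (1 : Matrix (Conf d ι) (Conf d ι) ℂ) p s₁ * K q (Sum.elim s₂ t) := by
      intro s₁ s₂ t
      have : (Sum.elim (Sum.elim s₁ s₂) t ∘ (Equiv.sumAssoc ι ι ι).symm) ∘ Sum.inr =
          Sum.elim s₂ t := by ext i; rcases i with i | i <;> rfl
      rw [kron, this]
      rfl
    simp only [mul_relabelMatrix_apply, hs, Sum.elim_comp_inl, Sum.elim_comp_inr,
      Matrix.conjTranspose_apply, smul_eq_mul, ← mul_assoc, sum_mul_one_apply] at this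
    rw [Finset.sum_comm] at this
    refine Eq.trans ?_ (this.trans (congrArg _ (Finset.sum_congr rfl fun z _ => mul_comm _ _)))
    refine Finset.sum_congr rfl fun c _ => ?_
    simp only [mul_assoc, sum_one_apply_mul]
    exact mul_comm _ _
  · have := congrFun (congrFun hfr (Sum.elim p q)) (Sum.elim a b)
    rw [← Matrix.mul_assoc, mul_kron_apply, Matrix.smul_apply, Matrix.mul_apply] at this
    have hs : ∀ s t₁ t₂ : Conf d ι, kron d K 1 (Sum.elim p q)
        (Sum.elim s (Sum.elim t₁ t₂) ∘ (Equiv.sumAssoc ι ι ι).symm.symm) =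
          K p (Sum.elim s t₁) * (1 : Matrix (Conf d ι) (Conf d ι) ℂ) q t₂ := by
      intro s t₁ t₂
      have : (Sum.elim s (Sum.elim t₁ t₂) ∘ (Equiv.sumAssoc ι ι ι).symm.symm) ∘ Sum.inl =
          Sum.elim s t₁ := by ext i; rcases i with i | i <;> rfl
      rw [kron, this]
      rfl
    simp only [sum_sum_arrow, mul_relabelMatrix_apply, hs, Sum.elim_comp_inr,
      Matrix.conjTranspose_apply, smul_eq_mul] at this
    refine Eq.trans ?_ (this.trans (congrArg _ (Finset.sum_congr rfl fun z _ => mul_comm _ _)))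
    have h1 : ∀ t, (1 : Matrix (Conf d ι) (Conf d ι) ℂ) t (Sum.elim a b ∘ Sum.inl) =
        (1 : Matrix (Conf d ι) (Conf d ι) ℂ) t a := fun _ => rfl
    simp only [h1]
    symm
    rw [Finset.sum_eq_single_of_mem a (Finset.mem_univ a)]
    · refine Finset.sum_congr rfl fun c _ => ?_
      rw [Finset.sum_eq_single_of_mem q (Finset.mem_univ q)]
      · rw [Matrix.one_apply_eq, Matrix.one_apply_eq, mul_one, one_mul, mul_comm]
      · intro t _ ht
        rw [Matrix.one_apply_ne ht.symm, mul_zero, zero_mul]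
    · intro t _ ht
      refine Finset.sum_eq_zero fun x _ => Finset.sum_eq_zero fun y _ => ?_
      rw [Matrix.one_apply_ne ht, zero_mul, mul_zero]
  · have := congrFun (congrFun hspecial z) z'
    rw [Matrix.mul_apply, sum_sum_arrow, Matrix.smul_apply, Matrix.one_apply] at this
    simpa using this
  · have := congrFun (congrFun hassoc w) (Sum.elim (Sum.elim a b) c)
    have hr : (Sum.elim (Sum.elim a b) c ∘ (Equiv.sumAssoc ι ι ι).symm) ∘ Sum.inr =
        Sum.elim b c := by ext i; rcases i with i | i <;> rfl
    have hl : (Sum.elim (Sum.elim a b) c ∘ (Equiv.sumAssoc ι ι ι).symm) ∘ Sum.inl = a := rfl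
    rw [mul_kron_apply, Matrix.smul_apply, mul_relabelMatrix_apply, mul_kron_apply, hl, hr] at this
    simp only [Sum.elim_comp_inl, Sum.elim_comp_inr, ← mul_assoc, sum_mul_one_apply,
      smul_eq_mul] at this
    rw [Finset.sum_comm] at this
    simp only [mul_right_comm _ ((1 : Matrix _ _ ℂ) _ a), sum_mul_one_apply] at this
    simpa only [mul_comm] using this
  · have := congrFun (congrFun hleft w) a
    have hl : ∀ x : Conf d Empty, x = default := fun x => Subsingleton.elim _ _
    have hr : (a ∘ (Equiv.emptySum Empty ι).symm.symm) ∘ Sum.inr = a := rfl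
    rw [mul_relabelMatrix_apply, mul_kron_apply, Matrix.smul_apply, Matrix.one_apply, hr] at this
    simp only [Matrix.one_apply, hl ((a ∘ _) ∘ Sum.inl)] at this
    simpa [mul_comm] using this
  · have := congrFun (congrFun hright w) a
    have hl : ∀ x : Conf d Empty, x = default := fun x => Subsingleton.elim _ _
    have hr : (a ∘ (Equiv.sumEmpty ι Empty).symm.symm) ∘ Sum.inl = a := rfl
    rw [mul_relabelMatrix_apply, mul_kron_apply, Matrix.smul_apply, Matrix.one_apply, hr] at this
    simp only [Matrix.one_apply, hl ((a ∘ _) ∘ Sum.inr)] at this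
    simpa [mul_comm] using this

end Kernels

/-- A factor `s` contributes `|s|²` to the superoperator, which the positive constant absorbs. Hence
the normalization of the Frobenius algebra is harmless. -/
theorem Represents.smul {ι κ : Type} [Fintype ι] [DecidableEq ι] [Fintype κ] [DecidableEq κ]
    {r : SetRel (Ph d ι) (Ph d κ)} {K : Matrix (Conf d κ) (Conf d ι) ℂ} (h : Represents d r K)
    {s : ℂ} (hs : s ≠ 0) : Represents d r (s • K) := by
  obtain ⟨c, hc, h⟩ := h
  have hn : 0 < ‖s‖ := norm_pos_iff.2 hs
  have hss : s * star s = ((‖s‖ ^ 2 : ℝ) : ℂ) := by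
    rw [Complex.ofReal_pow]
    exact Complex.mul_conj' s
  have h0 : ((‖s‖ ^ 2 : ℝ) : ℂ) ≠ 0 := Complex.ofReal_ne_zero.2 (by positivity)
  refine ⟨c / ‖s‖ ^ 2, by positivity, fun f => ?_⟩
  rw [h, Matrix.conjTranspose_smul, Matrix.smul_mul, Matrix.smul_mul, Matrix.mul_smul, smul_smul,
    smul_smul]
  congr 1
  rw [mul_assoc, hss, Complex.ofReal_div, div_mul_cancel₀ _ h0]

theorem EpiFrob.exists_isHilbFrobenius (hd : d ≠ 2) (A : EpiFrob d) :
    ∃ (mul : EuclideanSpace ℂ (Conf d (Fin A.n)) ⊗[ℂ] EuclideanSpace ℂ (Conf d (Fin A.n)) →ₗ[ℂ]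
        EuclideanSpace ℂ (Conf d (Fin A.n))) (unit : EuclideanSpace ℂ (Conf d (Fin A.n))),
      IsHilbFrobenius mul unit ∧ Stab d (mulMatrix d mul) ∧ Stab d (vecMatrix d unit) ∧
      Represents d (joinRel d A.mul) (mulMatrix d mul) ∧
      Represents d (stateRel d A.unit) (vecMatrix d unit) := by
  obtain ⟨K, hKs, hK⟩ := A.mul_spek.exists_stab d hd
  obtain ⟨E, hEs, hE⟩ := A.unit_spek.exists_stab d hd
  obtain ⟨s, t, hs, ht, hk⟩ := exists_isFrobeniusKernel d hd A.isFrob (A.mul_spek.isAffineRel)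
    (A.unit_spek.isAffineRel) hK hE
  -- The computational basis is orthonormal, so the normalized matrix entries serve directly as
  -- structure constants.
  let b := EuclideanSpace.basisFun (Conf d (Fin A.n)) ℂ
  obtain ⟨mul, hmul⟩ := exists_mul_of_kernel b fun z x y => s * K z (Sum.elim x y)
  have hm : mulMatrix d mul = s • K := by
    ext z x
    have := congrArg (fun v : EuclideanSpace ℂ _ => v z) (hmul (x ∘ Sum.inl) (x ∘ Sum.inr))
    simp only [b, EuclideanSpace.basisFun_apply, Sum.elim_comp_inl_inr] at this
    rw [mulMatrix, this]
    simp [Pi.single_apply]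
  have hu : vecMatrix d (WithLp.toLp 2 fun x => t * E x default) = t • E := by
    ext z x
    rw [Subsingleton.elim x default]
    rfl
  refine ⟨mul, WithLp.toLp 2 fun x => t * E x default,
    hk.isHilbFrobenius b hmul ?_, ?_, ?_, ?_, ?_⟩
  · ext z
    simp [b, Pi.single_apply]
  · rw [hm]
    exact Stab.smul s hKs
  · rw [hu]
    exact Stab.smul t hEs
  · rw [hm]
    exact hK.smul d hs
  · rw [hu]
    exact hE.smul d ht

end ToyQuantization

/-! ### The polarized convolution algebra and the quantization functor -/

noncomputable section PolarizedAlgebra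
variable (d : ℕ) [Fact d.Prime]
variable {ι : Type} [Fintype ι] [DecidableEq ι]

theorem polRep_bijective (hd : d ≠ 2) : Function.Bijective (polRep d (ι := ι)) := by
  have h : Function.Bijective (symbol d (ι := ι)) :=
    Function.bijective_iff_has_inverse.2 ⟨quantize d, quantize_symbol d, symbol_quantize d⟩
  exact (weylLin_bijective d hd).comp h

theorem polMul_apply (a b : polarized d ι) (p : Ph d ι × Ph d ι) :
    (polMul d ι (a ⊗ₜ[ℂ] b)).1 p = ∑ y, a.1 (p.1, y) * b.1 (y, p.2) := by
  simp [polMul]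

omit [DecidableEq ι] in
-- Parallel transport by `y` from the arrow `(x - y, 0)`: a polarized function is determined by the
-- arrows with source `0`.
theorem polarized_apply (a : polarized d ι) (x y : Ph d ι) :
    a.1 (x, y) = chi d (2⁻¹ * symp d ι y (x - y)) * a.1 (x - y, 0) := by
  have := a.2 (x - y) 0 y
  rwa [sub_add_cancel, zero_add, sub_zero] at this

/-- With `x = u + y`, transporting the arrow `(u + y, y)` to `(u, 0)` costs the phase `χ(½ ω(y,
u))`, which is the cocycle in `W(u) W(y)`. -/
theorem polRep_polMul (hd : d ≠ 2) (a b : polarized d ι) :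
    polRep d (polMul d ι (a ⊗ₜ[ℂ] b)) = polRep d a * polRep d b := by
  simp only [polRep_eq_sum, polMul_apply, Finset.sum_mul, Finset.mul_sum, Finset.sum_smul,
    Matrix.smul_mul, Matrix.mul_smul, displacement_mul d hd, smul_smul]
  rw [Finset.sum_comm]
  refine Finset.sum_congr rfl fun y _ => ?_
  rw [← Equiv.sum_comp (Equiv.addRight y)]
  refine Finset.sum_congr rfl fun u _ => ?_
  simp only [Equiv.coe_addRight]
  rw [polarized_apply d a, add_sub_cancel_right]
  congr 1
  ring

theorem polRep_polUnit : polRep d (polUnit d ι) = 1 := by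
  rw [polRep_eq_sum, Finset.sum_eq_single_of_mem 0 (Finset.mem_univ _)]
  · simp [polUnit, displacement_zero]
  · intro u _ hu
    simp [polUnit, hu]

/-- The transport phases are unimodular, so the arrows with any given source contribute as much as
those with source `0`. -/
theorem inner_polarized (a b : polarized d ι) : inner ℂ a b =
    (Fintype.card (Ph d ι) : ℂ) * ∑ u, star (a.1 (u, 0)) * b.1 (u, 0) := by
  rw [Submodule.coe_inner, PiLp.inner_apply, Fintype.sum_prod_type_right]
  have key : ∀ y : Ph d ι, ∑ x, inner ℂ (a.1 (x, y)) (b.1 (x, y)) =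
      ∑ u, star (a.1 (u, 0)) * b.1 (u, 0) := by
    intro y
    rw [← Equiv.sum_comp (Equiv.addRight y)]
    refine Finset.sum_congr rfl fun u _ => ?_
    rw [Equiv.coe_addRight, polarized_apply d a, polarized_apply d b, add_sub_cancel_right,
      RCLike.inner_apply, map_mul]
    have := chi_mul_chi_neg d (2⁻¹ * symp d ι y u)
    rw [← star_chi] at this
    calc _ = (chi d (2⁻¹ * symp d ι y u) * star (chi d (2⁻¹ * symp d ι y u))) *
          (star (a.1 (u, 0)) * b.1 (u, 0)) := by
          simp only [starRingEnd_apply]; ring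
      _ = _ := by rw [this, one_mul]
  simp only [key, Finset.sum_const, Finset.card_univ, nsmul_eq_mul]

theorem trace_polRep (hd : d ≠ 2) (a b : polarized d ι) :
    ((polRep d a)ᴴ * polRep d b).trace =
      (Fintype.card (Conf d ι) : ℂ) * ∑ u, star (a.1 (u, 0)) * b.1 (u, 0) := by
  have key : ∀ u v : Ph d ι, (displacement d (-u) * displacement d v).trace =
      if u = v then (Fintype.card (Conf d ι) : ℂ) else 0 := by
    intro u v
    rw [displacement_mul d hd, Matrix.trace_smul, trace_displacement d hd, smul_eq_mul]
    have : -u + v = 0 ↔ u = v := by rw [neg_add_eq_zero]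
    simp only [this]
    split_ifs with h
    · rw [h, map_neg, symp_isAlt d v, neg_zero, mul_zero, chi_zero, one_mul]
    · rw [mul_zero]
  simp only [polRep_eq_sum, Matrix.conjTranspose_sum, Matrix.conjTranspose_smul,
    displacement_conjTranspose, Finset.sum_mul, Finset.mul_sum, Matrix.smul_mul, Matrix.mul_smul,
    Matrix.trace_sum, Matrix.trace_smul, key, smul_eq_mul, mul_ite, mul_zero, Finset.sum_ite_eq',
    Finset.mem_univ, if_true]
  exact Finset.sum_congr rfl fun u _ => by ring

theorem card_conf_fin (n : ℕ) : (Fintype.card (Conf d (Fin n)) : ℂ) = (d : ℂ) ^ n := by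
  simp [ZMod.card]

theorem polarized_isOperatorRep (hd : d ≠ 2) (n : ℕ) :
    IsOperatorRep d n (polMul d (Fin n)) (polUnit d (Fin n)) (polRep d) where
  bijective := polRep_bijective d hd
  map_mul := polRep_polMul d hd
  map_unit := polRep_polUnit d
  inner_eq a b := by
    rw [inner_polarized, trace_polRep d hd, card_phase, card_conf_fin, mul_assoc]

theorem quantize_character (u w : Ph d ι) :
    (quantize d (character d u)).1 (w, 0) = if w = u then 1 else 0 := by
  have : (quantize d (character d u)).1 (w, 0) =
      (Fintype.card (Ph d ι) : ℂ)⁻¹ * ∑ z, chi d (symp d ι (u - w) z) := by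
    simp only [quantize, LinearMap.coe_mk, AddHom.coe_mk, map_zero, LinearMap.zero_apply, mul_zero,
      chi_zero, one_mul, sub_zero, character]
    congr 1
    refine Finset.sum_congr rfl fun z _ => ?_
    rw [← chi_add, map_sub, LinearMap.sub_apply, symp_swap d z w, sub_eq_add_neg]
  rw [this, sum_chi_symp]
  simp only [sub_eq_zero, eq_comm (a := u)]
  split_ifs
  · exact inv_mul_cancel₀ (card_ne_zero _)
  · exact mul_zero _

theorem eq_sum_quantize_character (a : polarized d ι) :
    a = ∑ u, a.1 (u, 0) • quantize d (character d u) := by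
  have := congrArg (quantize d) (symbol_eq_sum d a)
  simpa only [quantize_symbol, map_sum, map_smul] using this

/-- The structure constants of a twisted group algebra form a Frobenius algebra. -/
theorem isFrobeniusKernel_of_cocycle {G : Type} [AddCommGroup G] [Fintype G] [DecidableEq G]
    {g : G → G → ℂ} {t : ℂ} (cocycle : ∀ a b c, g a b * g (a + b) c = g b c * g a (b + c))
    (left : ∀ p c b, star (g p c) * g c b = g (p + c) b * star (g p (c + b)))
    (right : ∀ a c q, star (g c q) * g a c = g a (c + q) * star (g (a + c) q))
    (norm : ∀ a b, g a b * star (g a b) = (Fintype.card G : ℂ)⁻¹)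
    (zero_left : ∀ a, t * g 0 a = 1) (zero_right : ∀ a, t * g a 0 = 1) :
    IsFrobeniusKernel (fun w u v => if w = u + v then g u v else 0)
      (fun u => if u = 0 then t else 0) where
  frob_left a b p q := by
    rw [Finset.sum_eq_single_of_mem (a - p) (Finset.mem_univ _),
      Finset.sum_eq_single_of_mem (a + b) (Finset.mem_univ _), if_pos (add_sub_cancel p a).symm,
      if_pos rfl]
    · by_cases h : q = a - p + b
      · have := left p (a - p) b
        rw [add_sub_cancel, ← h] at this
        rw [if_pos h, if_pos (by rw [h]; abel), this]
      · rw [if_neg h, if_neg fun h' => h (by rw [sub_add_eq_add_sub, h', add_sub_cancel_left]),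
          star_zero, mul_zero, mul_zero]
    · intro z _ hz
      rw [if_neg hz, zero_mul]
    · intro c _ hc
      rw [if_neg fun h => hc (by rw [h, add_sub_cancel_left]), star_zero, zero_mul]
  frob_right a b p q := by
    rw [Finset.sum_eq_single_of_mem (b - q) (Finset.mem_univ _),
      Finset.sum_eq_single_of_mem (a + b) (Finset.mem_univ _), if_pos (sub_add_cancel b q).symm,
      if_pos rfl]
    · by_cases h : p = a + (b - q)
      · have := right a (b - q) q
        rw [sub_add_cancel, ← h] at this
        rw [if_pos h, if_pos (by rw [h]; abel), this]
      · rw [if_neg h, if_neg fun h' => h (by rw [← add_sub_assoc, h', add_sub_cancel_right]),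
          star_zero, mul_zero, mul_zero]
    · intro z _ hz
      rw [if_neg hz, zero_mul]
    · intro c _ hc
      rw [if_neg fun h => hc (by rw [h, add_sub_cancel_right]), star_zero, zero_mul]
  special z z' := by
    -- For each `x` only `y = z - x` contributes, with weight the inverse of the order of `G`;
    -- summing over `x` gives `1`.
    have h : ∀ x, ∑ y, (if z = x + y then g x y else 0) * star (if z' = x + y then g x y else 0) =
        if z = z' then (Fintype.card G : ℂ)⁻¹ else 0 := by
      intro x
      rw [Finset.sum_eq_single_of_mem (z - x) (Finset.mem_univ _), add_sub_cancel, if_pos rfl]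
      · simp only [eq_comm (a := z')]
        split_ifs
        · exact norm _ _
        · rw [star_zero, mul_zero]
      · intro y _ hy
        rw [if_neg fun h => hy (by rw [h, add_sub_cancel_left]), zero_mul]
    simp only [h, Finset.sum_const, Finset.card_univ, nsmul_eq_mul, mul_ite, mul_zero]
    rw [mul_inv_cancel₀ (card_ne_zero G)]
  assoc a b c w := by
    rw [Finset.sum_eq_single_of_mem (a + b) (Finset.mem_univ _),
      Finset.sum_eq_single_of_mem (b + c) (Finset.mem_univ _), if_pos rfl, if_pos rfl, add_assoc]
    · split_ifs
      · exact cocycle a b c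
      · rw [mul_zero, mul_zero]
    · intro z _ hz
      rw [if_neg hz, zero_mul]
    · intro z _ hz
      rw [if_neg hz, zero_mul]
  unit_left a w := by
    rw [Finset.sum_eq_single_of_mem 0 (Finset.mem_univ _), if_pos rfl, zero_add, mul_ite,
      zero_left, mul_zero]
    intro u _ hu
    rw [if_neg hu, zero_mul]
  unit_right a w := by
    rw [Finset.sum_eq_single_of_mem 0 (Finset.mem_univ _), if_pos rfl, add_zero, mul_ite,
      zero_right, mul_zero]
    intro u _ hu
    rw [if_neg hu, zero_mul]

/-- The polarized functions which quantize the characters, normalized. -/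
theorem exists_polarized_basis : ∃ b : OrthonormalBasis (Ph d ι) ℂ (polarized d ι),
    ∀ u, b u = (Fintype.card (Conf d ι) : ℂ)⁻¹ • quantize d (character d u) := by
  have h0 := card_ne_zero (Conf d ι)
  have hv : ∀ u w : Ph d ι,
      ((Fintype.card (Conf d ι) : ℂ)⁻¹ • quantize d (character d u)).1 (w, 0) =
        if w = u then (Fintype.card (Conf d ι) : ℂ)⁻¹ else 0 := by
    intro u w
    have : ((Fintype.card (Conf d ι) : ℂ)⁻¹ • quantize d (character d u)).1 (w, 0) =
      (Fintype.card (Conf d ι) : ℂ)⁻¹ * (quantize d (character d u)).1 (w, 0) := rfl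
    rw [this, quantize_character, mul_ite, mul_one, mul_zero]
  refine ⟨OrthonormalBasis.mk
    (v := fun u => (Fintype.card (Conf d ι) : ℂ)⁻¹ • quantize d (character d u)) ?_ ?_, fun u => ?_⟩
  · rw [orthonormal_iff_ite]
    intro u v
    simp only [inner_polarized, hv]
    rw [Finset.sum_eq_single_of_mem u (Finset.mem_univ _), if_pos rfl]
    · split_ifs
      -- The inner product contributes the cardinality of phase space, the square of that of
      -- configuration space, which cancels the two normalizing factors.
      · rw [star_inv₀, star_natCast, card_phase]
        field_simp
      · simp
    · intro w _ hw
      rw [if_neg hw, star_zero, zero_mul]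
  · rintro a -
    rw [eq_sum_quantize_character d a]
    refine Submodule.sum_mem _ fun u _ => Submodule.smul_mem _ _ ?_
    have := Submodule.smul_mem _ (Fintype.card (Conf d ι) : ℂ) (Submodule.subset_span
      (R := ℂ) (Set.mem_range_self (f := fun u : Ph d ι =>
        (Fintype.card (Conf d ι) : ℂ)⁻¹ • quantize d (character d u)) u))
    rwa [smul_inv_smul₀ h0] at this
  · rw [OrthonormalBasis.coe_mk]

theorem polRep_quantize_character (u : Ph d ι) :
    polRep d (quantize d (character d u)) = displacement d u := by
  rw [polRep_apply, symbol_quantize, weylOp_character]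

/-- In the orthonormal basis the structure constants are `N⁻¹ χ(½ ω(v, u))`. Bilinearity of the
exponent gives the cocycle and Frobenius identities, and specialness holds because `N²` is the
number of points of phase space. -/
theorem polarized_isHilbFrobenius (hd : d ≠ 2) :
    IsHilbFrobenius (polMul d ι) (polUnit d ι) := by
  obtain ⟨b, hb⟩ := exists_polarized_basis d (ι := ι)
  have h0 := card_ne_zero (Conf d ι)
  set N : ℂ := (Fintype.card (Conf d ι) : ℂ) with hN
  have hstar : star N = N := star_natCast _
  have hrep : ∀ u, polRep d (b u) = N⁻¹ • displacement d u := fun u => by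
    rw [hb, map_smul, polRep_quantize_character]
  have hk : IsFrobeniusKernel (fun w u v : Ph d ι => if w = u + v then
      N⁻¹ * chi d (2⁻¹ * symp d ι v u) else 0) (fun u => if u = 0 then N else 0) := by
    have hphase : ∀ s t s' t' : ZMod d, s + t = s' + t' →
        chi d s * chi d t = chi d s' * chi d t' := fun s t s' t' h => by
      rw [← chi_add, ← chi_add, h]
    refine isFrobeniusKernel_of_cocycle (fun a b c => ?_) (fun p c b => ?_) (fun a c q => ?_)
      (fun a b => ?_) (fun a => ?_) (fun a => ?_)
    · rw [mul_mul_mul_comm, mul_mul_mul_comm N⁻¹ _ N⁻¹]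
      refine congrArg _ (hphase _ _ _ _ ?_)
      simp only [map_add, LinearMap.add_apply]
      ring
    · rw [star_mul', star_mul', star_chi, star_chi, star_inv₀, hstar, mul_mul_mul_comm,
        mul_mul_mul_comm N⁻¹ _ N⁻¹]
      refine congrArg _ (hphase _ _ _ _ ?_)
      simp only [map_add, LinearMap.add_apply]
      ring
    · rw [star_mul', star_mul', star_chi, star_chi, star_inv₀, hstar, mul_mul_mul_comm,
        mul_mul_mul_comm N⁻¹ _ N⁻¹]
      refine congrArg _ (hphase _ _ _ _ ?_)
      simp only [map_add, LinearMap.add_apply]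
      ring
    · rw [star_mul', star_chi, star_inv₀, hstar, mul_mul_mul_comm, chi_mul_chi_neg, mul_one,
        card_phase, mul_inv]
    · rw [map_zero, mul_zero, chi_zero, mul_one, mul_inv_cancel₀ h0]
    · rw [map_zero, LinearMap.zero_apply, mul_zero, chi_zero, mul_one, mul_inv_cancel₀ h0]
  -- The products of basis vectors and the unit are identified inside the faithful representation
  -- `polRep`, where they become products of displacement operators.
  refine hk.isHilbFrobenius b (fun u v => (polRep_bijective d hd).1 ?_)
    ((polRep_bijective d hd).1 ?_)
  · rw [polRep_polMul d hd, hrep, hrep, map_sum,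
      Finset.sum_eq_single_of_mem (u + v) (Finset.mem_univ _), if_pos rfl, map_smul, hrep,
      Matrix.smul_mul, Matrix.mul_smul, displacement_mul d hd, smul_smul, smul_smul, smul_smul]
    · congr 1
      ring
    · intro w _ hw
      rw [if_neg hw, zero_smul, map_zero]
  · rw [polRep_polUnit, map_sum, Finset.sum_eq_single_of_mem 0 (Finset.mem_univ _), if_pos rfl,
      map_smul, hrep, smul_smul, mul_inv_cancel₀ h0, one_smul, displacement_zero]
    intro w _ hw
    rw [if_neg hw, zero_smul, map_zero]

section QuantMap
variable {κ l : Type} [Fintype κ] [DecidableEq κ] [Fintype l] [DecidableEq l]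

theorem polRep_quantMap (r : SetRel (Ph d ι) (Ph d κ)) (a : polarized d ι) :
    polRep d (quantMap d r a) = weylOp d (push d r (symbol d a)) := by
  rw [quantMap, polRep_apply]
  exact congrArg _ (symbol_quantize d _)

theorem quantMap_comp_apply (r : SetRel (Ph d ι) (Ph d κ)) (s : SetRel (Ph d κ) (Ph d l))
    (a : polarized d ι) :
    quantMap d s (quantMap d r a) = quantize d (push d s (push d r (symbol d a))) := by
  simp only [quantMap, LinearMap.comp_apply, symbol_quantize]

theorem quantMap_graphRel_trans (τ : Ph d ι ≃ Ph d κ) (τ' : Ph d κ ≃ Ph d l) :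
    quantMap d (graphRel (τ.trans τ')) = quantMap d (graphRel τ') ∘ₗ quantMap d (graphRel τ) := by
  refine LinearMap.ext fun a => ?_
  rw [LinearMap.comp_apply, quantMap_comp_apply, push_graphRel, push_graphRel]
  simp only [quantMap, LinearMap.comp_apply, push_graphRel]
  rfl

theorem quantMap_id : quantMap d (SetRel.id : SetRel (Ph d ι) (Ph d ι)) = LinearMap.id := by
  have : (SetRel.id : SetRel (Ph d ι) (Ph d ι)) = graphRel (Equiv.refl _) := rfl
  refine LinearMap.ext fun a => ?_
  rw [this, quantMap, LinearMap.comp_apply, LinearMap.comp_apply, push_graphRel]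
  exact quantize_symbol d a

theorem exists_quantMap_comp {r : SetRel (Ph d ι) (Ph d κ)} {s : SetRel (Ph d κ) (Ph d l)}
    (hr : IsAffineRel r) (hs : IsAffineRel s) : ∃ c : ℝ, 0 < c ∧
      quantMap d s ∘ₗ quantMap d r = (c : ℂ) • quantMap d (r.comp s) := by
  obtain ⟨c, hc, h⟩ := push_comp d r s hr hs
  refine ⟨c, hc, LinearMap.ext fun a => ?_⟩
  rw [LinearMap.comp_apply, quantMap_comp_apply, h, map_smul]
  rfl

end QuantMap

theorem quantMap_isStabSuperop (hd : d ≠ 2) {n k : ℕ}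
    {r : SetRel (Ph d (Fin n)) (Ph d (Fin k))} (hr : Spek d r) :
    IsStabSuperop d (polRep d) (polRep d) (quantMap d r) := by
  obtain ⟨K, hK, c, hc, h⟩ := hr.exists_stab d hd
  -- The square root of the positive constant is absorbed into the operator, so that the
  -- superoperator is exact.
  refine ⟨((√c : ℝ) : ℂ) • K, Stab.smul _ hK, fun a => ?_⟩
  rw [polRep_quantMap, h, Matrix.conjTranspose_smul, Matrix.smul_mul, Matrix.smul_mul,
    Matrix.mul_smul, smul_smul, polRep_apply]
  congr 1
  rw [RCLike.star_def, Complex.conj_ofReal, ← Complex.ofReal_mul, Real.mul_self_sqrt hc.le]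

/-- Affine symplectic transformations are quantized by automorphisms of the Frobenius algebra,
which are implemented by Clifford unitaries. -/
theorem exists_clifford_quantMap (hd : d ≠ 2) {τ : Ph d ι ≃ Ph d ι}
    (hτ : IsAffineSymplectic d τ) : ∃ U : Matrix (Conf d ι) (Conf d ι) ℂ, IsClifford d U ∧
      ∀ a, polRep d (quantMap d (graphRel τ) a) = U * polRep d a * Uᴴ := by
  obtain ⟨U, hU, h⟩ := exists_clifford d hd hτ
  exact ⟨U, hU, fun a => by rw [polRep_quantMap, h, polRep_apply]⟩

section Automorphism
variable {T : polarized d ι →ₗ[ℂ] polarized d ι} {U : Matrix (Conf d ι) (Conf d ι) ℂ}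

theorem map_polMul_of_unitary (hd : d ≠ 2) (hU : Uᴴ * U = 1)
    (h : ∀ a, polRep d (T a) = U * polRep d a * Uᴴ) (a b : polarized d ι) :
    T (polMul d ι (a ⊗ₜ[ℂ] b)) = polMul d ι (T a ⊗ₜ[ℂ] T b) := by
  refine (polRep_bijective d hd).1 ?_
  rw [polRep_polMul d hd, h, h, h, polRep_polMul d hd]
  simp only [Matrix.mul_assoc]
  rw [← Matrix.mul_assoc Uᴴ U, hU, Matrix.one_mul]

theorem map_polUnit_of_unitary (hd : d ≠ 2) (hU : U * Uᴴ = 1)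
    (h : ∀ a, polRep d (T a) = U * polRep d a * Uᴴ) : T (polUnit d ι) = polUnit d ι := by
  refine (polRep_bijective d hd).1 ?_
  rw [h, polRep_polUnit, Matrix.mul_one, hU]

theorem inner_map_map_of_unitary {n : ℕ} (hd : d ≠ 2)
    {T : polarized d (Fin n) →ₗ[ℂ] polarized d (Fin n)}
    {U : Matrix (Conf d (Fin n)) (Conf d (Fin n)) ℂ} (hU : Uᴴ * U = 1)
    (h : ∀ a, polRep d (T a) = U * polRep d a * Uᴴ) (a b : polarized d (Fin n)) :
    inner ℂ (T a) (T b) = inner ℂ a b := by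
  have hR := polarized_isOperatorRep d hd n
  rw [hR.inner_eq, hR.inner_eq, h, h]
  congr 1
  have : (U * polRep d a * Uᴴ)ᴴ * (U * polRep d b * Uᴴ) =
      U * ((polRep d a)ᴴ * polRep d b * Uᴴ) := by
    simp only [Matrix.conjTranspose_mul, Matrix.conjTranspose_conjTranspose, Matrix.mul_assoc]
    rw [← Matrix.mul_assoc Uᴴ U, hU, Matrix.one_mul]
  rw [this, Matrix.trace_mul_comm, Matrix.mul_assoc, hU, Matrix.mul_one]

end Automorphism

/-- The quantization functor. -/
def quantFunctor (hF : ∀ n, IsHilbFrobenius (polMul d (Fin n)) (polUnit d (Fin n)))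
    (hR : ∀ n, IsOperatorRep d n (polMul d (Fin n)) (polUnit d (Fin n)) (polRep d))
    (hS : ∀ (n k : ℕ) (r : SetRel (Ph d (Fin n)) (Ph d (Fin k))), Spek d r →
      IsStabSuperop d (polRep d) (polRep d) (quantMap d r)) :
    EpiFrob d ⥤ CategoryTheory.Quotient (posScale d) where
  obj A := (Quotient.functor (posScale d)).obj (quantObj d A.n (hF A.n) (hR A.n))
  map {A B} r := (Quotient.functor (posScale d)).map
    (quantHom d hF hR (EpiFrobHom.rel r) (hS A.n B.n _ (EpiFrobHom.spek r)))
  map_id A := by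
    rw [← CategoryTheory.Functor.map_id]
    exact congrArg _ (StabFrobHom.ext (quantMap_id d))
  map_comp {A B C} r s := by
    rw [← CategoryTheory.Functor.map_comp]
    obtain ⟨c, hc, h⟩ := exists_quantMap_comp d (Spek.isAffineRel d (EpiFrobHom.spek r))
      (Spek.isAffineRel d (EpiFrobHom.spek s))
    -- The number of intermediate points is the positive scalar that the quotient forgets.
    exact CategoryTheory.Quotient.sound _ ⟨c, hc, h⟩

end PolarizedAlgebra
end EpiQuant

/-! ### The main theorem -/

theorem mainTheorem1 (d : ℕ) [Fact d.Prime] (hd : d ≠ 2) :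
    -- the toy algebras are special dagger Frobenius algebras in `Spek`
    (∀ n : ℕ, EpiQuant.IsRelFrobenius (EpiQuant.toyMul d (Fin n)) (EpiQuant.toyUnit d (Fin n)) ∧
      EpiQuant.Spek d (EpiQuant.joinRel d (EpiQuant.toyMul d (Fin n))) ∧
      EpiQuant.Spek d (EpiQuant.stateRel d (EpiQuant.toyUnit d (Fin n)))) ∧
    -- every Frobenius algebra in `Spek` is a symplectic groupoid ...
    (∀ A : EpiQuant.EpiFrob d, EpiQuant.IsSymplecticGroupoid d (EpiQuant.symp d (Fin A.n))
      A.mul (EpiQuant.elems A.unit)) ∧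
    -- ... and embeds in its endomorphism monoid, i.e. in the pair groupoid
    (∀ A : EpiQuant.EpiFrob d,
      A.mul.comp (EpiQuant.endEmbedding A.mul) =
        (EpiQuant.prodRel (EpiQuant.endEmbedding A.mul) (EpiQuant.endEmbedding A.mul)).comp
          (EpiQuant.pairMul (EpiQuant.Ph d (Fin A.n))) ∧
      A.unit.comp (EpiQuant.endEmbedding A.mul) = EpiQuant.cup (EpiQuant.Ph d (Fin A.n)) ∧
      (EpiQuant.endEmbedding A.mul).comp (EpiQuant.endEmbedding A.mul).inv = SetRel.id) ∧
    -- the pair groupoid is a symplectic groupoid with a groupoid polarization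
    (∀ n : ℕ, EpiQuant.IsSymplecticGroupoid d
        (EpiQuant.formSub d (EpiQuant.symp d (Fin n)) (EpiQuant.symp d (Fin n)))
        (EpiQuant.pairMul (EpiQuant.Ph d (Fin n))) {p | p.1 = p.2} ∧
      EpiQuant.IsGroupoidPolarization d
        (EpiQuant.formSub d (EpiQuant.symp d (Fin n)) (EpiQuant.symp d (Fin n)))
        (EpiQuant.pairMul (EpiQuant.Ph d (Fin n))) {p | p.1 = p.2}
        (EpiQuant.pairPolarization d (Fin n))) ∧
    -- its twisted polarized convolution algebra is the twisted group algebra generated by the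
    -- displacement operators, which represent the Heisenberg group projectively
    (∀ n : ℕ,
      (∀ f : EpiQuant.Ph d (Fin n) → ℂ, EpiQuant.symbol d (EpiQuant.quantize d f) = f) ∧
      (∀ a : EpiQuant.polarized d (Fin n),
        EpiQuant.quantize d (EpiQuant.symbol d a) = a ∧
        EpiQuant.polRep d a = ∑ u, a.1 (u, 0) • EpiQuant.displacement d u) ∧
      (∀ u v : EpiQuant.Ph d (Fin n),
        EpiQuant.displacement d u * EpiQuant.displacement d v =
          EpiQuant.chi d (2⁻¹ * EpiQuant.symp d (Fin n) v u) • EpiQuant.displacement d (u + v))) ∧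
    -- affine symplectic transformations are represented strictly functorially by automorphisms of
    -- the quantized algebra which are implemented by Clifford unitaries
    (∀ (n : ℕ) (τ : EpiQuant.Ph d (Fin n) ≃ EpiQuant.Ph d (Fin n)),
      EpiQuant.IsAffineSymplectic d τ →
      (∀ τ' : EpiQuant.Ph d (Fin n) ≃ EpiQuant.Ph d (Fin n), EpiQuant.IsAffineSymplectic d τ' →
        EpiQuant.quantMap d (EpiQuant.graphRel (τ.trans τ')) =
          EpiQuant.quantMap d (EpiQuant.graphRel τ') ∘ₗ
            EpiQuant.quantMap d (EpiQuant.graphRel τ)) ∧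
      (∀ a b, EpiQuant.quantMap d (EpiQuant.graphRel τ)
          (EpiQuant.polMul d (Fin n) (a ⊗ₜ[ℂ] b)) =
        EpiQuant.polMul d (Fin n) (EpiQuant.quantMap d (EpiQuant.graphRel τ) a ⊗ₜ[ℂ]
          EpiQuant.quantMap d (EpiQuant.graphRel τ) b)) ∧
      EpiQuant.quantMap d (EpiQuant.graphRel τ) (EpiQuant.polUnit d (Fin n)) =
        EpiQuant.polUnit d (Fin n) ∧
      (∀ a b, inner ℂ (EpiQuant.quantMap d (EpiQuant.graphRel τ) a)
        (EpiQuant.quantMap d (EpiQuant.graphRel τ) b) = inner ℂ a b) ∧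
      ∃ U : Matrix (EpiQuant.Conf d (Fin n)) (EpiQuant.Conf d (Fin n)) ℂ,
        EpiQuant.IsClifford d U ∧
        ∀ a, EpiQuant.polRep d (EpiQuant.quantMap d (EpiQuant.graphRel τ) a) =
          U * EpiQuant.polRep d a * Uᴴ) ∧
    -- the multiplication and unit of a toy Frobenius algebra quantize to the superoperators of
    -- a special dagger Frobenius algebra of stabilizer quantum mechanics on `ℂ^(dⁿ)`
    (∀ A : EpiQuant.EpiFrob d,
      ∃ (mul : EuclideanSpace ℂ (EpiQuant.Conf d (Fin A.n)) ⊗[ℂ]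
          EuclideanSpace ℂ (EpiQuant.Conf d (Fin A.n)) →ₗ[ℂ]
            EuclideanSpace ℂ (EpiQuant.Conf d (Fin A.n)))
        (unit : EuclideanSpace ℂ (EpiQuant.Conf d (Fin A.n))),
        EpiQuant.IsHilbFrobenius mul unit ∧
        EpiQuant.Stab d (EpiQuant.mulMatrix d mul) ∧ EpiQuant.Stab d (EpiQuant.vecMatrix d unit) ∧
        (∃ c : ℝ, 0 < c ∧ ∀ f : EpiQuant.Ph d (Fin A.n ⊕ Fin A.n) → ℂ,
          EpiQuant.weylOp d (EpiQuant.push d (EpiQuant.joinRel d A.mul) f) =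
            (c : ℂ) • (EpiQuant.mulMatrix d mul * EpiQuant.weylOp d f *
              (EpiQuant.mulMatrix d mul)ᴴ)) ∧
        ∃ c : ℝ, 0 < c ∧ ∀ f : EpiQuant.Ph d Empty → ℂ,
          EpiQuant.weylOp d (EpiQuant.push d (EpiQuant.stateRel d A.unit) f) =
            (c : ℂ) • (EpiQuant.vecMatrix d unit * EpiQuant.weylOp d f *
              (EpiQuant.vecMatrix d unit)ᴴ)) ∧
    -- quantization is a functor from the Frobenius algebras in `Rel` of the epistricted theory to
    -- the dagger Frobenius algebras in `Hilb` of stabilizer quantum mechanics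
    ∃ (hF : ∀ n : ℕ, EpiQuant.IsHilbFrobenius (EpiQuant.polMul d (Fin n))
        (EpiQuant.polUnit d (Fin n)))
      (hR : ∀ n : ℕ, EpiQuant.IsOperatorRep d n (EpiQuant.polMul d (Fin n))
        (EpiQuant.polUnit d (Fin n)) (EpiQuant.polRep d))
      (hS : ∀ (n k : ℕ) (r : SetRel (EpiQuant.Ph d (Fin n)) (EpiQuant.Ph d (Fin k))),
        EpiQuant.Spek d r → EpiQuant.IsStabSuperop d (EpiQuant.polRep d) (EpiQuant.polRep d)
          (EpiQuant.quantMap d r))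
      (F : CategoryTheory.Functor (EpiQuant.EpiFrob d)
        (CategoryTheory.Quotient (EpiQuant.posScale d)))
      (hobj : ∀ A : EpiQuant.EpiFrob d,
        F.obj A = (CategoryTheory.Quotient.functor (EpiQuant.posScale d)).obj
          (EpiQuant.quantObj d A.n (hF A.n) (hR A.n))),
      ∀ (A B : EpiQuant.EpiFrob d) (r : A ⟶ B),
        F.map r = CategoryTheory.eqToHom (hobj A) ≫
          (CategoryTheory.Quotient.functor (EpiQuant.posScale d)).map
            (EpiQuant.quantHom d hF hR (EpiQuant.EpiFrobHom.rel r)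
              (hS A.n B.n _ (EpiQuant.EpiFrobHom.spek r))) ≫
          CategoryTheory.eqToHom (hobj B).symm := by
  have hF := fun n => EpiQuant.polarized_isHilbFrobenius d hd (ι := Fin n)
  have hR := EpiQuant.polarized_isOperatorRep d hd
  have hS := fun (n k : ℕ) (r : SetRel (EpiQuant.Ph d (Fin n)) (EpiQuant.Ph d (Fin k))) hr =>
    EpiQuant.quantMap_isStabSuperop d hd (r := r) hr
  refine ⟨fun n => ⟨EpiQuant.toyMul_isRelFrobenius d _, EpiQuant.Spek.toyMul d _,
    EpiQuant.Spek.toyUnit d _⟩, EpiQuant.EpiFrob.isSymplecticGroupoid d,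
    fun A => ⟨A.isFrob.mul_comp_endEmbedding, A.isFrob.unit_comp_endEmbedding,
      A.isFrob.endEmbedding_comp_inv⟩,
    fun n => ⟨EpiQuant.pairMul_isSymplecticGroupoid d _,
      EpiQuant.pairPolarization_isGroupoidPolarization d _⟩,
    fun n => ⟨EpiQuant.symbol_quantize d, fun a => ⟨EpiQuant.quantize_symbol d a,
      EpiQuant.polRep_eq_sum d a⟩, EpiQuant.displacement_mul d hd⟩,
    fun n τ hτ => ?_, EpiQuant.EpiFrob.exists_isHilbFrobenius d hd,
    hF, hR, hS, EpiQuant.quantFunctor d hF hR hS, fun A => rfl, fun A B r => ?_⟩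
  · obtain ⟨U, hU, h⟩ := EpiQuant.exists_clifford_quantMap d hd hτ
    have hl := Matrix.mem_unitaryGroup_iff'.1 hU.1
    have hr := Matrix.mem_unitaryGroup_iff.1 hU.1
    exact ⟨fun τ' _ => EpiQuant.quantMap_graphRel_trans d τ τ',
      EpiQuant.map_polMul_of_unitary d hd hl h, EpiQuant.map_polUnit_of_unitary d hd hr h,
      EpiQuant.inner_map_map_of_unitary d hd hl h, U, hU, h⟩
  -- The functor has the prescribed objects definitionally, so the transports are identities.
  · exact ((CategoryTheory.Category.id_comp _).trans (CategoryTheory.Category.comp_id _)).symm
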